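/- **Setting.** Let $2\le\sigma\le d$, $\mathfrak s_c=\frac{d-\sigma}{2}$. Let $m\in C^\infty(\mathbb R^d;\mathbb R)$ be a symbol of order $\sigma$: for some $C_{\max},C_L\ge 1$ and all $|\xi|\ge C_{\max}$, $|\partial^\alpha m(\xi)|\le C_L|\xi|^{\sigma-|\alpha|}$ for $|\alpha|\in\{1,2,3\}$, $|\nabla m(\xi)|\ge C_L^{-1}|\xi|^{\sigma-1}$ and $|\det D^2m(\xi)|^{1/d}\ge C_L^{-1}|\xi|^{\sigma-2}$. *Sectors.* Fix $\epsilon_\Theta\in(0,1]$, a finite set $\mathscr S$ of unit vectors with mutual distances $\ge\epsilon_\Theta$ whose open $\epsilon_\Theta$-balls cover $\mathbb S^{d-1}$, and a smooth non-increasing $\chi:[0,\infty)\to[0,\infty)$ with $\chi=1$ on $[0,1]$, $\chi\ge\frac12$ on $[0,\sqrt{1+\epsilon_\Theta}]$, $\chi=0$ on $[1+\epsilon_\Theta,\infty)$. Sectors $\theta\in\Theta$ are indexed by pairs $(N_\theta,\hat e_\theta)$ with $N_\theta\in\{(1+\epsilon_\Theta)^k:k\ge0\}$, $\hat e_\theta\in\mathscr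 S$. For $N=N_\theta>1$, $\theta=\{1\le|\xi|/N\le(1+\epsilon_\Theta)^2,\ |\xi/|\xi|-\hat e_\theta|\le2\epsilon_\Theta\}$ and $c_\theta=N\hat e_\theta$; for $N_\theta=1$, $\theta=\{|\xi|\le(1+\epsilon_\Theta)^2\}$ and $c_\theta=0$. Let $P_\theta$ be the Fourier multiplier in $x$ with symbol $\chi_\theta$, where $$\chi_\theta(\xi)=\Big[\chi\Big(\tfrac{|\xi|}{(1+\epsilon_\Theta)N_\theta}\Big)-\chi\Big(\tfrac{|\xi|}{N_\theta}\Big)\Big]\frac{\chi\big(\frac{|\xi/|\xi|-\hat e_\theta|}{2\epsilon_\Theta}\big)}{\sum_{\hat e\in\mathscr S}\chi\big(\frac{|\xi/|\xi|-\hat e|}{2\epsilon_\Theta}\big)}\ \ (N_\theta>1),\qquad \chi_\theta(\xi)=\frac1{|\mathscr S|}\chi\Big(\tfrac{|\xi|}{1+\epsilon_\Theta}\Big)\ \ (N_\theta=1),$$ so that $\sum_\theta\chi_\theta=1$. *Bases.* Let $\theta\mapsto\mathscr O_\theta\in O(d)$ have finite range $\mathscr O(\Theta)$ and satisfy, for some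 $C_{\mathscr O}\ge1$ and all $j$, all $\theta$ with $N_\theta\ge2C_{\max}$ and all $\xi\in\theta$: $C_{\mathscr O}^{-1}N_\theta^{\sigma-2}\le|\langle\mathscr O_\theta\hat e_j,D^2m(\xi)\mathscr O_\theta\hat e_j\rangle|\le C_{\mathscr O}N_\theta^{\sigma-2}$, $C_{\mathscr O}^{-1}N_\theta^{\sigma-1}\le|\langle\nabla m(\xi),\mathscr O_\theta\hat e_j\rangle|\le C_{\mathscr O}N_\theta^{\sigma-1}$, $|\langle\xi,\mathscr O_\theta\hat e_j\rangle|\ge C_{\mathscr O}^{-1}N_\theta$. Put $J_\theta(O)=\{j:|\langle\nabla m(c_\theta),O\hat e_j\rangle|\ge d^{-1/2}|\nabla m(c_\theta)|\}$. *Norms* (over $\mathbb R\times\mathbb R^d$). For $O\in O(d)$, $1\le j\le d$, let $\|v\|_{L^{(a,b,c)}_{O,j}}$ be the norm $L^a_{x_1}L^b_tL^c_{x'}$ (innermost $x'\in\mathbb R^{d-1}$) of $v(t,OS_j(x_1,x'))$, where $S_j$ swaps $\hat e_1$ and $\hat e_j$. For $\epsilon_0>0$ small put $p=\frac2{\epsilon_0}$,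 $q=\frac2{1-\epsilon_0}$, $\rho=\frac{2d}{d-2}\frac1{1-\epsilon_0}$ ($\rho=\infty$ if $d=2$), and $$\|v\|_{X_\theta}=\|v\|_{L^p_tL^q_x}+\|v\|_{L^q_tL^\rho_x}+\sum_{j=1}^d\Big(N_\theta^{-\frac\sigma4}\|v\|_{L^{(q,p,q)}_{\mathscr O_\theta,j}}+N_\theta^{-\frac{d-1}2}\|v\|_{L^{(q,p,p)}_{\mathscr O_\theta,j}}\Big)+\sum_{O\in\mathscr O(\Theta)}\sum_{j\in J_\theta(O)}\Big(N_\theta^{\frac{\sigma-1}2}\|v\|_{L^{(p,q,q)}_{O,j}}+N_\theta^{-\frac{d-\sigma}2}\|v\|_{L^{(p,q,p)}_{O,j}}\Big).$$ $\|v\|_{Y_\theta}$ is defined likewise with $N_\theta^{-(d-1)/2}$ replaced by $N_\theta^{-\sigma/4}$ and $N_\theta^{-(d-\sigma)/2}$ replaced by $N_\theta^{(\sigma-1)/2}$. Let $\|h\|_{X_\theta^*}=\sup\{|\int gh\,dt\,dx|:\|g\|_{X_\theta}\le1\}$, and for $r\in\mathbb R$ $$\|v\|_{X^r}^2=\sum_\theta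 N_\theta^{2r}\|P_\theta v\|_{X_\theta}^2,\quad\|v\|_{Y^r}^2=\sum_\theta N_\theta^{2r}\|P_\theta v\|_{Y_\theta}^2,\quad\|h\|_{X^{*,r}}^2=\sum_\theta N_\theta^{2r}\|P_\theta h\|_{X^*_\theta}^2.$$ The $z_j,v_j$ below are arbitrary (weakly measurable) functions of $t\in\mathbb R$ with values in the tempered distributions on $\mathbb R^d$ for which the norms on the right-hand side are finite; products are understood as limits, in the sense of distributions for almost every $t$, of the products of the frequency truncations $\sum_{N_\theta\le(1+\epsilon_\Theta)^M}P_\theta z_j$, etc., as $M\to\infty$. **Proposition 5.3.** Fix $\frac13-\frac\sigma4<S_1\le S_2\le S_3<\mathfrak s_c<\mathfrak s$. For all sufficiently small $\epsilon>0$ (depending on $d,\sigma,S_j,\mathfrak s$) and all sufficiently small $\epsilon_0>0$ (depending also on $\epsilon$), for all $m$, $\Theta$, $\mathscr O$ as above, there is a constant $C$, independent of $\sigma_*$ and of $z_j,v_j$, such that in each of the following cases the product on the left exists and the estimate holds: - ($zzz$) $\|z_1z_2z_3\|_{X^{*,\sigma_*}}\le C\|z_1\|_{Y^{S_1+\epsilon}}\|z_2\|_{Y^{S_2+\epsilon}}\|z_3\|_{Y^{S_3+\epsilon}}$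 if $\sigma_*\le S_1+\min(S_2,\frac\sigma4)+\min(S_3,\frac\sigma4)+\frac{\sigma-2}2$; - ($zzv$) $\|z_1z_2v_3\|_{X^{*,\sigma_*}}\le C\|z_1\|_{Y^{S_1+\epsilon}}\|z_2\|_{Y^{S_2+\epsilon}}\|v_3\|_{X^{\mathfrak s+\epsilon}}$ if $\sigma_*\le S_1+\min(S_2,\frac\sigma4)+\min(\mathfrak s,\frac\sigma4)+\frac{\sigma-2}2$; - ($zvv$) $\|z_1v_2v_3\|_{X^{*,\sigma_*}}\le C\|z_1\|_{Y^{S_1+\epsilon}}\|v_2\|_{X^{\mathfrak s+\epsilon}}\|v_3\|_{X^{\mathfrak s+\epsilon}}$ if $\sigma_*\le\min\big(2\mathfrak s-\mathfrak s_c+\frac{\sigma-2}4+\min(\frac\sigma4,S_1),\,S_1+\sigma-1\big)$; - ($vvv$) $\|v_1v_2v_3\|_{X^{*,\sigma_*}}\le C\|v_1\|_{X^{\mathfrak s+\epsilon}}\|v_2\|_{X^{\mathfrak s+\epsilon}}\|v_3\|_{X^{\mathfrak s+\epsilon}}$ if $\mathfrak s<\mathfrak s_c+\frac{\sigma-1}2$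 and $\sigma_*\le\mathfrak s+2(\mathfrak s-\mathfrak s_c)$. -/

import Mathlib

open MeasureTheory Filter Topology
open scoped ENNReal NNReal SchwartzMap FourierTransform ContDiff

noncomputable section

namespace DirectionalNLS

/-- Physical and frequency space `ℝ^d` with its Euclidean norm. -/
abbrev Space (d : ℕ) := EuclideanSpace ℝ (Fin d)

/-- The orthogonal group `O(d)`. -/
abbrev Orth (d : ℕ) := Matrix.orthogonalGroup (Fin d) ℝ

/-- The standard basis vector `ê_j`. -/
def stdVec {d : ℕ} (j : Fin d) : Space d := EuclideanSpace.single j 1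

/-- The action `y ↦ O y` of an orthogonal matrix on `ℝ^d`. -/
def rot {d : ℕ} (O : Orth d) (y : Fin d → ℝ) : Space d :=
  WithLp.toLp 2 ((O : Matrix (Fin d) (Fin d) ℝ).mulVec y)

/-- The vector `O ê_j`, the `j`-th column of `O`. -/
def col {d : ℕ} (O : Orth d) (j : Fin d) : Space d := rot O (Pi.single j 1)

/-! ### Symbols of order `σ` -/

/-- The Hessian matrix `D²m(ξ)`. -/
def hessian {d : ℕ} (m : Space d → ℝ) (ξ : Space d) : Matrix (Fin d) (Fin d) ℝ :=
  Matrix.of fun i j => iteratedFDeriv ℝ 2 m ξ ![stdVec i, stdVec j]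

/-- `m` is a (real-valued, smooth) symbol of order `σ` with constants `Cmax, CL ≥ 1`.
The partial derivatives `∂^α m` with `|α| = k` are the values of the `k`-th derivative on
`k`-tuples of standard basis vectors. -/
structure IsSymbol {d : ℕ} (σ : ℝ) (m : Space d → ℝ) (Cmax CL : ℝ) : Prop where
  one_le_Cmax : 1 ≤ Cmax
  one_le_CL : 1 ≤ CL
  smooth : ContDiff ℝ ∞ m
  deriv_le : ∀ k : ℕ, 1 ≤ k → k ≤ 3 → ∀ α : Fin k → Fin d, ∀ ξ : Space d, Cmax ≤ ‖ξ‖ →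
    |iteratedFDeriv ℝ k m ξ (fun i => stdVec (α i))| ≤ CL * ‖ξ‖ ^ (σ - k)
  le_gradient : ∀ ξ : Space d, Cmax ≤ ‖ξ‖ → CL⁻¹ * ‖ξ‖ ^ (σ - 1) ≤ ‖gradient m ξ‖
  le_hessian : ∀ ξ : Space d, Cmax ≤ ‖ξ‖ →
    CL⁻¹ * ‖ξ‖ ^ (σ - 2) ≤ |(hessian m ξ).det| ^ (1 / (d : ℝ))

/-! ### Sectors and sector projections -/

/-- The data behind a collection of sectors and its partition of unity: the resolution
`ε_Θ ∈ (0, 1]`, the finite `ε_Θ`-separated `ε_Θ`-net of unit vectors, and the cut-off `χ`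
(only its values on `[0, ∞)` matter). -/
structure Sectors (d : ℕ) where
  res : ℝ
  res_pos : 0 < res
  res_le_one : res ≤ 1
  dirs : Finset (Space d)
  norm_dirs : ∀ e ∈ dirs, ‖e‖ = 1
  cover : ∀ u : Space d, ‖u‖ = 1 → ∃ e ∈ dirs, ‖u - e‖ < res
  separated : ∀ e ∈ dirs, ∀ e' ∈ dirs, e ≠ e' → res ≤ ‖e - e'‖
  χ : ℝ → ℝ
  χ_smooth : ContDiffOn ℝ ∞ χ (Set.Ici 0)
  χ_antitone : AntitoneOn χ (Set.Ici 0)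
  χ_nonneg : ∀ r, 0 ≤ r → 0 ≤ χ r
  χ_eq_one : ∀ r, 0 ≤ r → r ≤ 1 → χ r = 1
  half_le_χ : ∀ r, 0 ≤ r → r ≤ Real.sqrt (1 + res) → 1 / 2 ≤ χ r
  χ_eq_zero : ∀ r, 1 + res ≤ r → χ r = 0

namespace Sectors

variable {d : ℕ} (Θ : Sectors d)

/-- Sectors are indexed by `(k, ê)`; the frequency scale is `N = (1 + ε_Θ)^k`. -/
abbrev Index := ℕ × {e : Space d // e ∈ Θ.dirs}

variable {Θ} in
/-- The frequency scale `N_θ = (1 + ε_Θ)^k`. -/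
def scale (θ : Θ.Index) : ℝ := (1 + Θ.res) ^ θ.1

variable {Θ} in
/-- The center `c_θ` of a sector: `N_θ ê_θ` if `N_θ > 1`, and `0` if `N_θ = 1`. -/
def center (θ : Θ.Index) : Space d := if θ.1 = 0 then 0 else scale θ • θ.2.1

variable {Θ} in
/-- The sector `θ` as a subset of `ℝ^d`. -/
def carrier (θ : Θ.Index) : Set (Space d) :=
  if θ.1 = 0 then {ξ | ‖ξ‖ ≤ (1 + Θ.res) ^ 2}
  else {ξ | 1 ≤ ‖ξ‖ / scale θ ∧ ‖ξ‖ / scale θ ≤ (1 + Θ.res) ^ 2 ∧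
    ‖‖ξ‖⁻¹ • ξ - θ.2.1‖ ≤ 2 * Θ.res}

/-- The radial multiplier at scale `N = (1 + ε_Θ)^k`; these sum to `1` over `k`. -/
def radial (k : ℕ) (ξ : Space d) : ℝ :=
  if k = 0 then Θ.χ (‖ξ‖ / (1 + Θ.res))
  else Θ.χ (‖ξ‖ / ((1 + Θ.res) * (1 + Θ.res) ^ k)) - Θ.χ (‖ξ‖ / (1 + Θ.res) ^ k)

/-- The angular multiplier around the direction `ê`; these sum to `1` over `ê` for `ξ ≠ 0`. -/
def angular (e : Space d) (ξ : Space d) : ℝ :=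
  Θ.χ (‖‖ξ‖⁻¹ • ξ - e‖ / (2 * Θ.res)) /
    ∑ e' ∈ Θ.dirs, Θ.χ (‖‖ξ‖⁻¹ • ξ - e'‖ / (2 * Θ.res))

variable {Θ} in
/-- The multiplier `χ_θ` of the sector projection `P_θ`. -/
def mult (θ : Θ.Index) (ξ : Space d) : ℝ :=
  if θ.1 = 0 then (Θ.dirs.card : ℝ)⁻¹ * Θ.radial 0 ξ
  else Θ.radial θ.1 ξ * Θ.angular θ.2.1 ξ

lemma one_lt : 1 < 1 + Θ.res := by linarith [Θ.res_pos]

lemma one_add_pos : 0 < 1 + Θ.res := by linarith [Θ.res_pos]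

/-- `ξ ↦ χ(|ξ - e| / a)` is smooth, as `χ = 1` near `0`. -/
lemma contDiff_bump (e : Space d) {a : ℝ} (ha : 0 < a) :
    ContDiff ℝ ∞ fun ξ : Space d => Θ.χ (‖ξ - e‖ / a) := by
  rw [contDiff_iff_contDiffAt]
  intro ξ
  by_cases h : ξ = e
  · subst h
    have hev : (fun η : Space d => Θ.χ (‖η - ξ‖ / a)) =ᶠ[𝓝 ξ] fun _ => 1 := by
      filter_upwards [Metric.ball_mem_nhds ξ ha] with η hη
      rw [Metric.mem_ball, dist_eq_norm] at hη
      exact Θ.χ_eq_one _ (by positivity) ((div_le_one ha).2 hη.le)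
    exact contDiffAt_const.congr_of_eventuallyEq hev
  · have hpos : 0 < ‖ξ - e‖ / a := div_pos (norm_pos_iff.2 (sub_ne_zero.2 h)) ha
    have h1 : ContDiffAt ℝ ∞ Θ.χ (‖ξ - e‖ / a) :=
      (Θ.χ_smooth _ hpos.le).contDiffAt (Ici_mem_nhds hpos)
    have h2 : ContDiffAt ℝ ∞ (fun η : Space d => ‖η - e‖ / a) ξ :=
      ((contDiffAt_id.sub contDiffAt_const).norm ℝ (sub_ne_zero.2 h)).div_const a
    exact ContDiffAt.comp (f := fun η : Space d => ‖η - e‖ / a) ξ h1 h2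

lemma contDiff_radial (k : ℕ) : ContDiff ℝ ∞ (Θ.radial k) := by
  have key : ∀ {a : ℝ}, 0 < a → ContDiff ℝ ∞ fun ξ : Space d => Θ.χ (‖ξ‖ / a) := by
    intro a ha
    simpa using Θ.contDiff_bump 0 ha
  have hp := Θ.one_add_pos
  unfold radial
  by_cases h : k = 0
  · simpa only [h, if_true] using key hp
  · simpa only [h, if_false] using
      (key (mul_pos hp (pow_pos hp k))).sub (key (pow_pos hp k))

lemma angular_denom_pos {ξ : Space d} (hξ : ξ ≠ 0) :
    0 < ∑ e' ∈ Θ.dirs, Θ.χ (‖‖ξ‖⁻¹ • ξ - e'‖ / (2 * Θ.res)) := by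
  have hr := Θ.res_pos
  have hu : ‖‖ξ‖⁻¹ • ξ‖ = 1 := norm_smul_inv_norm (𝕜 := ℝ) hξ
  obtain ⟨e, he, hlt⟩ := Θ.cover _ hu
  refine Finset.sum_pos' (fun e' _ => Θ.χ_nonneg _ (by positivity)) ⟨e, he, ?_⟩
  rw [Θ.χ_eq_one _ (by positivity) ((div_le_one (by positivity)).2 (by linarith))]
  exact one_pos

lemma contDiffAt_angular (e : Space d) {ξ : Space d} (hξ : ξ ≠ 0) :
    ContDiffAt ℝ ∞ (Θ.angular e) ξ := by
  have h2r : 0 < 2 * Θ.res := by linarith [Θ.res_pos]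
  have hdir : ContDiffAt ℝ ∞ (fun η : Space d => ‖η‖⁻¹ • η) ξ :=
    ((contDiffAt_norm ℝ hξ).inv (norm_ne_zero_iff.2 hξ)).smul contDiffAt_id
  have hb : ∀ e' : Space d,
      ContDiffAt ℝ ∞ (fun η : Space d => Θ.χ (‖‖η‖⁻¹ • η - e'‖ / (2 * Θ.res))) ξ := fun e' =>
    ContDiffAt.comp (g := fun u : Space d => Θ.χ (‖u - e'‖ / (2 * Θ.res))) ξ
      (Θ.contDiff_bump e' h2r).contDiffAt hdir
  exact (hb e).div (ContDiffAt.sum fun e' _ => hb e') (Θ.angular_denom_pos hξ).ne'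

lemma contDiff_mult (θ : Θ.Index) : ContDiff ℝ ∞ (mult θ) := by
  unfold mult
  by_cases h : θ.1 = 0
  · simpa only [h, if_true] using contDiff_const.mul (Θ.contDiff_radial 0)
  · simp only [h, if_false]
    rw [contDiff_iff_contDiffAt]
    intro ξ
    by_cases hξ : ξ = 0
    · subst hξ
      have hp := Θ.one_add_pos
      have hN : 1 ≤ (1 + Θ.res) ^ θ.1 := one_le_pow₀ Θ.one_lt.le
      have hev : (fun η : Space d => Θ.radial θ.1 η * Θ.angular θ.2.1 η) =ᶠ[𝓝 0]
          fun _ => 0 := by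
        filter_upwards [Metric.ball_mem_nhds (0 : Space d) one_pos] with η hη
        rw [mem_ball_zero_iff] at hη
        have h1 : ‖η‖ / (1 + Θ.res) ^ θ.1 ≤ 1 := (div_le_one (by positivity)).2 (by linarith)
        have h2 : ‖η‖ / ((1 + Θ.res) * (1 + Θ.res) ^ θ.1) ≤ 1 := by
          refine (div_le_one (by positivity)).2 ?_
          nlinarith [Θ.one_lt]
        simp only [radial, h, if_false]
        rw [Θ.χ_eq_one _ (by positivity) h1, Θ.χ_eq_one _ (by positivity) h2]
        simp
      exact contDiffAt_const.congr_of_eventuallyEq hev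
    · exact (Θ.contDiff_radial _).contDiffAt.mul (Θ.contDiffAt_angular _ hξ)

lemma radial_eq_zero (k : ℕ) {ξ : Space d} (hξ : (1 + Θ.res) ^ 2 * (1 + Θ.res) ^ k < ‖ξ‖) :
    Θ.radial k ξ = 0 := by
  have hp := Θ.one_add_pos
  have hl := Θ.one_lt
  have hk : 0 < (1 + Θ.res) ^ k := pow_pos hp k
  unfold radial
  by_cases h : k = 0
  · simp only [h, if_true, pow_zero, mul_one] at hξ ⊢
    exact Θ.χ_eq_zero _ ((le_div_iff₀ hp).2 (by nlinarith))
  · simp only [h, if_false]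
    rw [Θ.χ_eq_zero _ ((le_div_iff₀ (mul_pos hp hk)).2 (by nlinarith)),
      Θ.χ_eq_zero _ ((le_div_iff₀ hk).2 (by nlinarith [mul_pos hp hk])), sub_zero]

lemma hasCompactSupport_mult (θ : Θ.Index) : HasCompactSupport (mult θ) := by
  refine HasCompactSupport.intro
    (isCompact_closedBall (0 : Space d) ((1 + Θ.res) ^ 2 * (1 + Θ.res) ^ θ.1)) ?_
  intro ξ hξ
  rw [mem_closedBall_zero_iff, not_le] at hξ
  unfold mult
  by_cases h : θ.1 = 0
  · rw [h] at hξ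
    simp only [h, if_true, Θ.radial_eq_zero 0 hξ, mul_zero]
  · simp only [h, if_false, Θ.radial_eq_zero _ hξ, zero_mul]

variable {Θ} in
/-- The multiplier `χ_θ` as a complex-valued Schwartz function. -/
def multSchwartz (θ : Θ.Index) : 𝓢(Space d, ℂ) :=
  HasCompactSupport.toSchwartzMap (f := fun ξ => (mult θ ξ : ℂ))
    ((Θ.hasCompactSupport_mult θ).comp_left (g := Complex.ofReal) Complex.ofReal_zero)
    (Complex.ofRealCLM.contDiff.comp (Θ.contDiff_mult θ))

end Sectors

/-! ### Space-time functions and distributions -/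

/-- A time-dependent family of tempered distributions on `ℝ^d`. -/
abbrev Field (d : ℕ) := ℝ → 𝓢'(Space d, ℂ)

/-- Measurability in time: `t ↦ ⟨z(t), φ⟩` is measurable for every test function. -/
def Field.IsMeasurable {d : ℕ} (z : Field d) : Prop :=
  ∀ φ : 𝓢(Space d, ℂ), Measurable fun t => z t φ

variable {d : ℕ}

/-- The sector projection: the Fourier multiplier `χ_θ` in the space variable. It maps `z(t)` to
the smooth function `P_θ z (t, x) = ⟨𝓕 z(t), χ_θ e^{2πi x·}⟩ = ⟨z(t), (𝓕 χ_θ)(· - x)⟩`, which is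
the convolution of `z(t)` with the kernel `𝓕⁻¹ χ_θ = (𝓕 χ_θ)(-·)`. -/
def proj {Θ : Sectors d} (θ : Θ.Index) (z : Field d) (t : ℝ) (x : Space d) : ℂ :=
  z t ((𝓕 (Sectors.multSchwartz θ)).compSubConstCLM ℂ x)

/-- The truncation `∑ P_θ z` over all sectors with `N_θ ≤ (1 + ε_Θ)^M`. -/
def lowFreq (Θ : Sectors d) (M : ℕ) (z : Field d) (t : ℝ) (x : Space d) : ℂ :=
  ∑ k ∈ Finset.range (M + 1), ∑ e ∈ Θ.dirs.attach, proj (Θ := Θ) (k, e) z t x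

/-- `h = u₁ u₂ u₃`: for almost every time, the products of the (smooth) frequency truncations of
the factors converge to `h(t)` in the sense of tempered distributions. For factors that are
functions with values in `L³(ℝ^d)` this is the pointwise product. -/
def IsProduct (Θ : Sectors d) (u₁ u₂ u₃ h : Field d) : Prop :=
  ∀ᵐ t : ℝ, ∀ φ : 𝓢(Space d, ℂ),
    Tendsto (fun M : ℕ => ∫ x, lowFreq Θ M u₁ t x * lowFreq Θ M u₂ t x * lowFreq Θ M u₃ t x * φ x)
      atTop (𝓝 (h t φ))

/-! ### Norms -/

/-- The norm of `L_t^q L_x^p (I × ℝ^d)`. -/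
def mixedNorm (q p : ℝ≥0∞) (I : Set ℝ) (v : ℝ → Space d → ℂ) : ℝ≥0∞ :=
  eLpNorm (fun t => eLpNorm (v t) p volume) q (volume.restrict I)

/-- The point `O S_j (x₁, x')` for `x₁ ∈ ℝ`, `x' ∈ ℝ^{d-1}`: its coordinate along `O ê_j` is `x₁`,
and its coordinates along the other columns of `O` are given by `x'`. -/
def dirPoint (O : Orth d) (j : Fin d) (x₁ : ℝ) (x' : {k : Fin d // k ≠ j} → ℝ) : Space d :=
  rot O fun k => if h : k = j then x₁ else x' ⟨k, h⟩

/-- The directional norm of `L_{O,j}^{(a,b,c)}(I)`: exponent `a` in `x₁ ∈ ℝ` (outermost),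
exponent `b` in `t ∈ I`, exponent `c` in `x' ∈ ℝ^{d-1}` (innermost). -/
def dirNorm (O : Orth d) (j : Fin d) (a b c : ℝ≥0∞) (I : Set ℝ) (v : ℝ → Space d → ℂ) : ℝ≥0∞ :=
  eLpNorm (fun x₁ : ℝ =>
    eLpNorm (fun t : ℝ =>
      eLpNorm (fun x' : {k : Fin d // k ≠ j} → ℝ => v t (dirPoint O j x₁ x')) c volume)
      b (volume.restrict I)) a volume

/-- The fixed data entering the norms of order `σ` with parameter `ε₀`: the symbol, the sectors,
and the choice of an orthonormal basis for each sector. -/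
structure Setup (d : ℕ) (σ ε₀ : ℝ) where
  m : Space d → ℝ
  Θ : Sectors d
  basis : Θ.Index → Orth d

variable {σ ε₀ : ℝ}

/-- The sector basis choice is adapted to the sectors and to the symbol: it takes finitely many
values, and for all sectors with `N_θ ≥ 2 Cmax` the listed quantities are non-degenerate. -/
structure Setup.IsAdapted (A : Setup d σ ε₀) (Cmax CO : ℝ) : Prop where
  finite_range : (Set.range A.basis).Finite
  one_le : 1 ≤ CO
  hessian_bounds : ∀ θ : A.Θ.Index, 2 * Cmax ≤ Sectors.scale θ → ∀ j, ∀ ξ ∈ Sectors.carrier θ,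
    CO⁻¹ * Sectors.scale θ ^ (σ - 2) ≤
        |iteratedFDeriv ℝ 2 A.m ξ ![col (A.basis θ) j, col (A.basis θ) j]| ∧
      |iteratedFDeriv ℝ 2 A.m ξ ![col (A.basis θ) j, col (A.basis θ) j]| ≤
        CO * Sectors.scale θ ^ (σ - 2)
  gradient_bounds : ∀ θ : A.Θ.Index, 2 * Cmax ≤ Sectors.scale θ → ∀ j, ∀ ξ ∈ Sectors.carrier θ,
    CO⁻¹ * Sectors.scale θ ^ (σ - 1) ≤ |inner ℝ (gradient A.m ξ) (col (A.basis θ) j)| ∧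
      |inner ℝ (gradient A.m ξ) (col (A.basis θ) j)| ≤ CO * Sectors.scale θ ^ (σ - 1)
  le_projection : ∀ θ : A.Θ.Index, 2 * Cmax ≤ Sectors.scale θ → ∀ j, ∀ ξ ∈ Sectors.carrier θ,
    CO⁻¹ * Sectors.scale θ ≤ |inner ℝ ξ (col (A.basis θ) j)|

namespace Setup

variable (A : Setup d σ ε₀)

/-- The dominant directions `J_θ(O) = {j : |⟨∇m(c_θ), O ê_j⟩| ≥ d^{-1/2} |∇m(c_θ)|}`. -/
def dominant (θ : A.Θ.Index) (O : Orth d) : Set (Fin d) :=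
  {j | (d : ℝ) ^ (-(1 / 2) : ℝ) * ‖gradient A.m (Sectors.center θ)‖ ≤
    |inner ℝ (gradient A.m (Sectors.center θ)) (col O j)|}

/-- `N_θ ^ r` as an extended nonnegative number. -/
def wt (θ : A.Θ.Index) (r : ℝ) : ℝ≥0∞ := ENNReal.ofReal (Sectors.scale θ ^ r)

/-- The exponent `2 / ε₀`. -/
def pBig (ε₀ : ℝ) : ℝ≥0∞ := ENNReal.ofReal (2 / ε₀)

/-- The exponent `2 / (1 - ε₀)`. -/
def pTwo (ε₀ : ℝ) : ℝ≥0∞ := ENNReal.ofReal (2 / (1 - ε₀))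

/-- The exponent `(2d / (d-2)) · 1 / (1 - ε₀)`, which is `∞` if `d = 2`. -/
def pStr (d : ℕ) (ε₀ : ℝ) : ℝ≥0∞ := ENNReal.ofReal (2 * d) / ENNReal.ofReal ((d - 2) * (1 - ε₀))

/-- The norm `X_θ(I)`. -/
def XNormAt (θ : A.Θ.Index) (I : Set ℝ) (v : ℝ → Space d → ℂ) : ℝ≥0∞ :=
  mixedNorm (pBig ε₀) (pTwo ε₀) I v + mixedNorm (pTwo ε₀) (pStr d ε₀) I v
  + ∑ j : Fin d,
      (A.wt θ (-(σ / 4)) * dirNorm (A.basis θ) j (pTwo ε₀) (pBig ε₀) (pTwo ε₀) I v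
        + A.wt θ (-((d - 1) / 2)) * dirNorm (A.basis θ) j (pTwo ε₀) (pBig ε₀) (pBig ε₀) I v)
  + ∑' O : Set.range A.basis, ∑' j : A.dominant θ O.1,
      (A.wt θ ((σ - 1) / 2) * dirNorm O.1 j.1 (pBig ε₀) (pTwo ε₀) (pTwo ε₀) I v
        + A.wt θ (-((d - σ) / 2)) * dirNorm O.1 j.1 (pBig ε₀) (pTwo ε₀) (pBig ε₀) I v)

/-- The norm `Y_θ(I)`. -/
def YNormAt (θ : A.Θ.Index) (I : Set ℝ) (v : ℝ → Space d → ℂ) : ℝ≥0∞ :=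
  mixedNorm (pBig ε₀) (pTwo ε₀) I v + mixedNorm (pTwo ε₀) (pStr d ε₀) I v
  + ∑ j : Fin d,
      (A.wt θ (-(σ / 4)) * dirNorm (A.basis θ) j (pTwo ε₀) (pBig ε₀) (pTwo ε₀) I v
        + A.wt θ (-(σ / 4)) * dirNorm (A.basis θ) j (pTwo ε₀) (pBig ε₀) (pBig ε₀) I v)
  + ∑' O : Set.range A.basis, ∑' j : A.dominant θ O.1,
      (A.wt θ ((σ - 1) / 2) * dirNorm O.1 j.1 (pBig ε₀) (pTwo ε₀) (pTwo ε₀) I v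
        + A.wt θ ((σ - 1) / 2) * dirNorm O.1 j.1 (pBig ε₀) (pTwo ε₀) (pBig ε₀) I v)

/-- The dual norm `X_θ^*(I)`: the supremum of `|∫_{I × ℝ^d} g h|` over all measurable `g` with
`‖g‖_{X_θ(I)} ≤ 1` for which the integral converges. -/
def XStarNormAt (θ : A.Θ.Index) (I : Set ℝ) (h : ℝ → Space d → ℂ) : ℝ≥0∞ :=
  ⨆ (g : ℝ → Space d → ℂ) (_ : Measurable (Function.uncurry g)) (_ : A.XNormAt θ I g ≤ 1)
    (_ : Integrable (fun p : ℝ × Space d => g p.1 p.2 * h p.1 p.2)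
      ((volume.restrict I).prod volume)),
    ‖∫ p : ℝ × Space d, g p.1 p.2 * h p.1 p.2 ∂((volume.restrict I).prod volume)‖ₑ

/-- The norm `X^r(I)`. -/
def XNorm (r : ℝ) (I : Set ℝ) (v : Field d) : ℝ≥0∞ :=
  (∑' θ : A.Θ.Index, A.wt θ (2 * r) * A.XNormAt θ I (proj θ v) ^ 2) ^ (1 / 2 : ℝ)

/-- The norm `Y^r(I)`. -/
def YNorm (r : ℝ) (I : Set ℝ) (v : Field d) : ℝ≥0∞ :=
  (∑' θ : A.Θ.Index, A.wt θ (2 * r) * A.YNormAt θ I (proj θ v) ^ 2) ^ (1 / 2 : ℝ)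

/-- The norm `X^{*,r}(I)`. -/
def XStarNorm (r : ℝ) (I : Set ℝ) (h : Field d) : ℝ≥0∞ :=
  (∑' θ : A.Θ.Index, A.wt θ (2 * r) * A.XStarNormAt θ I (proj θ h) ^ 2) ^ (1 / 2 : ℝ)

/-- The product `u₁ u₂ u₃` exists, and its `X^{*,r}(ℝ)` norm is at most `B`. -/
def ProductBound (r : ℝ) (u₁ u₂ u₃ : Field d) (B : ℝ≥0∞) : Prop :=
  (∃ h : Field d, IsProduct A.Θ u₁ u₂ u₃ h) ∧
    ∀ h : Field d, IsProduct A.Θ u₁ u₂ u₃ h → A.XStarNorm r Set.univ h ≤ B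

end Setup

end DirectionalNLS

end

noncomputable section

namespace DirectionalNLS

/-! The estimate is a quadrilinear bound obtained by duality. Pairing a sector component of the
product with `g` in `X_θ` and decomposing each factor leads to integrals of `|g| |P_{θ₁}z₁|
|P_{θ₂}z₂| |P_{θ₃}z₃|`. Order the four functions by frequency. Cauchy–Schwarz splits the integral
into two `L²` norms of products, each pairing one of the two highest frequencies with one of the two
lowest. In each pair the high factor goes into a smoothing norm, gaining `N^{-(σ-1)/2}`, and the low
one into a maximal norm along the same direction. The maximal norm is available only in the basis of
its own sector, but in any orthonormal basis some direction is dominant for the high factor. The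
Hölder exponents `2/ε₀` and `2/(1-ε₀)` are exactly complementary in `L²`. The low factor loses
`N^{σ/4}` if the pair contains a `Y` factor and `N^{(d-1)/2}` otherwise
(`lintegral_sq_mul_sq_le_sectorNorm`).

Which high factor meets which low factor is a free choice, used to keep `X` factors apart
(`Pairable`). The total exponent is then a linear form in the logarithms of the ordered frequencies,
so it is enough to check its sign on the extremal rays of the ordered cone
(`exponent_le_of_ordered`). These finitely many inequalities are `Admissible`, and the four cases of
the theorem amount to verifying them. On the ray where the output frequency alone is large no sign
is needed: by Fourier support the output is at most twelve times the largest input. The extra `ε` of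
regularity on each input makes all sums over sectors geometric.

The frequency restriction has to be proved for arbitrary tempered distributions, whose components
grow polynomially. A tempered distribution is a bounded functional of finitely many weighted
derivatives (`exists_jet_representation`), which reduces the claim to an identity for Schwartz
kernels. That the product exists follows from the same quadrilinear bound, tested against one
explicit decaying function (`ae_tripleMass_lt_top`). -/

lemma norm_le_one_add_mul_one_add {W : Type*} [SeminormedAddCommGroup W] (x y : W) : ‖x‖ ≤ (1 + ‖y‖) * (1 + ‖x - y‖) := by
  have h1 : ‖x‖ ≤ ‖y‖ + ‖x - y‖ := by simpa using norm_add_le y (x - y)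
  nlinarith [norm_nonneg y, norm_nonneg (x - y), mul_nonneg (norm_nonneg y) (norm_nonneg (x - y))]

/-! ### Translates of Schwartz functions and tempered distributions as functionals of finite jets -/

section Translation

variable {V : Type*} [NormedAddCommGroup V] [NormedSpace ℝ V]

lemma iteratedFDeriv_compSubConstCLM (K : 𝓢(V, ℂ)) (y : V) (n : ℕ) (x : V) :
    iteratedFDeriv ℝ n (K.compSubConstCLM ℂ y) x = iteratedFDeriv ℝ n K (x - y) := by
  have : (K.compSubConstCLM ℂ y : V → ℂ) = fun x => K (x + -y) := by
    ext x; simp [sub_eq_add_neg]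
  rw [this, iteratedFDeriv_comp_add_right, sub_eq_add_neg]

lemma exists_one_add_pow_mul_le (K : 𝓢(V, ℂ)) (k n : ℕ) :
    ∃ B : ℝ, 0 ≤ B ∧ ∀ x, (1 + ‖x‖) ^ k * ‖iteratedFDeriv ℝ n K x‖ ≤ B := by
  have h := fun x => SchwartzMap.one_add_le_sup_seminorm_apply (𝕜 := ℂ) (m := (k, n)) le_rfl le_rfl K x
  exact ⟨_, (by positivity : (0 : ℝ) ≤ _).trans (h 0), h⟩

/-- Schwartz seminorms of translates grow at most polynomially. -/
lemma exists_seminorm_translate_le (K : 𝓢(V, ℂ)) (k n : ℕ) :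
    ∃ B : ℝ, 0 ≤ B ∧ ∀ y, SchwartzMap.seminorm ℂ k n (K.compSubConstCLM ℂ y) ≤
      B * (1 + ‖y‖) ^ k := by
  obtain ⟨B, hB, h⟩ := exists_one_add_pow_mul_le K k n
  refine ⟨B, hB, fun y => SchwartzMap.seminorm_le_bound ℂ k n _ (by positivity) fun x => ?_⟩
  rw [iteratedFDeriv_compSubConstCLM]
  calc ‖x‖ ^ k * ‖iteratedFDeriv ℝ n K (x - y)‖
      ≤ ((1 + ‖y‖) * (1 + ‖x - y‖)) ^ k * ‖iteratedFDeriv ℝ n K (x - y)‖ := by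
        gcongr; exact norm_le_one_add_mul_one_add x y
    _ = ((1 + ‖x - y‖) ^ k * ‖iteratedFDeriv ℝ n K (x - y)‖) * (1 + ‖y‖) ^ k := by
        rw [mul_pow]; ring
    _ ≤ B * (1 + ‖y‖) ^ k := by gcongr; exact h _

/-- The mean value inequality on the ball of radius `R` around `x`, which contains `x - y` and `x -
y'`. There `‖x‖ ≤ (1 + R)(1 + ‖c‖)`, so the weight at `x` is absorbed by the decay of the next
derivative at `c`. This yields continuity of `y ↦ K(· - y)` in every seminorm. -/
lemma exists_seminorm_translate_sub_le (K : 𝓢(V, ℂ)) (k n : ℕ) (R : ℝ) (hR : 0 ≤ R) :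
    ∃ B : ℝ, 0 ≤ B ∧ ∀ y y', ‖y‖ ≤ R → ‖y'‖ ≤ R →
      SchwartzMap.seminorm ℂ k n (K.compSubConstCLM ℂ y - K.compSubConstCLM ℂ y') ≤
        B * ‖y - y'‖ := by
  obtain ⟨B, hB, h⟩ := exists_one_add_pow_mul_le K k (n + 1)
  refine ⟨(1 + R) ^ k * B, by positivity, fun y y' hy hy' =>
    SchwartzMap.seminorm_le_bound ℂ k n _ (by positivity) fun x => ?_⟩
  have hs : ∀ y : V, ContDiff ℝ n (K.compSubConstCLM ℂ y) := fun y =>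
    (K.compSubConstCLM ℂ y).smooth n
  have e1 : iteratedFDeriv ℝ n (K.compSubConstCLM ℂ y - K.compSubConstCLM ℂ y' : 𝓢(V, ℂ)) x =
      iteratedFDeriv ℝ n K (x - y) - iteratedFDeriv ℝ n K (x - y') := by
    rw [← iteratedFDeriv_compSubConstCLM, ← iteratedFDeriv_compSubConstCLM]
    exact iteratedFDeriv_sub_apply (hs y).contDiffAt (hs y').contDiffAt
  have hd : ∀ c, DifferentiableAt ℝ (iteratedFDeriv ℝ n K) c := fun c =>
    ((K.smooth (n + 1)).differentiable_iteratedFDeriv (by exact_mod_cast Nat.lt_succ_self n)) c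
  have hmv := (convex_closedBall x R).norm_image_sub_le_of_norm_fderiv_le (𝕜 := ℝ)
    (f := fun c => (‖x‖ ^ k) • iteratedFDeriv ℝ n K c) (C := (1 + R) ^ k * B)
    (fun c _ => (hd c).fun_const_smul _) (fun c hc => ?_)
    (x := x - y') (y := x - y) (by simpa using hy') (by simpa using hy)
  · rw [← smul_sub, ← e1, norm_smul, norm_pow, norm_norm] at hmv
    rwa [sub_sub_sub_cancel_left, norm_sub_rev] at hmv
  · have hc' : ‖x - c‖ ≤ R := by simpa [dist_eq_norm, norm_sub_rev] using hc
    have : ‖x‖ ≤ (1 + R) * (1 + ‖c‖) := by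
      have h2 : ‖x‖ ≤ ‖x - c‖ + ‖c‖ := by simpa using norm_add_le (x - c) c
      nlinarith [norm_nonneg c, mul_nonneg hR (norm_nonneg c)]
    rw [fderiv_fun_const_smul (hd c), norm_smul, norm_pow, norm_norm, norm_fderiv_iteratedFDeriv]
    calc ‖x‖ ^ k * ‖iteratedFDeriv ℝ (n + 1) K c‖
        ≤ ((1 + R) * (1 + ‖c‖)) ^ k * ‖iteratedFDeriv ℝ (n + 1) K c‖ := by gcongr
      _ = (1 + R) ^ k * ((1 + ‖c‖) ^ k * ‖iteratedFDeriv ℝ (n + 1) K c‖) := by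
          rw [mul_pow]; ring
      _ ≤ _ := by gcongr; exact h c

/-- The Banach space of bounded continuous functions carrying the weighted derivatives
`‖x‖^k D^n φ(x)` for `(k, n)` in a finite set. -/
def JetSpace (V : Type*) [NormedAddCommGroup V] [NormedSpace ℝ V] (s : Finset (ℕ × ℕ)) :=
  ∀ i : s, BoundedContinuousFunction V (ContinuousMultilinearMap ℝ (fun _ : Fin i.1.2 => V) ℂ)

instance (s : Finset (ℕ × ℕ)) : NormedAddCommGroup (JetSpace V s) :=
  inferInstanceAs (NormedAddCommGroup (∀ i : s,
    BoundedContinuousFunction V (ContinuousMultilinearMap ℝ (fun _ : Fin i.1.2 => V) ℂ)))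

instance (s : Finset (ℕ × ℕ)) : NormedSpace ℂ (JetSpace V s) :=
  inferInstanceAs (NormedSpace ℂ (∀ i : s,
    BoundedContinuousFunction V (ContinuousMultilinearMap ℝ (fun _ : Fin i.1.2 => V) ℂ)))

instance (s : Finset (ℕ × ℕ)) : CompleteSpace (JetSpace V s) :=
  inferInstanceAs (CompleteSpace (∀ i : s,
    BoundedContinuousFunction V (ContinuousMultilinearMap ℝ (fun _ : Fin i.1.2 => V) ℂ)))

/-- A single weighted derivative of Schwartz functions, as a bounded continuous function. -/
def weightedDeriv (k n : ℕ) : 𝓢(V, ℂ) →ₗ[ℂ]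
    BoundedContinuousFunction V (ContinuousMultilinearMap ℝ (fun _ : Fin n => V) ℂ) where
  toFun φ := BoundedContinuousFunction.ofNormedAddCommGroup
    (fun x => (‖x‖ ^ k) • iteratedFDeriv ℝ n φ x)
    ((continuous_norm.pow _).smul ((φ.smooth n).continuous_iteratedFDeriv le_rfl))
    (SchwartzMap.seminorm ℂ k n φ) (fun x => by
      rw [norm_smul, norm_pow, norm_norm]; exact SchwartzMap.le_seminorm ℂ _ _ _ _)
  map_add' φ ψ := by
    ext x : 1
    simp only [BoundedContinuousFunction.coe_ofNormedAddCommGroup,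
      BoundedContinuousFunction.coe_add, Pi.add_apply, ← smul_add]
    congr 1
    exact iteratedFDeriv_add_apply (φ.smooth n).contDiffAt (ψ.smooth n).contDiffAt
  map_smul' c φ := by
    ext x : 1
    simp only [BoundedContinuousFunction.coe_ofNormedAddCommGroup,
      BoundedContinuousFunction.coe_smul, RingHom.id_apply]
    rw [smul_comm c]
    congr 1
    exact iteratedFDeriv_const_smul_apply (φ.smooth n).contDiffAt

lemma weightedDeriv_apply (k n : ℕ) (φ : 𝓢(V, ℂ)) (x : V) :
    weightedDeriv k n φ x = (‖x‖ ^ k) • iteratedFDeriv ℝ n φ x := rfl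

lemma norm_weightedDeriv_le (k n : ℕ) (φ : 𝓢(V, ℂ)) :
    ‖weightedDeriv k n φ‖ ≤ SchwartzMap.seminorm ℂ k n φ :=
  (BoundedContinuousFunction.norm_le (apply_nonneg _ _)).2 fun x => by
    rw [weightedDeriv_apply, norm_smul, norm_pow, norm_norm]
    exact SchwartzMap.le_seminorm ℂ _ _ _ _

lemma seminorm_le_norm_weightedDeriv (k n : ℕ) (φ : 𝓢(V, ℂ)) :
    SchwartzMap.seminorm ℂ k n φ ≤ ‖weightedDeriv k n φ‖ := by
  refine SchwartzMap.seminorm_le_bound ℂ _ _ _ (norm_nonneg (weightedDeriv k n φ)) fun x => ?_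
  have h1 := (weightedDeriv k n φ).norm_coe_le_norm x
  rwa [weightedDeriv_apply, norm_smul, norm_pow, norm_norm] at h1

/-- The map `φ ↦ (‖x‖^k D^n φ(x))_{(k, n) ∈ s}`. -/
def jet (s : Finset (ℕ × ℕ)) : 𝓢(V, ℂ) →ₗ[ℂ] JetSpace V s where
  toFun φ := fun i : s => weightedDeriv i.1.1 i.1.2 φ
  map_add' φ ψ := funext fun i : s => map_add (weightedDeriv i.1.1 i.1.2) φ ψ
  map_smul' c φ := funext fun i : s => map_smul (weightedDeriv i.1.1 i.1.2) c φ

/-- Evaluation of a jet at a point and a tuple of directions. -/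
def jetEval (s : Finset (ℕ × ℕ)) (i : s) (x : V) (m : Fin i.1.2 → V) : JetSpace V s →L[ℂ] ℂ where
  toFun J := (J i : V → _) x m
  map_add' _ _ := rfl
  map_smul' _ _ := rfl
  cont := (ContinuousMultilinearMap.apply ℝ (fun _ : Fin i.1.2 => V) ℂ m).continuous.comp
    ((continuous_eval_const (F := BoundedContinuousFunction V
      (ContinuousMultilinearMap ℝ (fun _ : Fin i.1.2 => V) ℂ)) x).comp (continuous_apply i))

lemma jetEval_jet (s : Finset (ℕ × ℕ)) (i : s) (x : V) (m : Fin i.1.2 → V) (φ : 𝓢(V, ℂ)) :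
    jetEval s i x m (jet s φ) = ‖x‖ ^ i.1.1 • iteratedFDeriv ℝ i.1.2 φ x m := rfl

lemma JetSpace.ext {s : Finset (ℕ × ℕ)} {J J' : JetSpace V s}
    (h : ∀ i x m, jetEval s i x m J = jetEval s i x m J') : J = J' :=
  funext fun i => BoundedContinuousFunction.ext fun x => ContinuousMultilinearMap.ext fun m => h i x m

lemma norm_jet_le {s : Finset (ℕ × ℕ)} {φ : 𝓢(V, ℂ)} {C : ℝ} (hC : 0 ≤ C)
    (h : ∀ i : s, ‖weightedDeriv i.1.1 i.1.2 φ‖ ≤ C) : ‖jet s φ‖ ≤ C :=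
  (pi_norm_le_iff_of_nonneg hC).2 h

lemma seminorm_le_norm_jet (s : Finset (ℕ × ℕ)) (φ : 𝓢(V, ℂ)) (i : s) :
    SchwartzMap.seminorm ℂ i.1.1 i.1.2 φ ≤ ‖jet s φ‖ :=
  (seminorm_le_norm_weightedDeriv _ _ φ).trans (norm_le_pi_norm (ι := s) (fun i : s => weightedDeriv i.1.1 i.1.2 φ) i)

/-- A tempered distribution is a bounded functional of finitely many weighted derivatives. -/
lemma exists_jet_representation (u : 𝓢'(V, ℂ)) :
    ∃ (s : Finset (ℕ × ℕ)) (L : JetSpace V s →L[ℂ] ℂ), ∀ φ, u φ = L (jet s φ) := by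
  let u' : 𝓢(V, ℂ) →ₗ[ℂ] ℂ := u.toLinearMap
  have hu' : ∀ φ, u' φ = u φ := fun _ => rfl
  obtain ⟨s, C, -, hC⟩ := Seminorm.bound_of_continuous (schwartz_withSeminorms ℂ V ℂ)
    ((normSeminorm ℂ ℂ).comp u') (continuous_norm.comp u.continuous)
  have hb : ∀ φ, ‖u φ‖ ≤ C * ‖jet s φ‖ := by
    intro φ
    refine (hC φ).trans ?_
    rw [smul_apply]
    refine mul_le_mul_of_nonneg_left ?_ C.2
    exact Seminorm.finset_sup_apply_le (norm_nonneg _) fun i hi =>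
      seminorm_le_norm_jet s φ ⟨i, hi⟩
  -- A linear section `g` of the jet map makes `u ∘ g` a functional on its range, bounded by `hb`,
  -- and Hahn–Banach extends it. The choice of section does not matter, since `hb` forces `u` to
  -- vanish on the kernel of the jet map.
  obtain ⟨g, hg⟩ := LinearMap.exists_rightInverse_of_surjective (jet (V := V) s).rangeRestrict
    (LinearMap.range_rangeRestrict _)
  have hg' : ∀ y : LinearMap.range (jet (V := V) s), jet s (g y) = y := fun y => by
    have := LinearMap.congr_fun hg y
    simpa using congrArg Subtype.val this
  let f : LinearMap.range (jet (V := V) s) →L[ℂ] ℂ :=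
    (u' ∘ₗ g).mkContinuous C fun y => by
      have := hb (g y)
      rw [hg'] at this
      exact this
  obtain ⟨L, hL, -⟩ := exists_extension_norm_eq _ f
  refine ⟨s, L, fun φ => ?_⟩
  have h1 := hL ⟨jet s φ, φ, rfl⟩
  rw [h1]
  change u φ = u (g _)
  have h2 : ‖u (φ - g ⟨jet s φ, φ, rfl⟩)‖ ≤ 0 := by
    refine (hb _).trans ?_
    rw [map_sub, hg']
    simp
  rw [map_sub] at h2
  exact sub_eq_zero.1 (norm_le_zero_iff.1 h2)

lemma continuous_weightedDeriv_translate (k n : ℕ) (K : 𝓢(V, ℂ)) :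
    Continuous fun y => weightedDeriv k n (K.compSubConstCLM ℂ y) := by
  rw [continuous_iff_continuousAt]
  intro y
  obtain ⟨B, hB, h⟩ := exists_seminorm_translate_sub_le K k n (‖y‖ + 1) (by positivity)
  rw [ContinuousAt, tendsto_iff_dist_tendsto_zero]
  have hlim : Tendsto (fun y' => B * ‖y' - y‖) (𝓝 y) (𝓝 0) := by
    have : Continuous fun y' => B * ‖y' - y‖ := by fun_prop
    simpa using this.tendsto y
  refine squeeze_zero' (Eventually.of_forall fun _ => dist_nonneg) ?_ hlim
  filter_upwards [Metric.ball_mem_nhds y one_pos] with y' hy'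
  rw [Metric.mem_ball, dist_eq_norm] at hy'
  have h1 : ‖y'‖ ≤ ‖y‖ + 1 := by
    have := norm_add_le (y' - y) y
    rw [sub_add_cancel] at this; linarith
  refine (BoundedContinuousFunction.dist_le (by positivity)).2 fun x => ?_
  rw [dist_eq_norm]
  have h2 := (norm_weightedDeriv_le k n
    (K.compSubConstCLM ℂ y' - K.compSubConstCLM ℂ y)).trans (h y' y h1 (by linarith))
  rw [map_sub] at h2
  exact ((weightedDeriv k n (K.compSubConstCLM ℂ y') -
    weightedDeriv k n (K.compSubConstCLM ℂ y)).norm_coe_le_norm x).trans h2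

lemma continuous_jet_translate (s : Finset (ℕ × ℕ)) (K : 𝓢(V, ℂ)) :
    Continuous fun y => jet s (K.compSubConstCLM ℂ y) :=
  continuous_pi (A := fun i : s => BoundedContinuousFunction V
    (ContinuousMultilinearMap ℝ (fun _ : Fin i.1.2 => V) ℂ)) fun i : s =>
      continuous_weightedDeriv_translate i.1.1 i.1.2 K

lemma exists_norm_jet_translate_le (s : Finset (ℕ × ℕ)) (K : 𝓢(V, ℂ)) :
    ∃ (B : ℝ) (n : ℕ), 0 ≤ B ∧ ∀ y, ‖jet s (K.compSubConstCLM ℂ y)‖ ≤ B * (1 + ‖y‖) ^ n := by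
  choose B hB h using fun i : s => exists_seminorm_translate_le K i.1.1 i.1.2
  have hB' : 0 ≤ ∑ i, B i := Finset.sum_nonneg fun i _ => hB i
  refine ⟨∑ i, B i, ∑ i : s, i.1.1, hB', fun y => ?_⟩
  have hy : (1 : ℝ) ≤ 1 + ‖y‖ := by linarith [norm_nonneg y]
  refine norm_jet_le (by positivity) fun i => ?_
  refine (norm_weightedDeriv_le _ _ _).trans ((h i y).trans ?_)
  have h1 : B i ≤ ∑ i, B i := Finset.single_le_sum (fun i _ => hB i) (Finset.mem_univ i)
  have h2 : i.1.1 ≤ ∑ i : s, i.1.1 :=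
    Finset.single_le_sum (f := fun i : s => i.1.1) (fun i _ => Nat.zero_le _) (Finset.mem_univ i)
  exact mul_le_mul h1 (pow_le_pow_right₀ hy h2) (by positivity) hB'

lemma continuous_apply_translate (u : 𝓢'(V, ℂ)) (K : 𝓢(V, ℂ)) :
    Continuous fun y => u (K.compSubConstCLM ℂ y) := by
  obtain ⟨s, L, hL⟩ := exists_jet_representation u
  simp_rw [hL]
  exact L.continuous.comp (continuous_jet_translate s K)

lemma exists_norm_apply_translate_le (u : 𝓢'(V, ℂ)) (K : 𝓢(V, ℂ)) :
    ∃ (B : ℝ) (n : ℕ), 0 ≤ B ∧ ∀ y, ‖u (K.compSubConstCLM ℂ y)‖ ≤ B * (1 + ‖y‖) ^ n := by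
  obtain ⟨s, L, hL⟩ := exists_jet_representation u
  obtain ⟨B, n, hB, h⟩ := exists_norm_jet_translate_le s K
  refine ⟨‖L‖ * B, n, by positivity, fun y => ?_⟩
  rw [hL, mul_assoc]
  exact (L.le_opNorm _).trans (by gcongr; exact h y)

end Translation

/-! ### Rapidly decaying continuous functions -/

section RapidDecay

/-- Continuous functions decaying faster than every polynomial. -/
structure RapidDecay {V : Type*} [NormedAddCommGroup V] (Ψ : V → ℂ) : Prop where
  continuous : Continuous Ψ
  decay : ∀ n : ℕ, ∃ C : ℝ, ∀ y, (1 + ‖y‖) ^ n * ‖Ψ y‖ ≤ C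

lemma rapidDecay_schwartz {V : Type*} [NormedAddCommGroup V] [NormedSpace ℝ V] (φ : 𝓢(V, ℂ)) : RapidDecay φ where
  continuous := φ.continuous
  decay n := by
    obtain ⟨B, -, h⟩ := exists_one_add_pow_mul_le φ n 0
    exact ⟨B, fun y => by simpa using h y⟩

lemma RapidDecay.mul {V : Type*} [NormedAddCommGroup V] {Ψ f : V → ℂ} (hΨ : RapidDecay Ψ) (hf : Continuous f) {B : ℝ} {n : ℕ}
    (hB : ∀ y, ‖f y‖ ≤ B * (1 + ‖y‖) ^ n) : RapidDecay fun y => f y * Ψ y where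
  continuous := hf.mul hΨ.continuous
  decay k := by
    obtain ⟨C, hC⟩ := hΨ.decay (n + k)
    have hB0 : 0 ≤ B := by
      have := (norm_nonneg _).trans (hB 0)
      simpa using this
    refine ⟨B * C, fun y => ?_⟩
    calc (1 + ‖y‖) ^ k * ‖f y * Ψ y‖ ≤ (1 + ‖y‖) ^ k * (B * (1 + ‖y‖) ^ n * ‖Ψ y‖) := by
          rw [norm_mul]; gcongr; exact hB y
      _ = B * ((1 + ‖y‖) ^ (n + k) * ‖Ψ y‖) := by rw [pow_add]; ring
      _ ≤ B * C := by gcongr; exact hC y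

lemma RapidDecay.fourierChar_smul {V : Type*} [NormedAddCommGroup V] [InnerProductSpace ℝ V] {Ψ : V → ℂ} (hΨ : RapidDecay Ψ) (η : V) :
    RapidDecay fun y => Real.fourierChar (-inner ℝ y η) • Ψ y where
  continuous := (Real.continuous_fourierChar.comp (by fun_prop)).smul hΨ.continuous
  decay n := by
    obtain ⟨C, hC⟩ := hΨ.decay n
    exact ⟨C, fun y => by simpa [Circle.norm_smul] using hC y⟩

lemma RapidDecay.apply_translate_mul {V : Type*} [NormedAddCommGroup V] [NormedSpace ℝ V] {Ψ : V → ℂ} (hΨ : RapidDecay Ψ) (u : 𝓢'(V, ℂ))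
    (K : 𝓢(V, ℂ)) : RapidDecay fun y => u (K.compSubConstCLM ℂ y) * Ψ y := by
  obtain ⟨B, n, -, h⟩ := exists_norm_apply_translate_le u K
  exact hΨ.mul (continuous_apply_translate u K) h

end RapidDecay

/-! ### Spectral gaps and multiplication by band-limited functions -/

section SpectralGap

variable {V : Type*} [NormedAddCommGroup V] [InnerProductSpace ℝ V] [FiniteDimensional ℝ V]
  [MeasurableSpace V] [BorelSpace V]

/-- Vector values are needed for the Bochner integral of jets. The majorant is `(1 + ‖y‖)^{-(dim V +
1)}`. -/
lemma RapidDecay.integrable_one_add_pow_smul {F : Type*} [NormedAddCommGroup F] [NormedSpace ℂ F]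
    {Ψ : V → ℂ} (hΨ : RapidDecay Ψ)
    {f : V → F} (hf : Continuous f) {B : ℝ} {n : ℕ} (hB : ∀ y, ‖f y‖ ≤ B * (1 + ‖y‖) ^ n) :
    Integrable fun y => Ψ y • f y := by
  set r : ℕ := Module.finrank ℝ V + 1
  obtain ⟨C, hC⟩ := hΨ.decay (n + r)
  have hint : Integrable fun y : V => (B * C) * (1 + ‖y‖) ^ (-(r : ℝ)) :=
    (integrable_one_add_norm (by simp [r])).const_mul _
  refine hint.mono' (hΨ.continuous.smul hf).aestronglyMeasurable (Eventually.of_forall fun y => ?_)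
  have hy : 0 < 1 + ‖y‖ := by positivity
  have hB0 : 0 ≤ B := by
    have := (norm_nonneg _).trans (hB 0)
    simpa using this
  rw [norm_smul, Real.rpow_neg hy.le, Real.rpow_natCast, ← div_eq_mul_inv, le_div_iff₀ (by positivity)]
  calc ‖Ψ y‖ * ‖f y‖ * (1 + ‖y‖) ^ r ≤ ‖Ψ y‖ * (B * (1 + ‖y‖) ^ n) * (1 + ‖y‖) ^ r := by
        gcongr; exact hB y
    _ = B * ((1 + ‖y‖) ^ (n + r) * ‖Ψ y‖) := by rw [pow_add]; ring
    _ ≤ B * C := by gcongr; exact hC y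

lemma RapidDecay.integrable {Ψ : V → ℂ} (hΨ : RapidDecay Ψ) : Integrable Ψ := by
  have := hΨ.integrable_one_add_pow_smul (f := fun _ => (1 : ℂ)) continuous_const (B := 1) (n := 0)
    (by simp)
  simpa using this

/-- If translates of all derivatives of `K` are orthogonal to `Φ`, then so is `y ↦ u(K(· - y))`,
for every tempered distribution `u`. -/
lemma integral_apply_translate_mul_eq_zero {Φ : V → ℂ} (hΦ : RapidDecay Φ) (u : 𝓢'(V, ℂ))
    (K : 𝓢(V, ℂ))
    (h : ∀ (n : ℕ) (m : Fin n → V) (x : V),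
      ∫ y, Φ y * iteratedFDeriv ℝ n K (x - y) m = 0) :
    ∫ y, u (K.compSubConstCLM ℂ y) * Φ y = 0 := by
  obtain ⟨s, L, hL⟩ := exists_jet_representation u
  obtain ⟨B, n, -, hB⟩ := exists_norm_jet_translate_le s K
  have hint : Integrable fun y => Φ y • jet s (K.compSubConstCLM ℂ y) :=
    hΦ.integrable_one_add_pow_smul (continuous_jet_translate s K) hB
  -- The functional `L` commutes with the Bochner integral of jets, and that integral vanishes
  -- because all its point evaluations do.
  have hzero : ∫ y, Φ y • jet s (K.compSubConstCLM ℂ y) = 0 := by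
    refine JetSpace.ext fun i x m => ?_
    rw [← ContinuousLinearMap.integral_comp_comm _ hint, map_zero]
    simp_rw [map_smul, jetEval_jet, iteratedFDeriv_compSubConstCLM, smul_comm (Φ _), smul_eq_mul]
    rw [integral_smul, h, smul_zero]
  have e : ∀ y, u (K.compSubConstCLM ℂ y) * Φ y =
      L (Φ y • jet s (K.compSubConstCLM ℂ y)) := fun y => by
    rw [L.map_smul, hL, smul_eq_mul, mul_comm]
  simp_rw [e]
  rw [L.integral_comp_comm hint, hzero, map_zero]

-- Differentiating `𝓕 g` multiplies `g` by a linear function, which does not enlarge its support.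
-- Jets involve derivatives of the kernel, and this reduces them to kernels of the same type.
open LineDeriv in
lemma exists_iteratedFDeriv_fourier_eq {R : ℝ} {n : ℕ} (m : Fin n → V) {g : 𝓢(V, ℂ)}
    (hg : ∀ ξ, R < ‖ξ‖ → g ξ = 0) :
    ∃ g' : 𝓢(V, ℂ), (∀ ξ, R < ‖ξ‖ → g' ξ = 0) ∧
      ∀ x, iteratedFDeriv ℝ n (𝓕 g : 𝓢(V, ℂ)) x m = (𝓕 g' : 𝓢(V, ℂ)) x := by
  suffices h : ∃ g' : 𝓢(V, ℂ), (∀ ξ, R < ‖ξ‖ → g' ξ = 0) ∧ ∂^{m} (𝓕 g : 𝓢(V, ℂ)) = 𝓕 g' by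
    obtain ⟨g', hg', h⟩ := h
    refine ⟨g', hg', fun x => ?_⟩
    rw [← SchwartzMap.iteratedLineDerivOp_eq_iteratedFDeriv, h]
  induction n with
  | zero => exact ⟨g, hg, by rw [iteratedLineDerivOp_fin_zero]⟩
  | succ n ih =>
    obtain ⟨g', hg', h⟩ := ih (Fin.tail m)
    refine ⟨_, fun ξ hξ => ?_, by
      rw [iteratedLineDerivOp_succ_left, h, SchwartzMap.lineDerivOp_fourier_eq]⟩
    have : (inner ℝ · (m 0) : V → ℝ).HasTemperateGrowth := by fun_prop
    simp [SchwartzMap.smulLeftCLM_apply_apply this, hg' ξ hξ]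

/-- The Fourier transform of `Ψ` vanishes on the open ball of radius `ρ`. -/
def HasSpectralGap (Ψ : V → ℂ) (ρ : ℝ) : Prop := ∀ η : V, ‖η‖ < ρ → 𝓕 Ψ η = 0

/-- Moving the Fourier transform from `g` to the other factor leaves the integral of a phase times
`𝓕 Ψ (η - ξ) * g ξ`. On the support of `g` one has `‖η - ξ‖ ≤ ‖η‖ + R < ρ`, inside the gap. -/
lemma integral_mul_fourier_sub_eq_zero {Ψ : V → ℂ} (hΨ : Integrable Ψ) {ρ R : ℝ}
    (hgap : HasSpectralGap Ψ ρ) {g : 𝓢(V, ℂ)} (hg : ∀ ξ, R < ‖ξ‖ → g ξ = 0) {η : V}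
    (hη : ‖η‖ < ρ - R) (x : V) :
    ∫ y, (Real.fourierChar (-inner ℝ y η) • Ψ y) * 𝓕 g (x - y) = 0 := by
  set Φ : V → ℂ := fun y => Real.fourierChar (-inner ℝ y η) • Ψ y with hΦ
  have hΦi : Integrable Φ := (Real.fourierIntegral_convergent_iff η).2 hΨ
  have hF : ∀ ξ, 𝓕 (fun y => Φ (x - y)) ξ =
      Real.fourierChar (-inner ℝ x ξ) • 𝓕 Ψ (η - ξ) := by
    intro ξ
    rw [Real.fourier_eq, Real.fourier_eq, Circle.smul_def, ← integral_smul,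
      ← integral_sub_left_eq_self _ volume x]
    congr 1
    ext y
    simp only [hΦ, sub_sub_cancel, ← Circle.smul_def, smul_smul, ← AddChar.map_add_eq_mul]
    congr 2
    rw [inner_sub_left, inner_sub_right]; ring
  rw [← integral_sub_left_eq_self _ volume x]
  simp only [sub_sub_cancel]
  have h1 := VectorFourier.integral_fourierIntegral_smul_eq_flip (L := innerₗ V)
    (μ := volume) (ν := volume) (f := fun y => Φ (x - y)) (g := g)
    Real.continuous_fourierChar continuous_inner (hΦi.comp_sub_left x) g.integrable
  have h2 : ∫ y, Φ (x - y) * 𝓕 g y = ∫ ξ, 𝓕 (fun y => Φ (x - y)) ξ * g ξ := by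
    rw [flip_innerₗ] at h1
    simp only [smul_eq_mul] at h1
    exact h1.symm
  rw [h2]
  refine (integral_congr_ae (Eventually.of_forall fun ξ => ?_)).trans (integral_zero _ _)
  by_cases hξ : R < ‖ξ‖
  · simp [hg ξ hξ]
  · have : ‖η - ξ‖ < ρ := by
      have := norm_sub_le η ξ
      linarith
    simp [hF, hgap _ this]

/-- Multiplication by a band-limited function shrinks the spectral gap by its bandwidth. -/
lemma HasSpectralGap.apply_translate_mul {Ψ : V → ℂ} (hΨ : RapidDecay Ψ) {ρ R : ℝ}
    (hgap : HasSpectralGap Ψ ρ) {g : 𝓢(V, ℂ)} (hg : ∀ ξ, R < ‖ξ‖ → g ξ = 0) (u : 𝓢'(V, ℂ)) :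
    HasSpectralGap (fun y => u ((𝓕 g).compSubConstCLM ℂ y) * Ψ y) (ρ - R) := by
  intro η hη
  rw [Real.fourier_eq]
  have h := integral_apply_translate_mul_eq_zero (hΨ.fourierChar_smul η) u (𝓕 g) fun n m x => by
    obtain ⟨g', hg', h'⟩ := exists_iteratedFDeriv_fourier_eq m hg
    simp only [h']
    exact integral_mul_fourier_sub_eq_zero hΨ.integrable hgap hg' hη x
  refine Eq.trans ?_ h
  congr 1
  ext y
  rw [Circle.smul_def, Circle.smul_def, smul_eq_mul, smul_eq_mul]; ring

lemma HasSpectralGap.integral_eq_zero {Ψ : V → ℂ} {ρ : ℝ} (hgap : HasSpectralGap Ψ ρ)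
    (hρ : 0 < ρ) : ∫ y, Ψ y = 0 := by
  have := hgap 0 (by simpa using hρ)
  rw [Real.fourier_eq] at this
  simpa using this

/-- By Fourier inversion the transform of `𝓕 g` is the reflection of `g`, and translation only
contributes a phase. -/
lemma hasSpectralGap_fourier_translate {g : 𝓢(V, ℂ)} {ρ : ℝ} (hg : ∀ ξ, ‖ξ‖ < ρ → g ξ = 0)
    (x : V) : HasSpectralGap ((𝓕 g).compSubConstCLM ℂ x) ρ := by
  intro η hη
  rw [Real.fourier_eq, ← integral_add_right_eq_self _ x]
  have h1 : ∀ y, Real.fourierChar (-inner ℝ (y + x) η) • (𝓕 g).compSubConstCLM ℂ x (y + x) =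
      Real.fourierChar (-inner ℝ x η) • (Real.fourierChar (inner ℝ y (-η)) • 𝓕 g y) := by
    intro y
    rw [SchwartzMap.compSubConstCLM_apply, add_sub_cancel_right, smul_smul,
      ← AddChar.map_add_eq_mul]
    congr 2
    rw [inner_add_left, inner_neg_right]; ring
  simp_rw [h1, Circle.smul_def (Real.fourierChar (-inner ℝ x η))]
  rw [integral_smul, ← Real.fourierInv_eq, ← SchwartzMap.fourierInv_coe,
    FourierTransform.fourierInv_fourier_eq, hg _ (by simpa using hη), smul_zero]

end SpectralGap

/-! ### Supports of the sector multipliers and `L¹` bounds for their kernels -/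

namespace Sectors

variable {d : ℕ} {Θ : Sectors d}

lemma scale_pos (θ : Θ.Index) : 0 < scale θ := pow_pos Θ.one_add_pos _

lemma one_le_scale (θ : Θ.Index) : 1 ≤ scale θ := one_le_pow₀ Θ.one_lt.le

lemma mult_eq_zero_of_lt_norm (θ : Θ.Index) {ξ : Space d} (hξ : 4 * scale θ < ‖ξ‖) :
    mult θ ξ = 0 := by
  -- The factor 4 bounds `(1 + res)^2`, as `res ≤ 1`.
  have h : (1 + Θ.res) ^ 2 * (1 + Θ.res) ^ θ.1 < ‖ξ‖ := by
    refine lt_of_le_of_lt ?_ hξ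
    have h1 := Θ.res_pos
    have h2 := Θ.res_le_one
    exact mul_le_mul_of_nonneg_right (by nlinarith) (scale_pos θ).le
  unfold mult
  by_cases h0 : θ.1 = 0
  · rw [h0] at h
    simp only [h0, if_true, Θ.radial_eq_zero 0 h, mul_zero]
  · simp only [h0, if_false, Θ.radial_eq_zero _ h, zero_mul]

lemma mult_eq_zero_of_norm_lt (θ : Θ.Index) (h0 : θ.1 ≠ 0) {ξ : Space d} (hξ : ‖ξ‖ < scale θ) :
    mult θ ξ = 0 := by
  have hp := Θ.one_lt
  have hN := scale_pos θ
  have h1 : ‖ξ‖ / (1 + Θ.res) ^ θ.1 ≤ 1 := (div_le_one hN).2 hξ.le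
  have h2 : ‖ξ‖ / ((1 + Θ.res) * (1 + Θ.res) ^ θ.1) ≤ 1 := by
    refine (div_le_one (by positivity)).2 ?_
    exact hξ.le.trans (le_mul_of_one_le_left hN.le hp.le)
  simp only [mult, h0, if_false, radial]
  rw [Θ.χ_eq_one _ (by positivity) h1, Θ.χ_eq_one _ (by positivity) h2]
  simp

lemma multSchwartz_apply (θ : Θ.Index) (ξ : Space d) : multSchwartz θ ξ = (mult θ ξ : ℂ) := rfl

/-- All multipliers away from the lowest level are dilates of those at level 1. With the dilation
invariance of the `L¹` norm of the Fourier transform, only finitely many kernels remain to be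
bounded. -/
lemma mult_succ (k : ℕ) (e : {e : Space d // e ∈ Θ.dirs}) (ξ : Space d) :
    mult (Θ := Θ) (k + 1, e) ξ = mult (Θ := Θ) (1, e) (((1 + Θ.res) ^ k)⁻¹ • ξ) := by
  have hp := Θ.one_add_pos
  have hk : 0 < (1 + Θ.res) ^ k := pow_pos hp k
  have h1 : ‖((1 + Θ.res) ^ k)⁻¹ • ξ‖ = ‖ξ‖ / (1 + Θ.res) ^ k := by
    rw [norm_smul, norm_inv, Real.norm_of_nonneg hk.le, div_eq_inv_mul]
  have h2 : (‖ξ‖ / (1 + Θ.res) ^ k)⁻¹ • ((1 + Θ.res) ^ k)⁻¹ • ξ = ‖ξ‖⁻¹ • ξ := by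
    rw [smul_smul]
    congr 1
    field_simp
  have hrad : Θ.radial (k + 1) ξ = Θ.radial 1 (((1 + Θ.res) ^ k)⁻¹ • ξ) := by
    simp only [radial, Nat.add_eq_zero_iff, one_ne_zero, and_false, if_false, h1,
      div_div, pow_succ, pow_zero, one_mul]
    congr 3
    ring
  have hang : Θ.angular e.1 ξ = Θ.angular e.1 (((1 + Θ.res) ^ k)⁻¹ • ξ) := by
    simp only [angular, h1, h2]
  simp only [mult, Nat.add_eq_zero_iff, one_ne_zero, and_false, if_false]
  rw [hrad, hang]

lemma fourier_comp_inv_smul {d : ℕ} (f : Space d → ℂ) {c : ℝ} (hc : 0 < c) (w : Space d) :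
    𝓕 (fun v => f (c⁻¹ • v)) w = ((c ^ d : ℝ) : ℂ) * 𝓕 f (c • w) := by
  rw [Real.fourier_eq, Real.fourier_eq]
  have h := Measure.integral_comp_inv_smul (volume : Measure (Space d))
    (fun v => Real.fourierChar (-inner ℝ v (c • w)) • f v) c
  rw [finrank_euclideanSpace_fin, abs_of_pos (pow_pos hc d)] at h
  rw [← smul_eq_mul, Complex.coe_smul, ← h]
  congr 1
  ext v
  congr 3
  rw [inner_smul_left, inner_smul_right]
  simp [hc.ne']

lemma lintegral_fourier_comp_inv_smul {d : ℕ} (f : Space d → ℂ) {c : ℝ} (hc : 0 < c) :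
    ∫⁻ w, ‖𝓕 (fun v => f (c⁻¹ • v)) w‖ₑ = ∫⁻ w, ‖𝓕 f w‖ₑ := by
  have hcd : 0 < c ^ d := pow_pos hc d
  simp_rw [fourier_comp_inv_smul f hc, enorm_mul]
  rw [lintegral_const_mul' _ _ enorm_ne_top]
  have h1 : MeasurableEmbedding (fun w : Space d => c • w) :=
    (Homeomorph.smulOfNeZero c hc.ne').measurableEmbedding
  have h2 := h1.lintegral_map (μ := volume) (fun w => ‖𝓕 f w‖ₑ)
  rw [← h2, Measure.map_addHaar_smul _ hc.ne', lintegral_smul_measure, smul_eq_mul, ← mul_assoc,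
    finrank_euclideanSpace_fin, abs_of_pos (by positivity), ENNReal.ofReal_inv_of_pos hcd]
  have h3 : ‖((c ^ d : ℝ) : ℂ)‖ₑ = ENNReal.ofReal (c ^ d) := by
    rw [← ofReal_norm, Complex.norm_real, Real.norm_of_nonneg hcd.le]
  rw [h3, ENNReal.mul_inv_cancel (by simpa using hcd) ENNReal.ofReal_ne_top, one_mul]

/-- The convolution kernels of the sector projections are bounded in `L¹`. -/
lemma exists_lintegral_kernel_le (Θ : Sectors d) :
    ∃ κ : ℝ≥0, ∀ θ : Θ.Index, ∫⁻ w, ‖(𝓕 (multSchwartz θ) : 𝓢(Space d, ℂ)) w‖ₑ ≤ κ := by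
  have hfin : ∀ θ : Θ.Index, ∫⁻ w, ‖(𝓕 (multSchwartz θ) : 𝓢(Space d, ℂ)) w‖ₑ ≠ ⊤ := fun θ =>
    ((𝓕 (multSchwartz θ) : 𝓢(Space d, ℂ)).integrable (μ := volume)).2.ne
  set a : Θ.Index → ℝ≥0 := fun θ => (∫⁻ w, ‖(𝓕 (multSchwartz θ) : 𝓢(Space d, ℂ)) w‖ₑ).toNNReal
  have ha : ∀ θ, ∫⁻ w, ‖(𝓕 (multSchwartz θ) : 𝓢(Space d, ℂ)) w‖ₑ = a θ := fun θ =>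
    (ENNReal.coe_toNNReal (hfin θ)).symm
  refine ⟨∑ e ∈ Θ.dirs.attach, (a (0, e) + a (1, e)), fun ⟨k, e⟩ => ?_⟩
  have hle : a (0, e) + a (1, e) ≤ ∑ e ∈ Θ.dirs.attach, (a (0, e) + a (1, e)) :=
    Finset.single_le_sum (f := fun e => a (0, e) + a (1, e)) (fun _ _ => bot_le)
      (Finset.mem_attach _ e)
  rcases k with _ | k
  · rw [ha]
    exact_mod_cast (le_self_add).trans hle
  · have h1 : ∫⁻ w, ‖(𝓕 (multSchwartz (Θ := Θ) (k + 1, e)) : 𝓢(Space d, ℂ)) w‖ₑ = a (1, e) := by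
      rw [← ha, SchwartzMap.fourier_coe, SchwartzMap.fourier_coe]
      have h2 : (multSchwartz (Θ := Θ) (k + 1, e) : Space d → ℂ) =
          fun v => multSchwartz (Θ := Θ) (1, e) (((1 + Θ.res) ^ k)⁻¹ • v) := by
        ext v
        rw [multSchwartz_apply, multSchwartz_apply, mult_succ]
      rw [h2]
      exact lintegral_fourier_comp_inv_smul _ (pow_pos Θ.one_add_pos k)
    rw [h1]
    exact_mod_cast (le_add_self).trans hle

end Sectors

/-! ### Sector components and vanishing interactions -/

section Projections

variable {d : ℕ} {Θ : Sectors d}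

lemma continuous_proj (θ : Θ.Index) (z : Field d) (t : ℝ) : Continuous (proj θ z t) :=
  continuous_apply_translate (z t) _

lemma measurable_uncurry_proj (θ : Θ.Index) {z : Field d} (hz : z.IsMeasurable) :
    Measurable (Function.uncurry (proj θ z)) := by
  have h : Measurable (Function.uncurry fun (x : Space d) (t : ℝ) => proj θ z t x) :=
    measurable_uncurry_of_continuous_of_measurable (fun t => continuous_proj θ z t)
      (fun x => hz _)
  exact h.comp measurable_swap

lemma rapidDecay_proj_mul (θ : Θ.Index) (z : Field d) (t : ℝ) {Ψ : Space d → ℂ}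
    (hΨ : RapidDecay Ψ) : RapidDecay fun x => proj θ z t x * Ψ x :=
  hΨ.apply_translate_mul (z t) _

lemma rapidDecay_triple (θ₁ θ₂ θ₃ : Θ.Index) (z₁ z₂ z₃ : Field d) (t : ℝ) (φ : 𝓢(Space d, ℂ)) :
    RapidDecay fun x => proj θ₁ z₁ t x * proj θ₂ z₂ t x * proj θ₃ z₃ t x * φ x := by
  have := rapidDecay_proj_mul θ₁ z₁ t (rapidDecay_proj_mul θ₂ z₂ t
    (rapidDecay_proj_mul θ₃ z₃ t (rapidDecay_schwartz φ)))
  simpa only [mul_assoc] using this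

/-- The frequencies of a product of three functions are bounded by the sum of their frequencies. -/
lemma integral_triple_mul_kernel_eq_zero (θ θ₁ θ₂ θ₃ : Θ.Index) (z₁ z₂ z₃ : Field d) (t : ℝ)
    (x : Space d) (h₁ : 12 * Sectors.scale θ₁ < Sectors.scale θ)
    (h₂ : 12 * Sectors.scale θ₂ < Sectors.scale θ)
    (h₃ : 12 * Sectors.scale θ₃ < Sectors.scale θ) :
    ∫ y, proj θ₁ z₁ t y * proj θ₂ z₂ t y * proj θ₃ z₃ t y *
      (𝓕 (Sectors.multSchwartz θ)).compSubConstCLM ℂ x y = 0 := by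
  have h0 : θ.1 ≠ 0 := by
    intro h0
    have := Sectors.one_le_scale θ₁
    have h1 : Sectors.scale θ = 1 := by simp [Sectors.scale, h0]
    linarith
  have hs : ∀ θ' : Θ.Index, ∀ ξ, 4 * Sectors.scale θ' < ‖ξ‖ → Sectors.multSchwartz θ' ξ = 0 :=
    fun θ' ξ hξ => by simp [Sectors.multSchwartz_apply, Sectors.mult_eq_zero_of_lt_norm θ' hξ]
  -- The kernel of `P_θ` has a gap of radius `N_θ`, and each factor lowers it by `4 N_{θᵢ}`. The
  -- remaining radius `N_θ - 4(N_{θ₁} + N_{θ₂} + N_{θ₃})` is positive because every `12 N_{θᵢ}` is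
  -- below `N_θ`.
  have g0 := hasSpectralGap_fourier_translate (g := Sectors.multSchwartz θ)
    (ρ := Sectors.scale θ) (fun ξ hξ => by
      simp [Sectors.multSchwartz_apply, Sectors.mult_eq_zero_of_norm_lt θ h0 hξ]) x
  have r0 := rapidDecay_schwartz ((𝓕 (Sectors.multSchwartz θ)).compSubConstCLM ℂ x)
  have g3 := g0.apply_translate_mul r0 (hs θ₃) (z₃ t)
  have r3 := rapidDecay_proj_mul θ₃ z₃ t r0
  have g2 := g3.apply_translate_mul r3 (hs θ₂) (z₂ t)
  have r2 := rapidDecay_proj_mul θ₂ z₂ t r3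
  have g1 := g2.apply_translate_mul r2 (hs θ₁) (z₁ t)
  have := g1.integral_eq_zero (by linarith)
  simpa only [mul_assoc] using! this

end Projections

/-! ### Hölder's inequality in mixed norms -/

section MixedHolder

variable {α β γ : Type*} [MeasurableSpace α] [MeasurableSpace β] [MeasurableSpace γ]
  {μ : Measure α} {ν : Measure β} {τ : Measure γ}

lemma eLpNorm_ofReal_eq {E : Type*} [TopologicalSpace E] [ContinuousENorm E] (f : α → E) {p : ℝ}
    (hp : 0 < p) : eLpNorm f (ENNReal.ofReal p) μ = (∫⁻ x, ‖f x‖ₑ ^ p ∂μ) ^ (1 / p) := by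
  rw [eLpNorm_eq_lintegral_rpow_enorm_toReal (by simpa using hp) ENNReal.ofReal_ne_top,
    ENNReal.toReal_ofReal hp.le]

/-- Two exponents whose reciprocals add up to `1/2`. -/
structure HalfConjugate (p q : ℝ) : Prop where
  left_pos : 0 < p
  right_pos : 0 < q
  add : 1 / p + 1 / q = 1 / 2

lemma HalfConjugate.symm {p q : ℝ} (h : HalfConjugate p q) : HalfConjugate q p :=
  ⟨h.right_pos, h.left_pos, by rw [add_comm, h.add]⟩

/-- Squared form of `‖fg‖_2 ≤ ‖f‖_p ‖g‖_q`. Squares avoid roots when the inequality is iterated over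
several variables. -/
lemma lintegral_sq_mul_sq_le {E F : Type*} [TopologicalSpace E] [ContinuousENorm E]
    [TopologicalSpace F] [ContinuousENorm F] {p q : ℝ} (h : HalfConjugate p q)
    {f : α → E} {g : α → F} (hf : Measurable fun x => ‖f x‖ₑ) (hg : Measurable fun x => ‖g x‖ₑ) :
    ∫⁻ x, ‖f x‖ₑ ^ 2 * ‖g x‖ₑ ^ 2 ∂μ ≤
      eLpNorm f (ENNReal.ofReal p) μ ^ 2 * eLpNorm g (ENNReal.ofReal q) μ ^ 2 := by
  have hlt : 2 < p := by
    have h1 : 1 / p < 1 / 2 := by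
      have := h.add
      have := one_div_pos.2 h.right_pos
      linarith
    exact (one_div_lt_one_div h.left_pos two_pos).1 h1
  have h1 := ENNReal.lintegral_Lp_mul_le_Lq_mul_Lr (p := 2) two_pos hlt h.add.symm μ
    hf.aemeasurable hg.aemeasurable
  rw [eLpNorm_ofReal_eq f h.left_pos, eLpNorm_ofReal_eq g h.right_pos, ← mul_pow]
  have h2 := pow_le_pow_left' h1 2
  refine le_trans (le_of_eq ?_) h2
  rw [← ENNReal.rpow_natCast, ← ENNReal.rpow_mul]
  norm_num
  refine lintegral_congr fun x => ?_
  rw [mul_pow]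

lemma measurable_eLpNorm_right {E : Type*} [TopologicalSpace E] [ContinuousENorm E] [SFinite ν]
    {f : α → β → E} (hf : Measurable fun x : α × β => ‖f x.1 x.2‖ₑ) {p : ℝ} (hp : 0 < p) :
    Measurable fun x => eLpNorm (f x) (ENNReal.ofReal p) ν := by
  simp_rw [eLpNorm_ofReal_eq _ hp]
  exact (Measurable.lintegral_prod_right' (hf.pow_const p)).pow_const _

/-- The mixed norm with exponents `p₁, p₂, p₃`, the last one innermost. -/
def mixedNorm₃ (p₁ p₂ p₃ : ℝ≥0∞) (μ : Measure α) (ν : Measure β) (τ : Measure γ)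
    (f : α → β → γ → ℂ) : ℝ≥0∞ :=
  eLpNorm (fun x => eLpNorm (fun y => eLpNorm (f x y) p₃ τ) p₂ ν) p₁ μ

/-- Hölder is applied from the innermost variable outwards, the inner norms being the functions to
which the next application refers. -/
lemma lintegral_sq_mul_sq_le_mixedNorm₃ [SFinite ν] [SFinite τ] {p₁ p₂ p₃ q₁ q₂ q₃ : ℝ}
    (h₁ : HalfConjugate p₁ q₁) (h₂ : HalfConjugate p₂ q₂) (h₃ : HalfConjugate p₃ q₃)
    {f g : α → β → γ → ℂ} (hf : Measurable fun x : (α × β) × γ => f x.1.1 x.1.2 x.2)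
    (hg : Measurable fun x : (α × β) × γ => g x.1.1 x.1.2 x.2) :
    ∫⁻ x, ∫⁻ y, ∫⁻ z, ‖f x y z‖ₑ ^ 2 * ‖g x y z‖ₑ ^ 2 ∂τ ∂ν ∂μ ≤
      mixedNorm₃ (ENNReal.ofReal p₁) (ENNReal.ofReal p₂) (ENNReal.ofReal p₃) μ ν τ f ^ 2 *
      mixedNorm₃ (ENNReal.ofReal q₁) (ENNReal.ofReal q₂) (ENNReal.ofReal q₃) μ ν τ g ^ 2 := by
  have mf : ∀ {p₃ : ℝ}, 0 < p₃ → ∀ {f : α → β → γ → ℂ},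
      (Measurable fun x : (α × β) × γ => f x.1.1 x.1.2 x.2) →
      Measurable fun x : α × β => eLpNorm (f x.1 x.2) (ENNReal.ofReal p₃) τ := fun hp f hf =>
    measurable_eLpNorm_right (f := fun (x : α × β) z => f x.1 x.2 z) hf.enorm hp
  have mf' : ∀ {p₂ p₃ : ℝ}, 0 < p₂ → 0 < p₃ → ∀ {f : α → β → γ → ℂ},
      (Measurable fun x : (α × β) × γ => f x.1.1 x.1.2 x.2) →
      Measurable fun x : α => eLpNorm (fun y => eLpNorm (f x y) (ENNReal.ofReal p₃) τ)
        (ENNReal.ofReal p₂) ν := fun hp₂ hp₃ f hf =>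
    measurable_eLpNorm_right (f := fun x y => eLpNorm (f x y) _ τ) (by simpa using mf hp₃ hf) hp₂
  have e1 : ∀ x y, ∫⁻ z, ‖f x y z‖ₑ ^ 2 * ‖g x y z‖ₑ ^ 2 ∂τ ≤
      ‖eLpNorm (f x y) (ENNReal.ofReal p₃) τ‖ₑ ^ 2 *
        ‖eLpNorm (g x y) (ENNReal.ofReal q₃) τ‖ₑ ^ 2 := fun x y => by
    simp only [enorm_eq_self]
    exact lintegral_sq_mul_sq_le h₃ (hf.comp (measurable_prodMk_left (x := (x, y)))).enorm
      (hg.comp (measurable_prodMk_left (x := (x, y)))).enorm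
  have e2 : ∀ x, ∫⁻ y, ∫⁻ z, ‖f x y z‖ₑ ^ 2 * ‖g x y z‖ₑ ^ 2 ∂τ ∂ν ≤
      ‖eLpNorm (fun y => eLpNorm (f x y) (ENNReal.ofReal p₃) τ) (ENNReal.ofReal p₂) ν‖ₑ ^ 2 *
      ‖eLpNorm (fun y => eLpNorm (g x y) (ENNReal.ofReal q₃) τ) (ENNReal.ofReal q₂) ν‖ₑ ^ 2 :=
    fun x => by
    refine (lintegral_mono (e1 x)).trans ?_
    rw [enorm_eq_self, enorm_eq_self]
    refine lintegral_sq_mul_sq_le h₂ ?_ ?_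
    · simpa [Function.comp_def] using (mf h₃.left_pos hf).comp (measurable_prodMk_left (x := x))
    · simpa [Function.comp_def] using (mf h₃.right_pos hg).comp (measurable_prodMk_left (x := x))
  refine (lintegral_mono e2).trans (lintegral_sq_mul_sq_le h₁ ?_ ?_)
  · simpa using mf' h₂.left_pos h₃.left_pos hf
  · simpa using mf' h₂.right_pos h₃.right_pos hg

end MixedHolder

/-! ### Directional coordinates and translation invariance of the norms -/

section Directions

variable {d : ℕ}

lemma rot_sub (O : Orth d) (y w : Fin d → ℝ) : rot O (y - w) = rot O y - rot O w := by
  simp [rot, Matrix.mulVec_sub]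

lemma rot_surjective (O : Orth d) (z : Space d) : ∃ w, rot O w = z := by
  refine ⟨(star (O : Matrix (Fin d) (Fin d) ℝ)).mulVec z.ofLp, ?_⟩
  have h := (Matrix.mem_unitaryGroup_iff (A := (O : Matrix (Fin d) (Fin d) ℝ))).1 O.2
  simp [rot, Matrix.mulVec_mulVec, h]

lemma measurePreserving_rot (O : Orth d) : MeasurePreserving (rot O) volume volume := by
  have hdet : |(O : Matrix (Fin d) (Fin d) ℝ).det| = 1 := by
    have h := (Matrix.mem_orthogonalGroup_iff (A := (O : Matrix (Fin d) (Fin d) ℝ))).1 O.2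
    have h2 := congrArg Matrix.det h
    rw [Matrix.det_mul, Matrix.det_transpose, Matrix.det_one] at h2
    have h3 : |(O : Matrix (Fin d) (Fin d) ℝ).det| * |(O : Matrix (Fin d) (Fin d) ℝ).det| = 1 := by
      rw [← abs_mul, h2, abs_one]
    nlinarith [abs_nonneg (O : Matrix (Fin d) (Fin d) ℝ).det]
  have hdet0 : (O : Matrix (Fin d) (Fin d) ℝ).det ≠ 0 := by
    intro h0; rw [h0] at hdet; simp at hdet
  have h1 : MeasurePreserving (Matrix.toLin' (O : Matrix (Fin d) (Fin d) ℝ)) volume volume := by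
    refine ⟨(LinearMap.continuous_of_finiteDimensional
      (Matrix.toLin' (O : Matrix (Fin d) (Fin d) ℝ))).measurable, ?_⟩
    rw [Real.map_matrix_volume_pi_eq_smul_volume_pi hdet0, abs_inv, hdet]
    simp
  exact (PiLp.volume_preserving_toLp (Fin d)).comp h1

lemma measurePreserving_dirPoint (O : Orth d) (j : Fin d) :
    MeasurePreserving (fun p : ℝ × ({k : Fin d // k ≠ j} → ℝ) => dirPoint O j p.1 p.2)
      (volume.prod volume) volume := by
  have h1 := (volume_preserving_piEquivPiSubtypeProd (fun _ : Fin d => ℝ) (fun k => k = j)).symm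
  have h2 : MeasurePreserving (MeasurableEquiv.funUnique {k : Fin d // k = j} ℝ).symm volume
      (@volume _ (@MeasureSpace.pi _ (Subtype.fintype fun k => k = j) _ _)) := by
    convert (volume_preserving_funUnique {k : Fin d // k = j} ℝ).symm
  have h3 := (measurePreserving_rot O).comp (h1.comp
    (h2.prod (MeasurePreserving.id (volume : Measure ({k : Fin d // ¬k = j} → ℝ)))))
  convert h3 using 1
  funext p
  refine congrArg (rot O) (funext fun k => ?_)
  by_cases h : k = j
  · subst h
    simp [MeasurableEquiv.piEquivPiSubtypeProd, Equiv.piEquivPiSubtypeProd]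
  · simp [MeasurableEquiv.piEquivPiSubtypeProd, Equiv.piEquivPiSubtypeProd, h]

lemma measurable_dirPoint (O : Orth d) (j : Fin d) :
    Measurable fun p : ℝ × ({k : Fin d // k ≠ j} → ℝ) => dirPoint O j p.1 p.2 :=
  (measurePreserving_dirPoint O j).measurable

lemma dirPoint_sub_rot (O : Orth d) (j : Fin d) (x₁ : ℝ) (x' : {k : Fin d // k ≠ j} → ℝ)
    (w : Fin d → ℝ) :
    dirPoint O j x₁ x' - rot O w = dirPoint O j (x₁ - w j) (x' - fun k : {k : Fin d // k ≠ j} => w k) := by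
  unfold dirPoint
  rw [← rot_sub]
  congr 1
  ext k
  by_cases h : k = j
  · subst h; simp
  · simp [h]

lemma lintegral_prod_eq_dirPoint (O : Orth d) (j : Fin d) {F : ℝ × Space d → ℝ≥0∞}
    (hF : Measurable F) :
    ∫⁻ p, F p = ∫⁻ x₁ : ℝ, ∫⁻ t : ℝ, ∫⁻ x' : {k : Fin d // k ≠ j} → ℝ,
      F (t, dirPoint O j x₁ x') := by
  have hm : Measurable fun q : (ℝ × ℝ) × ({k : Fin d // k ≠ j} → ℝ) =>
      F (q.1.1, dirPoint O j q.1.2 q.2) :=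
    hF.comp (measurable_fst.fst.prodMk
      ((measurable_dirPoint O j).comp (measurable_fst.snd.prodMk measurable_snd)))
  rw [Measure.volume_eq_prod, lintegral_prod _ hF.aemeasurable]
  have h1 : ∀ t : ℝ, ∫⁻ x, F (t, x) = ∫⁻ x₁ : ℝ, ∫⁻ x' : {k : Fin d // k ≠ j} → ℝ,
      F (t, dirPoint O j x₁ x') := fun t => by
    have hFt : Measurable fun x => F (t, x) := hF.comp measurable_prodMk_left
    rw [← (measurePreserving_dirPoint O j).lintegral_comp hFt, lintegral_prod]
    exact (hFt.comp (measurable_dirPoint O j)).aemeasurable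
  simp_rw [h1]
  exact lintegral_lintegral_swap (f := fun t x₁ => ∫⁻ x' : {k : Fin d // k ≠ j} → ℝ,
    F (t, dirPoint O j x₁ x')) (Measurable.lintegral_prod_right' hm).aemeasurable

/-- The directional Hölder inequality in `L²_{t,x}`. -/
lemma lintegral_sq_mul_sq_le_dirNorm (O : Orth d) (j : Fin d) {p₁ p₂ p₃ q₁ q₂ q₃ : ℝ}
    (h₁ : HalfConjugate p₁ q₁) (h₂ : HalfConjugate p₂ q₂) (h₃ : HalfConjugate p₃ q₃)
    {f g : ℝ → Space d → ℂ} (hf : Measurable (Function.uncurry f))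
    (hg : Measurable (Function.uncurry g)) :
    ∫⁻ p : ℝ × Space d, ‖f p.1 p.2‖ₑ ^ 2 * ‖g p.1 p.2‖ₑ ^ 2 ≤
      dirNorm O j (ENNReal.ofReal p₁) (ENNReal.ofReal p₂) (ENNReal.ofReal p₃) Set.univ f ^ 2 *
      dirNorm O j (ENNReal.ofReal q₁) (ENNReal.ofReal q₂) (ENNReal.ofReal q₃) Set.univ g ^ 2 := by
  have hm : Measurable fun q : (ℝ × ℝ) × ({k : Fin d // k ≠ j} → ℝ) =>
      ((q.1.2, dirPoint O j q.1.1 q.2) : ℝ × Space d) :=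
    measurable_fst.snd.prodMk
      ((measurable_dirPoint O j).comp (measurable_fst.fst.prodMk measurable_snd))
  rw [lintegral_prod_eq_dirPoint O j (F := fun p => ‖f p.1 p.2‖ₑ ^ 2 * ‖g p.1 p.2‖ₑ ^ 2)
    ((hf.enorm.pow_const 2).mul (hg.enorm.pow_const 2))]
  have := lintegral_sq_mul_sq_le_mixedNorm₃ (μ := (volume : Measure ℝ))
    (ν := (volume : Measure ℝ)) (τ := (volume : Measure ({k : Fin d // k ≠ j} → ℝ))) h₁ h₂ h₃
    (f := fun x₁ t x' => f t (dirPoint O j x₁ x')) (g := fun x₁ t x' => g t (dirPoint O j x₁ x'))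
    (hf.comp hm) (hg.comp hm)
  simpa only [dirNorm, Measure.restrict_univ] using! this

lemma eLpNorm_comp_sub_right {G E : Type*} [AddGroup G] [MeasurableSpace G] [MeasurableAdd G]
    {μ : Measure G} [μ.IsAddRightInvariant] [TopologicalSpace E] [ContinuousENorm E] (f : G → E) (p : ℝ≥0∞)
    (w : G) : eLpNorm (fun x => f (x - w)) p μ = eLpNorm f p μ := by
  have h := (measurableEmbedding_addRight (-w)).eLpNorm_map_measure (μ := μ) (g := f) (p := p)
  rw [map_add_right_eq_self] at h
  simpa [Function.comp_def, sub_eq_add_neg] using h.symm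

lemma mixedNorm_translate (q p : ℝ≥0∞) (I : Set ℝ) (v : ℝ → Space d → ℂ) (z : Space d) :
    mixedNorm q p I (fun t x => v t (x - z)) = mixedNorm q p I v := by
  unfold mixedNorm
  congr 1
  ext t
  exact eLpNorm_comp_sub_right (v t) p z

/-- In the coordinates of `O`, a translation acts separately on `x₁` and `x'`, and each of the
nested norms is invariant. This is what later allows the kernel of `P_θ` to be moved onto the test
function. -/
lemma dirNorm_translate (O : Orth d) (j : Fin d) (a b c : ℝ≥0∞) (I : Set ℝ)
    (v : ℝ → Space d → ℂ) (z : Space d) :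
    dirNorm O j a b c I (fun t x => v t (x - z)) = dirNorm O j a b c I v := by
  obtain ⟨w, rfl⟩ := rot_surjective O z
  unfold dirNorm
  simp_rw [dirPoint_sub_rot]
  have h1 : ∀ x₁ : ℝ, ∀ t : ℝ, eLpNorm (fun x' : {k : Fin d // k ≠ j} → ℝ =>
      v t (dirPoint O j (x₁ - w j) (x' - fun k : {k : Fin d // k ≠ j} => w k))) c volume =
      eLpNorm (fun x' : {k : Fin d // k ≠ j} → ℝ => v t (dirPoint O j (x₁ - w j) x')) c volume :=
    fun x₁ t => eLpNorm_comp_sub_right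
      (fun x' : {k : Fin d // k ≠ j} → ℝ => v t (dirPoint O j (x₁ - w j) x')) c _
  simp_rw [h1]
  exact eLpNorm_comp_sub_right (fun x₁ => eLpNorm (fun t => eLpNorm
    (fun x' : {k : Fin d // k ≠ j} → ℝ => v t (dirPoint O j x₁ x')) c volume) b
      (volume.restrict I)) a (w j)

end Directions

/-! ### Pairing smoothing norms with maximal norms -/

namespace Setup

variable {d : ℕ} {σ ε₀ : ℝ} (A : Setup d σ ε₀)

/-- The logarithm of the frequency scale of a sector. -/
def logScale (θ : A.Θ.Index) : ℝ := Real.log (Sectors.scale θ)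

lemma logScale_nonneg (θ : A.Θ.Index) : 0 ≤ A.logScale θ :=
  Real.log_nonneg (Sectors.one_le_scale θ)

lemma wt_eq_exp (θ : A.Θ.Index) (r : ℝ) :
    A.wt θ r = ENNReal.ofReal (Real.exp (r * A.logScale θ)) := by
  rw [wt, logScale, Real.rpow_def_of_pos (Sectors.scale_pos θ), mul_comm]

lemma wt_add (θ : A.Θ.Index) (r r' : ℝ) : A.wt θ (r + r') = A.wt θ r * A.wt θ r' := by
  rw [wt_eq_exp, wt_eq_exp, wt_eq_exp, ← ENNReal.ofReal_mul (Real.exp_nonneg _), ← Real.exp_add,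
    add_mul]

lemma wt_zero (θ : A.Θ.Index) : A.wt θ 0 = 1 := by simp [wt_eq_exp]

lemma wt_mono (θ : A.Θ.Index) {r r' : ℝ} (h : r ≤ r') : A.wt θ r ≤ A.wt θ r' := by
  rw [wt_eq_exp, wt_eq_exp]
  exact ENNReal.ofReal_le_ofReal (Real.exp_le_exp.2
    (mul_le_mul_of_nonneg_right h (A.logScale_nonneg θ)))

lemma wt_neg_mul_wt (θ : A.Θ.Index) (r : ℝ) : A.wt θ (-r) * A.wt θ r = 1 := by
  rw [← wt_add, neg_add_cancel, wt_zero]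

lemma le_wt_neg_mul {θ : A.Θ.Index} {r : ℝ} {a b : ℝ≥0∞} (h : A.wt θ r * a ≤ b) :
    a ≤ A.wt θ (-r) * b := by
  calc a = A.wt θ (-r) * (A.wt θ r * a) := by rw [← mul_assoc, wt_neg_mul_wt, one_mul]
    _ ≤ _ := by gcongr

lemma wt_sq (θ : A.Θ.Index) (r : ℝ) : A.wt θ r ^ 2 = A.wt θ (2 * r) := by
  rw [sq, ← wt_add, two_mul]

/-- The norm of a sector component: `Y_θ` if `y` holds, `X_θ` otherwise. -/
def sectorNorm (y : Bool) (θ : A.Θ.Index) (v : ℝ → Space d → ℂ) : ℝ≥0∞ :=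
  if y then A.YNormAt θ Set.univ v else A.XNormAt θ Set.univ v

variable {A}

lemma maximal_le_XNormAt (θ : A.Θ.Index) (j : Fin d) (v : ℝ → Space d → ℂ) :
    A.wt θ (-(σ / 4)) * dirNorm (A.basis θ) j (pTwo ε₀) (pBig ε₀) (pTwo ε₀) Set.univ v ≤
      A.XNormAt θ Set.univ v ∧
    A.wt θ (-((d - 1) / 2)) * dirNorm (A.basis θ) j (pTwo ε₀) (pBig ε₀) (pBig ε₀) Set.univ v ≤
      A.XNormAt θ Set.univ v := by
  have h := Finset.single_le_sum (f := fun j : Fin d =>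
      A.wt θ (-(σ / 4)) * dirNorm (A.basis θ) j (pTwo ε₀) (pBig ε₀) (pTwo ε₀) Set.univ v
        + A.wt θ (-((d - 1) / 2)) *
          dirNorm (A.basis θ) j (pTwo ε₀) (pBig ε₀) (pBig ε₀) Set.univ v)
    (fun _ _ => bot_le) (Finset.mem_univ j)
  have h2 : _ ≤ A.XNormAt θ Set.univ v := h.trans (le_add_self.trans le_self_add)
  exact ⟨le_self_add.trans h2, le_add_self.trans h2⟩

lemma maximal_le_YNormAt (θ : A.Θ.Index) (j : Fin d) (v : ℝ → Space d → ℂ) :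
    A.wt θ (-(σ / 4)) * dirNorm (A.basis θ) j (pTwo ε₀) (pBig ε₀) (pTwo ε₀) Set.univ v ≤
      A.YNormAt θ Set.univ v ∧
    A.wt θ (-(σ / 4)) * dirNorm (A.basis θ) j (pTwo ε₀) (pBig ε₀) (pBig ε₀) Set.univ v ≤
      A.YNormAt θ Set.univ v := by
  have h := Finset.single_le_sum (f := fun j : Fin d =>
      A.wt θ (-(σ / 4)) * dirNorm (A.basis θ) j (pTwo ε₀) (pBig ε₀) (pTwo ε₀) Set.univ v
        + A.wt θ (-(σ / 4)) *
          dirNorm (A.basis θ) j (pTwo ε₀) (pBig ε₀) (pBig ε₀) Set.univ v)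
    (fun _ _ => bot_le) (Finset.mem_univ j)
  have h2 : _ ≤ A.YNormAt θ Set.univ v := h.trans (le_add_self.trans le_self_add)
  exact ⟨le_self_add.trans h2, le_add_self.trans h2⟩

lemma smoothing_le_XNormAt (θ : A.Θ.Index) {O : Orth d} (hO : O ∈ Set.range A.basis) {j : Fin d}
    (hj : j ∈ A.dominant θ O) (v : ℝ → Space d → ℂ) :
    A.wt θ ((σ - 1) / 2) * dirNorm O j (pBig ε₀) (pTwo ε₀) (pTwo ε₀) Set.univ v ≤
      A.XNormAt θ Set.univ v := by
  unfold XNormAt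
  refine le_trans ?_ le_add_self
  refine le_trans ?_ (ENNReal.le_tsum (⟨O, hO⟩ : Set.range A.basis))
  refine le_trans ?_ (ENNReal.le_tsum (⟨j, hj⟩ : A.dominant θ O))
  exact le_self_add

lemma smoothing_le_YNormAt (θ : A.Θ.Index) {O : Orth d} (hO : O ∈ Set.range A.basis) {j : Fin d}
    (hj : j ∈ A.dominant θ O) (v : ℝ → Space d → ℂ) :
    A.wt θ ((σ - 1) / 2) * dirNorm O j (pBig ε₀) (pTwo ε₀) (pTwo ε₀) Set.univ v ≤
      A.YNormAt θ Set.univ v ∧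
    A.wt θ ((σ - 1) / 2) * dirNorm O j (pBig ε₀) (pTwo ε₀) (pBig ε₀) Set.univ v ≤
      A.YNormAt θ Set.univ v := by
  have key : A.wt θ ((σ - 1) / 2) * dirNorm O j (pBig ε₀) (pTwo ε₀) (pTwo ε₀) Set.univ v +
      A.wt θ ((σ - 1) / 2) * dirNorm O j (pBig ε₀) (pTwo ε₀) (pBig ε₀) Set.univ v ≤
      A.YNormAt θ Set.univ v := by
    unfold YNormAt
    refine le_trans ?_ le_add_self
    refine le_trans ?_ (ENNReal.le_tsum (⟨O, hO⟩ : Set.range A.basis))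
    exact ENNReal.le_tsum (f := fun j : A.dominant θ O =>
      A.wt θ ((σ - 1) / 2) * dirNorm O j.1 (pBig ε₀) (pTwo ε₀) (pTwo ε₀) Set.univ v +
      A.wt θ ((σ - 1) / 2) * dirNorm O j.1 (pBig ε₀) (pTwo ε₀) (pBig ε₀) Set.univ v) ⟨j, hj⟩
  exact ⟨le_self_add.trans key, le_add_self.trans key⟩

lemma sum_inner_col_sq (O : Orth d) (v : Space d) : ∑ j, inner ℝ v (col O j) ^ 2 = ‖v‖ ^ 2 := by
  have h := (Matrix.mem_orthogonalGroup_iff (A := (O : Matrix (Fin d) (Fin d) ℝ))).1 O.2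
  have h1 : ∀ j, inner ℝ v (col O j) = Matrix.vecMul v.ofLp (O : Matrix (Fin d) (Fin d) ℝ) j := by
    intro j
    simp [col, rot, PiLp.inner_apply, Matrix.vecMul, dotProduct, mul_comm]
  have h2 : ∑ j, inner ℝ v (col O j) ^ 2 =
      Matrix.vecMul v.ofLp (O : Matrix (Fin d) (Fin d) ℝ) ⬝ᵥ
        Matrix.vecMul v.ofLp (O : Matrix (Fin d) (Fin d) ℝ) := by
    simp_rw [h1, dotProduct, sq]
  have h3 : Matrix.vecMul v.ofLp (O : Matrix (Fin d) (Fin d) ℝ) =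
      (O : Matrix (Fin d) (Fin d) ℝ).transpose.mulVec v.ofLp := (Matrix.mulVec_transpose _ _).symm
  rw [h2]
  nth_rewrite 2 [h3]
  rw [Matrix.dotProduct_mulVec, Matrix.vecMul_vecMul, h, Matrix.vecMul_one,
    EuclideanSpace.norm_sq_eq]
  simp [dotProduct, sq]

/-- The `d` squared components of the gradient in an orthonormal basis sum to its squared norm, so
one is at least the average. The argument includes a vanishing gradient, for which every direction
qualifies. -/
lemma exists_mem_dominant (hd : 0 < d) (θ : A.Θ.Index) (O : Orth d) : ∃ j, j ∈ A.dominant θ O := by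
  by_contra! hcon
  set v := gradient A.m (Sectors.center θ) with hv
  have hlt : ∀ j, |inner ℝ v (col O j)| < (d : ℝ) ^ (-(1 / 2) : ℝ) * ‖v‖ := fun j => by
    exact not_le.1 (hcon j)
  have hd' : (0 : ℝ) < d := by exact_mod_cast hd
  have hc : ((d : ℝ) ^ (-(1 / 2) : ℝ)) ^ 2 = (d : ℝ)⁻¹ := by
    rw [← Real.rpow_natCast, ← Real.rpow_mul hd'.le, ← Real.rpow_neg_one]
    norm_num
  have hlt2 : ∀ j, inner ℝ v (col O j) ^ 2 < (d : ℝ)⁻¹ * ‖v‖ ^ 2 := fun j => by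
    rw [← hc, ← mul_pow, ← sq_abs]
    exact pow_lt_pow_left₀ (hlt j) (abs_nonneg _) two_ne_zero
  have : Nonempty (Fin d) := ⟨⟨0, hd⟩⟩
  have hsum := Finset.sum_lt_sum_of_nonempty (s := Finset.univ) Finset.univ_nonempty
    (fun j _ => hlt2 j)
  rw [sum_inner_col_sq, Finset.sum_const, Finset.card_univ, Fintype.card_fin, nsmul_eq_mul,
    ← mul_assoc, mul_inv_cancel₀ hd'.ne', one_mul] at hsum
  exact lt_irrefl _ hsum

lemma halfConjugate_two_big (h0 : 0 < ε₀) (h1 : ε₀ < 1) :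
    HalfConjugate (2 / (1 - ε₀)) (2 / ε₀) :=
  ⟨div_pos two_pos (by linarith), div_pos two_pos h0, by rw [one_div_div, one_div_div]; ring⟩

/-- The loss exponent of the factor placed in the maximal norm. -/
def lossExp (d : ℕ) (σ : ℝ) (y : Bool) : ℝ := if y then σ / 4 else ((d : ℝ) - 1) / 2

/-- The bilinear `L²` estimate: the first factor is placed in a smoothing norm, the second in a
maximal norm along the same direction. -/
lemma lintegral_sq_mul_sq_le_sectorNorm (hd : 0 < d) (h0 : 0 < ε₀) (h1 : ε₀ < 1) (y₁ y₂ : Bool)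
    (θ₁ θ₂ : A.Θ.Index) {f g : ℝ → Space d → ℂ} (hf : Measurable (Function.uncurry f))
    (hg : Measurable (Function.uncurry g)) :
    ∫⁻ p : ℝ × Space d, ‖f p.1 p.2‖ₑ ^ 2 * ‖g p.1 p.2‖ₑ ^ 2 ≤
      (A.wt θ₁ (-((σ - 1) / 2)) * A.sectorNorm y₁ θ₁ f *
        (A.wt θ₂ (lossExp d σ (y₁ || y₂)) * A.sectorNorm y₂ θ₂ g)) ^ 2 := by
  have hT := halfConjugate_two_big h0 h1
  -- The basis is that of `θ₂`, where the maximal norm of `g` lives. The smoothing norm of `f` is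
  -- available in every basis of the range, along dominant directions.
  obtain ⟨j, hj⟩ := exists_mem_dominant hd θ₁ (A.basis θ₂)
  have hO : A.basis θ₂ ∈ Set.range A.basis := ⟨θ₂, rfl⟩
  have hqp := lintegral_sq_mul_sq_le_dirNorm (A.basis θ₂) j hT.symm hT hT hf hg
  have hpq := lintegral_sq_mul_sq_le_dirNorm (A.basis θ₂) j hT.symm hT hT.symm hf hg
  change _ ≤ dirNorm _ j (pBig ε₀) (pTwo ε₀) (pTwo ε₀) _ f ^ 2 *
    dirNorm _ j (pTwo ε₀) (pBig ε₀) (pBig ε₀) _ g ^ 2 at hqp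
  change _ ≤ dirNorm _ j (pBig ε₀) (pTwo ε₀) (pBig ε₀) _ f ^ 2 *
    dirNorm _ j (pTwo ε₀) (pBig ε₀) (pTwo ε₀) _ g ^ 2 at hpq
  rw [← mul_pow] at hqp hpq
  have smooth₁ : dirNorm (A.basis θ₂) j (pBig ε₀) (pTwo ε₀) (pTwo ε₀) Set.univ f ≤
      A.wt θ₁ (-((σ - 1) / 2)) * A.sectorNorm y₁ θ₁ f := by
    refine A.le_wt_neg_mul ?_
    cases y₁
    · exact smoothing_le_XNormAt θ₁ hO hj f
    · exact (smoothing_le_YNormAt θ₁ hO hj f).1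
  cases y₂ with
  | true =>
    -- A `Y` factor in the maximal position costs only `σ/4` even with exponent `2/ε₀` in `x'`.
    refine hqp.trans (pow_le_pow_left' (mul_le_mul' smooth₁ ?_) 2)
    have := A.le_wt_neg_mul (maximal_le_YNormAt θ₂ j g).2
    simpa [lossExp, sectorNorm] using this
  | false =>
    cases y₁ with
    | true =>
      -- Here the exponents in `x'` are exchanged: the `Y` factor takes `2/ε₀` inside its smoothing
      -- norm, so that the `X` factor keeps `2/(1-ε₀)` and costs `σ/4`.
      refine hpq.trans (pow_le_pow_left' (mul_le_mul' ?_ ?_) 2)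
      · exact A.le_wt_neg_mul (smoothing_le_YNormAt θ₁ hO hj f).2
      · have := A.le_wt_neg_mul (maximal_le_XNormAt θ₂ j g).1
        simpa [lossExp, sectorNorm] using this
    | false =>
      refine hqp.trans (pow_le_pow_left' (mul_le_mul' smooth₁ ?_) 2)
      have := A.le_wt_neg_mul (maximal_le_XNormAt θ₂ j g).2
      simpa [lossExp, sectorNorm] using this

lemma lintegral_mul_mul_le {α : Type*} [MeasurableSpace α] {μ : Measure α} {f g : α → ℝ≥0∞}
    (hf : Measurable f) (hg : Measurable g) {B C : ℝ≥0∞} (hB : ∫⁻ x, f x ^ 2 ∂μ ≤ B ^ 2)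
    (hC : ∫⁻ x, g x ^ 2 ∂μ ≤ C ^ 2) : ∫⁻ x, f x * g x ∂μ ≤ B * C := by
  have h := ENNReal.lintegral_mul_le_Lp_mul_Lq μ Real.HolderConjugate.two_two
    hf.aemeasurable hg.aemeasurable
  refine h.trans (mul_le_mul' ?_ ?_)
  · have := ENNReal.rpow_le_rpow hB (by norm_num : (0 : ℝ) ≤ 1 / 2)
    rw [← ENNReal.rpow_natCast, ← ENNReal.rpow_mul] at this
    simpa using this
  · have := ENNReal.rpow_le_rpow hC (by norm_num : (0 : ℝ) ≤ 1 / 2)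
    rw [← ENNReal.rpow_natCast, ← ENNReal.rpow_mul] at this
    simpa using this

/-- The quadrilinear estimate for a fixed pairing of the four factors. -/
lemma lintegral_four_le_sectorNorm (hd : 0 < d) (h0 : 0 < ε₀) (h1 : ε₀ < 1) (y : Fin 4 → Bool)
    (θ : Fin 4 → A.Θ.Index) {u : Fin 4 → ℝ → Space d → ℂ}
    (hu : ∀ i, Measurable (Function.uncurry (u i))) (a b c e : Fin 4) :
    ∫⁻ p : ℝ × Space d, (‖u a p.1 p.2‖ₑ * ‖u c p.1 p.2‖ₑ) * (‖u b p.1 p.2‖ₑ * ‖u e p.1 p.2‖ₑ) ≤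
      (A.wt (θ a) (-((σ - 1) / 2)) * A.sectorNorm (y a) (θ a) (u a) *
        (A.wt (θ c) (lossExp d σ (y a || y c)) * A.sectorNorm (y c) (θ c) (u c))) *
      (A.wt (θ b) (-((σ - 1) / 2)) * A.sectorNorm (y b) (θ b) (u b) *
        (A.wt (θ e) (lossExp d σ (y b || y e)) * A.sectorNorm (y e) (θ e) (u e))) := by
  refine lintegral_mul_mul_le (f := fun p : ℝ × Space d => ‖u a p.1 p.2‖ₑ * ‖u c p.1 p.2‖ₑ)
    (g := fun p : ℝ × Space d => ‖u b p.1 p.2‖ₑ * ‖u e p.1 p.2‖ₑ) ((hu a).enorm.mul (hu c).enorm) ((hu b).enorm.mul (hu e).enorm) ?_ ?_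
  · simpa only [mul_pow] using lintegral_sq_mul_sq_le_sectorNorm hd h0 h1 (y a) (y c) (θ a) (θ c)
      (hu a) (hu c)
  · simpa only [mul_pow] using lintegral_sq_mul_sq_le_sectorNorm hd h0 h1 (y b) (y e) (θ b) (θ e)
      (hu b) (hu e)

/-- The permutation encodes the roles: `π 0` and `π 1` are smoothed, and are paired with `π 2` and
`π 3` respectively. -/
lemma lintegral_prod_le_sectorNorm (hd : 0 < d) (h0 : 0 < ε₀) (h1 : ε₀ < 1) (y : Fin 4 → Bool)
    (θ : Fin 4 → A.Θ.Index) {u : Fin 4 → ℝ → Space d → ℂ}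
    (hu : ∀ i, Measurable (Function.uncurry (u i))) (π : Equiv.Perm (Fin 4)) :
    ∫⁻ p : ℝ × Space d, ∏ i, ‖u i p.1 p.2‖ₑ ≤
      ENNReal.ofReal (Real.exp (-((σ - 1) / 2) * A.logScale (θ (π 0)) +
        -((σ - 1) / 2) * A.logScale (θ (π 1)) +
        lossExp d σ (y (π 0) || y (π 2)) * A.logScale (θ (π 2)) +
        lossExp d σ (y (π 1) || y (π 3)) * A.logScale (θ (π 3)))) *
      ∏ i, A.sectorNorm (y i) (θ i) (u i) := by
  have h := lintegral_four_le_sectorNorm hd h0 h1 y θ hu (π 0) (π 1) (π 2) (π 3)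
  have e1 : ∀ f : Fin 4 → ℝ≥0∞, ∏ i, f i = f (π 0) * f (π 1) * f (π 2) * f (π 3) := fun f => by
    rw [← Equiv.prod_comp π, Fin.prod_univ_four]
  simp_rw [e1]
  rw [Real.exp_add, Real.exp_add, Real.exp_add, ENNReal.ofReal_mul (by positivity),
    ENNReal.ofReal_mul (by positivity), ENNReal.ofReal_mul (by positivity)]
  simp_rw [← wt_eq_exp]
  refine le_trans (le_of_eq ?_) (h.trans (le_of_eq ?_))
  · refine lintegral_congr fun p => ?_
    ring
  · ring

/-- The abstract combinatorial condition on the placement of the four factors: whichever two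
factors are placed in smoothing norms, the remaining ones can be paired with them so that they
lose at most `lossExp (m l)` and `lossExp (n l)`, with `l` the last factor. -/
def Pairable (y m n : Fin 4 → Bool) : Prop :=
  ∀ π : Equiv.Perm (Fin 4),
    ((m (π 3) → y (π 0) || y (π 2)) ∧ (n (π 3) → y (π 1) || y (π 3))) ∨
    ((m (π 3) → y (π 1) || y (π 2)) ∧ (n (π 3) → y (π 0) || y (π 3)))

/-- Comes down to `σ/4 ≤ (d-1)/2`, true since `σ ≤ d` and `d ≥ 2`. -/
lemma lossExp_anti (hσd : σ ≤ (d : ℝ)) (hd : (2 : ℝ) ≤ d) {b b' : Bool} (h : b → b') :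
    lossExp d σ b' ≤ lossExp d σ b := by
  cases b <;> cases b' <;> simp [lossExp] at h ⊢
  linarith

lemma lintegral_prod_le_of_pairable (hσd : σ ≤ (d : ℝ)) (hd : (2 : ℝ) ≤ d) (h0 : 0 < ε₀)
    (h1 : ε₀ < 1) {y m n : Fin 4 → Bool} (hp : Pairable y m n)
    (θ : Fin 4 → A.Θ.Index) {u : Fin 4 → ℝ → Space d → ℂ}
    (hu : ∀ i, Measurable (Function.uncurry (u i))) (π : Equiv.Perm (Fin 4)) :
    ∫⁻ p : ℝ × Space d, ∏ i, ‖u i p.1 p.2‖ₑ ≤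
      ENNReal.ofReal (Real.exp (-((σ - 1) / 2) * A.logScale (θ (π 0)) +
        -((σ - 1) / 2) * A.logScale (θ (π 1)) +
        lossExp d σ (m (π 3)) * A.logScale (θ (π 2)) +
        lossExp d σ (n (π 3)) * A.logScale (θ (π 3)))) *
      ∏ i, A.sectorNorm (y i) (θ i) (u i) := by
  have hd0 : 0 < d := by
    have : (0 : ℝ) < d := by linarith
    exact_mod_cast this
  have key : ∀ {a b a' b' : ℝ} {i k : Fin 4}, a ≤ a' → b ≤ b' →
      a * A.logScale (θ i) + b * A.logScale (θ k) ≤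
        a' * A.logScale (θ i) + b' * A.logScale (θ k) := fun ha hb =>
    add_le_add (mul_le_mul_of_nonneg_right ha (A.logScale_nonneg _))
      (mul_le_mul_of_nonneg_right hb (A.logScale_nonneg _))
  rcases hp π with ⟨h2, h3⟩ | ⟨h2, h3⟩
  · refine (lintegral_prod_le_sectorNorm hd0 h0 h1 y θ hu π).trans (mul_le_mul_left ?_ _)
    refine ENNReal.ofReal_le_ofReal (Real.exp_le_exp.2 ?_)
    have := key (i := π 2) (k := π 3) (lossExp_anti hσd hd h2) (lossExp_anti hσd hd h3)
    linarith
  -- The second alternative of `Pairable` interchanges the two smoothed factors and leaves the lower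
  -- two in place.
  · refine (lintegral_prod_le_sectorNorm hd0 h0 h1 y θ hu
      ((Equiv.swap 0 1).trans π)).trans (mul_le_mul_left ?_ _)
    have e2 : (Equiv.swap (0 : Fin 4) 1) 2 = 2 := by decide
    have e3 : (Equiv.swap (0 : Fin 4) 1) 3 = 3 := by decide
    simp only [Equiv.trans_apply, Equiv.swap_apply_left, Equiv.swap_apply_right, e2, e3]
    refine ENNReal.ofReal_le_ofReal (Real.exp_le_exp.2 ?_)
    have := key (i := π 2) (k := π 3) (lossExp_anti hσd hd h2) (lossExp_anti hσd hd h3)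
    linarith

end Setup

/-- Bounding a linear form on an ordered orthant by its values on the extremal rays. -/
lemma exponent_le_of_ordered {K δ : ℝ} {c μ ν x : Fin 4 → ℝ} (π : Equiv.Perm (Fin 4))
    (hx01 : x (π 1) ≤ x (π 0)) (hx12 : x (π 2) ≤ x (π 1)) (hx23 : x (π 3) ≤ x (π 2))
    (hx3 : 0 ≤ x (π 3)) (hδ : 0 ≤ δ) (hx : ∃ j, j ≠ 0 ∧ x 0 ≤ x j + δ)
    (h1 : ∀ i, i ≠ 0 → c i - K ≤ 0) (h2 : ∀ i j, i ≠ j → c i + c j - 2 * K ≤ 0)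
    (h3 : ∀ l, ∑ i, c i - c l - 2 * K + μ l ≤ 0)
    (h4 : ∀ l, ∑ i, c i - 2 * K + μ l + ν l ≤ 0) :
    ∑ i, c i * x i + (-K * x (π 0) + -K * x (π 1) + μ (π 3) * x (π 2) + ν (π 3) * x (π 3)) ≤
      |c 0 - K| * δ := by
  have s1 : ∑ i, c i = c (π 0) + c (π 1) + c (π 2) + c (π 3) := by
    rw [← Equiv.sum_comp π, Fin.sum_univ_four]
  have s2 : ∑ i, c i * x i = c (π 0) * x (π 0) + c (π 1) * x (π 1) + c (π 2) * x (π 2) +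
      c (π 3) * x (π 3) := by
    rw [← Equiv.sum_comp π, Fin.sum_univ_four]
  -- Summation by parts writes the exponent in terms of the consecutive gaps of the ordered `x` and
  -- its least value; `t1` to `t4` bound the four terms. When the largest entry is `x 0`, the
  -- coefficient may have either sign, but the first gap is at most `δ`.
  have t1 : (x (π 0) - x (π 1)) * (c (π 0) - K) ≤ |c 0 - K| * δ := by
    by_cases h : π 0 = 0
    · rw [h]
      obtain ⟨j, hj, hxj⟩ := hx
      have hj1 : x j ≤ x (π 1) := by
        obtain ⟨i, rfl⟩ := π.surjective j
        have hi : i ≠ 0 := by rintro rfl; exact hj h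
        fin_cases i
        · exact absurd rfl hi
        · exact le_rfl
        · exact hx12
        · exact hx23.trans hx12
      rw [h] at hx01
      have := mul_le_mul (le_abs_self (c 0 - K)) (show x 0 - x (π 1) ≤ δ by linarith)
        (by linarith) (abs_nonneg _)
      linarith
    · have := mul_nonpos_of_nonneg_of_nonpos (show 0 ≤ x (π 0) - x (π 1) by linarith) (h1 _ h)
      have := mul_nonneg (abs_nonneg (c 0 - K)) hδ
      linarith
  have t2 := mul_nonpos_of_nonneg_of_nonpos (show 0 ≤ x (π 1) - x (π 2) by linarith)
    (h2 (π 0) (π 1) (by simp))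
  have t3 := mul_nonpos_of_nonneg_of_nonpos (show 0 ≤ x (π 2) - x (π 3) by linarith) (h3 (π 3))
  have t4 := mul_nonpos_of_nonneg_of_nonpos hx3 (h4 (π 3))
  rw [s1] at t3 t4
  rw [s2]
  nlinarith

lemma exists_perm_ordered (x : Fin 4 → ℝ) : ∃ π : Equiv.Perm (Fin 4),
    x (π 1) ≤ x (π 0) ∧ x (π 2) ≤ x (π 1) ∧ x (π 3) ≤ x (π 2) := by
  have h := Tuple.monotone_sort (fun i => -x i)
  refine ⟨Tuple.sort fun i => -x i, ?_, ?_, ?_⟩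
  · simpa using h (show (0 : Fin 4) ≤ 1 by decide)
  · simpa using h (show (1 : Fin 4) ≤ 2 by decide)
  · simpa using h (show (2 : Fin 4) ≤ 3 by decide)

/-! ### Summable frequency gains in the quadrilinear estimate -/

namespace Setup

variable {d : ℕ} {σ ε₀ : ℝ} {A : Setup d σ ε₀}

/-- The norm of `Y^r` if `y` holds, and of `X^r` otherwise. -/
def fieldNorm (A : Setup d σ ε₀) (y : Bool) (r : ℝ) (v : Field d) : ℝ≥0∞ :=
  if y then A.YNorm r Set.univ v else A.XNorm r Set.univ v

lemma fieldNorm_eq (y : Bool) (r : ℝ) (v : Field d) :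
    A.fieldNorm y r v =
      (∑' θ : A.Θ.Index, A.wt θ (2 * r) * A.sectorNorm y θ (proj θ v) ^ 2) ^ (1 / 2 : ℝ) := by
  cases y <;> rfl

lemma sectorNorm_proj_le (y : Bool) (r : ℝ) (v : Field d) (θ : A.Θ.Index) :
    A.sectorNorm y θ (proj θ v) ≤ A.wt θ (-r) * A.fieldNorm y r v := by
  refine A.le_wt_neg_mul ?_
  rw [fieldNorm_eq]
  have h := ENNReal.le_tsum (f := fun θ : A.Θ.Index =>
    A.wt θ (2 * r) * A.sectorNorm y θ (proj θ v) ^ 2) θ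
  have h2 := ENNReal.rpow_le_rpow h (by norm_num : (0 : ℝ) ≤ 1 / 2)
  refine le_trans (le_of_eq ?_) h2
  rw [← wt_sq, ← mul_pow, ← ENNReal.rpow_natCast, ← ENNReal.rpow_mul]
  norm_num

/-- A geometric series in the scale, times the finite number of directions. -/
lemma tsum_wt_neg_lt_top (A : Setup d σ ε₀) {δ : ℝ} (hδ : 0 < δ) :
    ∑' θ : A.Θ.Index, A.wt θ (-δ) < ⊤ := by
  have hl : 0 < Real.log (1 + A.Θ.res) := Real.log_pos A.Θ.one_lt
  have h1 : ∀ θ : A.Θ.Index,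
      A.wt θ (-δ) = ENNReal.ofReal (Real.exp (-(δ * Real.log (1 + A.Θ.res)))) ^ θ.1 := fun θ => by
    rw [wt_eq_exp, logScale, Sectors.scale, Real.log_pow, ← ENNReal.ofReal_pow (Real.exp_nonneg _),
      ← Real.exp_nat_mul]
    congr 2
    ring
  simp_rw [h1]
  rw [ENNReal.tsum_prod']
  have hq : ENNReal.ofReal (Real.exp (-(δ * Real.log (1 + A.Θ.res)))) < 1 := by
    rw [← ENNReal.ofReal_one, ENNReal.ofReal_lt_ofReal_iff one_pos, Real.exp_lt_one_iff]
    have := mul_pos hδ hl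
    linarith
  simp only [tsum_fintype, Finset.sum_const, nsmul_eq_mul]
  rw [ENNReal.tsum_mul_left, ENNReal.tsum_geometric]
  refine ENNReal.mul_lt_top (by simp) (ENNReal.inv_lt_top.2 (tsub_pos_of_lt hq))

/-- The data of a case of the trilinear estimate: which factors are measured in `Y`, the
regularities, and the pairing pattern. Index `0` stands for the dual function. -/
structure Admissible (d : ℕ) (σ : ℝ) (y m n : Fin 4 → Bool) (c : Fin 4 → ℝ) : Prop where
  dual : y 0 = false
  pairable : Pairable y m n
  one : ∀ i, i ≠ 0 → c i - (σ - 1) / 2 ≤ 0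
  two : ∀ i j, i ≠ j → c i + c j - 2 * ((σ - 1) / 2) ≤ 0
  three : ∀ l, ∑ i, c i - c l - 2 * ((σ - 1) / 2) + lossExp d σ (m l) ≤ 0
  four : ∀ l, ∑ i, c i - 2 * ((σ - 1) / 2) + lossExp d σ (m l) + lossExp d σ (n l) ≤ 0

/-- The constant in the quadrilinear estimate. -/
def quadConst (σ ε : ℝ) (c : Fin 4 → ℝ) : ℝ≥0∞ :=
  ENNReal.ofReal (Real.exp (|c 0 - (σ - 1) / 2| * Real.log 12 + ε / 2 * Real.log 12))

/-- The quadrilinear estimate with summable gain in all frequencies. -/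
lemma lintegral_quadrilinear_le (hσd : σ ≤ (d : ℝ)) (hd : (2 : ℝ) ≤ d) (h0 : 0 < ε₀) (h1 : ε₀ < 1)
    {ε : ℝ} (hε : 0 < ε) {y m n : Fin 4 → Bool} {c : Fin 4 → ℝ} (H : Admissible d σ y m n c)
    (θ θ₁ θ₂ θ₃ : A.Θ.Index)
    (hθ : Sectors.scale θ ≤ 12 * Sectors.scale θ₁ ∨ Sectors.scale θ ≤ 12 * Sectors.scale θ₂ ∨
      Sectors.scale θ ≤ 12 * Sectors.scale θ₃)
    {g : ℝ → Space d → ℂ} (hg : Measurable (Function.uncurry g)) {z₁ z₂ z₃ : Field d}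
    (hz₁ : z₁.IsMeasurable) (hz₂ : z₂.IsMeasurable) (hz₃ : z₃.IsMeasurable) :
    ∫⁻ p : ℝ × Space d, ‖g p.1 p.2‖ₑ *
        ‖proj θ₁ z₁ p.1 p.2 * proj θ₂ z₂ p.1 p.2 * proj θ₃ z₃ p.1 p.2‖ₑ ≤
      quadConst σ ε c * A.wt θ (-(c 0 + ε / 2)) *
        (A.wt θ₁ (-(ε / 2)) * A.wt θ₂ (-(ε / 2)) * A.wt θ₃ (-(ε / 2))) *
        (A.XNormAt θ Set.univ g * (A.fieldNorm (y 1) (-c 1 + ε) z₁ *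
          A.fieldNorm (y 2) (-c 2 + ε) z₂ * A.fieldNorm (y 3) (-c 3 + ε) z₃)) := by
  set ϑ : Fin 4 → A.Θ.Index := ![θ, θ₁, θ₂, θ₃] with hϑ
  set u : Fin 4 → ℝ → Space d → ℂ := ![g, proj θ₁ z₁, proj θ₂ z₂, proj θ₃ z₃] with hu
  have hum : ∀ i, Measurable (Function.uncurry (u i)) := by
    intro i
    fin_cases i
    · exact hg
    · exact measurable_uncurry_proj θ₁ hz₁
    · exact measurable_uncurry_proj θ₂ hz₂
    · exact measurable_uncurry_proj θ₃ hz₃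
  obtain ⟨π, p1, p2, p3⟩ := exists_perm_ordered fun i => A.logScale (ϑ i)
  have hq := lintegral_prod_le_of_pairable hσd hd h0 h1 H.pairable ϑ hum π
  have hlog : ∀ θ' : A.Θ.Index, Sectors.scale θ ≤ 12 * Sectors.scale θ' →
      A.logScale θ ≤ A.logScale θ' + Real.log 12 := fun θ' h => by
    have := Real.log_le_log (Sectors.scale_pos θ) h
    rw [Real.log_mul (by norm_num) (Sectors.scale_pos θ').ne'] at this
    unfold logScale; linarith
  have hx : ∃ j, j ≠ 0 ∧ A.logScale (ϑ 0) ≤ A.logScale (ϑ j) + Real.log 12 := by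
    rcases hθ with h | h | h
    · exact ⟨1, by decide, hlog _ h⟩
    · exact ⟨2, by decide, hlog _ h⟩
    · exact ⟨3, by decide, hlog _ h⟩
  have hδ : 0 ≤ Real.log 12 := Real.log_nonneg (by norm_num)
  have hexp := exponent_le_of_ordered (x := fun i => A.logScale (ϑ i)) (K := (σ - 1) / 2)
    (μ := fun l => lossExp d σ (m l)) (ν := fun l => lossExp d σ (n l)) π p1 p2 p3
    (A.logScale_nonneg _) hδ hx H.one H.two H.three H.four
  have hlhs : ∀ p : ℝ × Space d, ‖g p.1 p.2‖ₑ *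
      ‖proj θ₁ z₁ p.1 p.2 * proj θ₂ z₂ p.1 p.2 * proj θ₃ z₃ p.1 p.2‖ₑ =
        ∏ i, ‖u i p.1 p.2‖ₑ := fun p => by
    simp only [Fin.prod_univ_four, enorm_mul, hu, Matrix.cons_val, mul_assoc]
  simp_rw [hlhs]
  refine hq.trans ?_
  have hprod : ∏ i, A.sectorNorm (y i) (ϑ i) (u i) ≤ A.XNormAt θ Set.univ g *
      ((A.wt θ₁ (-(-c 1 + ε)) * A.fieldNorm (y 1) (-c 1 + ε) z₁) *
       (A.wt θ₂ (-(-c 2 + ε)) * A.fieldNorm (y 2) (-c 2 + ε) z₂) *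
       (A.wt θ₃ (-(-c 3 + ε)) * A.fieldNorm (y 3) (-c 3 + ε) z₃)) := by
    rw [Fin.prod_univ_four, mul_assoc, mul_assoc, ← mul_assoc (A.sectorNorm (y 1) _ _)]
    refine mul_le_mul' ?_ (mul_le_mul' (mul_le_mul' ?_ ?_) ?_)
    · rw [H.dual]; exact le_rfl
    · exact sectorNorm_proj_le (y 1) _ z₁ θ₁
    · exact sectorNorm_proj_le (y 2) _ z₂ θ₂
    · exact sectorNorm_proj_le (y 3) _ z₃ θ₃
  refine (mul_le_mul_right hprod _).trans ?_
  set E := -((σ - 1) / 2) * A.logScale (ϑ (π 0)) + -((σ - 1) / 2) * A.logScale (ϑ (π 1)) +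
    lossExp d σ (m (π 3)) * A.logScale (ϑ (π 2)) + lossExp d σ (n (π 3)) * A.logScale (ϑ (π 3))
  -- Each input carries a spare weight `N_{θᵢ}^{-ε}`. One half is kept for the sums over the inputs,
  -- and the other half is traded for `N_θ^{-ε/2}`, because `log N_θ` is at most the sum of the
  -- input logarithms plus `log 12`.
  have hw : ENNReal.ofReal (Real.exp E) * (A.wt θ₁ (-(-c 1 + ε)) * A.wt θ₂ (-(-c 2 + ε)) *
      A.wt θ₃ (-(-c 3 + ε))) ≤ quadConst σ ε c * A.wt θ (-(c 0 + ε / 2)) *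
        (A.wt θ₁ (-(ε / 2)) * A.wt θ₂ (-(ε / 2)) * A.wt θ₃ (-(ε / 2))) := by
    simp only [wt_eq_exp, quadConst, ← ENNReal.ofReal_mul (Real.exp_nonneg _), ← Real.exp_add]
    refine ENNReal.ofReal_le_ofReal (Real.exp_le_exp.2 ?_)
    rw [Fin.sum_univ_four] at hexp
    change c 0 * A.logScale θ + c 1 * A.logScale θ₁ + c 2 * A.logScale θ₂ + c 3 * A.logScale θ₃ +
      E ≤ _ at hexp
    have n1 := A.logScale_nonneg θ₁
    have n2 := A.logScale_nonneg θ₂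
    have n3 := A.logScale_nonneg θ₃
    have hx' : A.logScale θ ≤ A.logScale θ₁ + A.logScale θ₂ + A.logScale θ₃ + Real.log 12 := by
      rcases hθ with h | h | h <;> have := hlog _ h <;> linarith
    have := mul_le_mul_of_nonneg_left hx' (show 0 ≤ ε / 2 by linarith)
    linarith
  calc _ = (ENNReal.ofReal (Real.exp E) * (A.wt θ₁ (-(-c 1 + ε)) * A.wt θ₂ (-(-c 2 + ε)) *
      A.wt θ₃ (-(-c 3 + ε)))) * (A.XNormAt θ Set.univ g * (A.fieldNorm (y 1) (-c 1 + ε) z₁ *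
          A.fieldNorm (y 2) (-c 2 + ε) z₂ * A.fieldNorm (y 3) (-c 3 + ε) z₃)) := by ring
    _ ≤ _ := mul_le_mul_left hw _

lemma XNormAt_translate (θ : A.Θ.Index) (I : Set ℝ) (v : ℝ → Space d → ℂ) (z : Space d) :
    A.XNormAt θ I (fun t x => v t (x - z)) = A.XNormAt θ I v := by
  simp only [XNormAt, mixedNorm_translate, dirNorm_translate]

end Setup

/-! ### The dual norm of the product -/

namespace Setup

variable {d : ℕ} {σ ε₀ : ℝ} {A : Setup d σ ε₀}

/-- The sectors with scale at most `(1 + ε_Θ)^M`. -/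
def lowSectors (Θ : Sectors d) (M : ℕ) : Finset Θ.Index := Finset.range (M + 1) ×ˢ Θ.dirs.attach

lemma lowFreq_eq_sum (Θ : Sectors d) (M : ℕ) (z : Field d) (t : ℝ) (x : Space d) :
    lowFreq Θ M z t x = ∑ θ ∈ lowSectors Θ M, proj θ z t x := by
  rw [lowFreq, lowSectors, Finset.sum_product]

/-- The product of the three sector components. -/
def triple {Θ : Sectors d} (z₁ z₂ z₃ : Field d) (τ : Θ.Index × Θ.Index × Θ.Index) (t : ℝ)
    (x : Space d) : ℂ :=
  proj τ.1 z₁ t x * proj τ.2.1 z₂ t x * proj τ.2.2 z₃ t x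

lemma measurable_uncurry_triple {Θ : Sectors d} {z₁ z₂ z₃ : Field d} (hz₁ : z₁.IsMeasurable)
    (hz₂ : z₂.IsMeasurable) (hz₃ : z₃.IsMeasurable) (τ : Θ.Index × Θ.Index × Θ.Index) :
    Measurable (Function.uncurry (triple z₁ z₂ z₃ τ)) :=
  ((measurable_uncurry_proj τ.1 hz₁).mul (measurable_uncurry_proj τ.2.1 hz₂)).mul
    (measurable_uncurry_proj τ.2.2 hz₃)

lemma integrable_triple_mul {Θ : Sectors d} (z₁ z₂ z₃ : Field d)
    (τ : Θ.Index × Θ.Index × Θ.Index) (t : ℝ) (φ : 𝓢(Space d, ℂ)) :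
    Integrable fun x => triple z₁ z₂ z₃ τ t x * φ x :=
  (rapidDecay_triple τ.1 τ.2.1 τ.2.2 z₁ z₂ z₃ t φ).integrable

/-- The triples of sectors with scale at most `(1 + ε_Θ)^M`. -/
def lowTriples (Θ : Sectors d) (M : ℕ) : Finset (Θ.Index × Θ.Index × Θ.Index) :=
  lowSectors Θ M ×ˢ lowSectors Θ M ×ˢ lowSectors Θ M

lemma integral_lowFreq_mul (Θ : Sectors d) (M : ℕ) (z₁ z₂ z₃ : Field d) (t : ℝ)
    (φ : 𝓢(Space d, ℂ)) :
    ∫ x, lowFreq Θ M z₁ t x * lowFreq Θ M z₂ t x * lowFreq Θ M z₃ t x * φ x =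
      ∑ τ ∈ lowTriples Θ M, ∫ x, triple z₁ z₂ z₃ τ t x * φ x := by
  rw [← integral_finsetSum _ fun τ _ => integrable_triple_mul z₁ z₂ z₃ τ t φ]
  congr 1
  ext x
  rw [← Finset.sum_mul]
  congr 1
  simp only [lowFreq_eq_sum, lowTriples, Finset.sum_product, triple]
  simp only [← Finset.mul_sum, ← Finset.sum_mul]

/-- Tonelli and the substitution `z = y - x`: convolution with a kernel becomes an average over
translates of `G`. -/
lemma lintegral_mul_convolution {G F : ℝ → Space d → ℝ≥0∞} {K : Space d → ℝ≥0∞}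
    (hG : Measurable (Function.uncurry G)) (hF : Measurable (Function.uncurry F))
    (hK : Measurable K) :
    ∫⁻ p : ℝ × Space d, G p.1 p.2 * ∫⁻ y, F p.1 y * K (y - p.2) =
      ∫⁻ z, K z * ∫⁻ p : ℝ × Space d, G p.1 (p.2 - z) * F p.1 p.2 := by
  have m1 : Measurable fun p : (ℝ × Space d) × Space d => F p.1.1 p.2 * K (p.2 - p.1.2) :=
    (hF.comp (measurable_fst.fst.prodMk measurable_snd)).mul
      (hK.comp (measurable_snd.sub measurable_fst.snd))
  have m1' : Measurable fun p : ℝ × Space d => G p.1 p.2 * ∫⁻ y, F p.1 y * K (y - p.2) :=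
    hG.mul (Measurable.lintegral_prod_right' m1)
  have m2 : Measurable fun p : (ℝ × Space d) × Space d =>
      K p.2 * (G p.1.1 (p.1.2 - p.2) * F p.1.1 p.1.2) :=
    (hK.comp measurable_snd).mul
      ((hG.comp (measurable_fst.fst.prodMk (measurable_fst.snd.sub measurable_snd))).mul
      (hF.comp measurable_fst))
  have m2' : Measurable fun p : ℝ × Space d => ∫⁻ z, K z * (G p.1 (p.2 - z) * F p.1 p.2) :=
    Measurable.lintegral_prod_right' m2
  have e1 : ∀ t, ∫⁻ x, G t x * ∫⁻ y, F t y * K (y - x) =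
      ∫⁻ y, ∫⁻ z, K z * (G t (y - z) * F t y) := fun t => by
    have mG : Measurable (G t) := hG.comp measurable_prodMk_left
    have mF : Measurable (F t) := hF.comp measurable_prodMk_left
    have a1 : ∀ x, G t x * ∫⁻ y, F t y * K (y - x) = ∫⁻ y, G t x * (F t y * K (y - x)) :=
      fun x => (lintegral_const_mul _ (mF.mul (hK.comp (measurable_id.sub_const x)))).symm
    simp_rw [a1]
    rw [lintegral_lintegral_swap (Measurable.aemeasurable (by
      exact (mG.comp measurable_fst).mul ((mF.comp measurable_snd).mul
        (hK.comp (measurable_snd.sub measurable_fst)))))]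
    refine lintegral_congr fun y => ?_
    rw [← lintegral_sub_left_eq_self _ y]
    refine lintegral_congr fun z => ?_
    rw [sub_sub_cancel]; ring
  calc _ = ∫⁻ t, ∫⁻ x, G t x * ∫⁻ y, F t y * K (y - x) := by
        rw [Measure.volume_eq_prod, lintegral_prod _ m1'.aemeasurable]
    _ = ∫⁻ p : ℝ × Space d, ∫⁻ z, K z * (G p.1 (p.2 - z) * F p.1 p.2) := by
        simp_rw [e1]
        rw [Measure.volume_eq_prod, lintegral_prod _ m2'.aemeasurable]
    _ = ∫⁻ z, ∫⁻ p : ℝ × Space d, K z * (G p.1 (p.2 - z) * F p.1 p.2) :=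
        lintegral_lintegral_swap m2.aemeasurable
    _ = _ := by
        refine lintegral_congr fun z => lintegral_const_mul _ ?_
        exact (hG.comp (measurable_fst.prodMk (measurable_snd.sub_const z))).mul hF

/-- The output sector `θ` can see the product of three sectors. -/
def Interacts {Θ : Sectors d} (θ : Θ.Index) (τ : Θ.Index × Θ.Index × Θ.Index) : Prop :=
  Sectors.scale θ ≤ 12 * Sectors.scale τ.1 ∨ Sectors.scale θ ≤ 12 * Sectors.scale τ.2.1 ∨
    Sectors.scale θ ≤ 12 * Sectors.scale τ.2.2

-- The defining limit of the product is tested against the translated kernel of `P_θ`. Each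
-- truncation is a finite sum over triples, the non-interacting ones contribute exactly zero, and
-- the bound by the full series is uniform in the truncation.
open Classical in
lemma enorm_proj_le_of_isProduct {Θ : Sectors d} {z₁ z₂ z₃ h : Field d}
    (hh : IsProduct Θ z₁ z₂ z₃ h) (θ : Θ.Index) :
    ∀ᵐ t : ℝ, ∀ x, ‖proj θ h t x‖ₑ ≤ ∑' τ : Θ.Index × Θ.Index × Θ.Index,
      if Interacts θ τ then ∫⁻ y, ‖triple z₁ z₂ z₃ τ t y‖ₑ *
        ‖(𝓕 (Sectors.multSchwartz θ) : 𝓢(Space d, ℂ)) (y - x)‖ₑ else 0 := by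
  filter_upwards [hh] with t ht x
  have hlim := (ht ((𝓕 (Sectors.multSchwartz θ)).compSubConstCLM ℂ x)).enorm
  refine le_of_tendsto hlim (Eventually.of_forall fun M => ?_)
  rw [integral_lowFreq_mul]
  refine (enorm_sum_le _ _).trans (le_trans (Finset.sum_le_sum fun τ _ => ?_)
    (ENNReal.sum_le_tsum (lowTriples Θ M)))
  split_ifs with hi
  · refine (enorm_integral_le_lintegral_enorm _).trans (le_of_eq ?_)
    refine lintegral_congr fun y => ?_
    rw [enorm_mul, SchwartzMap.compSubConstCLM_apply]
  · simp only [Interacts, not_or, not_le] at hi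
    have := integral_triple_mul_kernel_eq_zero θ τ.1 τ.2.1 τ.2.2 z₁ z₂ z₃ t x hi.1 hi.2.1 hi.2.2
    simp only [triple]
    rw [this, enorm_zero]

lemma tsum_wt_triple (δ : ℝ) :
    ∑' τ : A.Θ.Index × A.Θ.Index × A.Θ.Index, A.wt τ.1 δ * A.wt τ.2.1 δ * A.wt τ.2.2 δ =
      (∑' θ : A.Θ.Index, A.wt θ δ) ^ 3 := by
  rw [ENNReal.tsum_prod']
  have h : ∀ θ : A.Θ.Index, ∑' τ : A.Θ.Index × A.Θ.Index,
      A.wt θ δ * A.wt τ.1 δ * A.wt τ.2 δ = A.wt θ δ * (∑' θ : A.Θ.Index, A.wt θ δ) ^ 2 :=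
    fun θ => by
    rw [ENNReal.tsum_prod (f := fun θ₁ θ₂ => A.wt θ δ * A.wt θ₁ δ * A.wt θ₂ δ)]
    simp only [ENNReal.tsum_mul_left, ENNReal.tsum_mul_right]
    ring
  simp only [h, ENNReal.tsum_mul_right]
  ring

open Classical in
/-- The product tested against a function in `X_θ`. -/
lemma lintegral_mul_proj_le (hσd : σ ≤ (d : ℝ)) (hd : (2 : ℝ) ≤ d) (h0 : 0 < ε₀) (h1 : ε₀ < 1)
    {ε : ℝ} (hε : 0 < ε) {y m n : Fin 4 → Bool} {c : Fin 4 → ℝ} (H : Admissible d σ y m n c)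
    {κ : ℝ≥0}
    (hκ : ∀ θ : A.Θ.Index, ∫⁻ w, ‖(𝓕 (Sectors.multSchwartz θ) : 𝓢(Space d, ℂ)) w‖ₑ ≤ κ)
    {z₁ z₂ z₃ : Field d} (hz₁ : z₁.IsMeasurable) (hz₂ : z₂.IsMeasurable)
    (hz₃ : z₃.IsMeasurable) {h : Field d} (hh : IsProduct A.Θ z₁ z₂ z₃ h) (θ : A.Θ.Index)
    {g : ℝ → Space d → ℂ} (hg : Measurable (Function.uncurry g)) :
    ∫⁻ p : ℝ × Space d, ‖g p.1 p.2‖ₑ * ‖proj θ h p.1 p.2‖ₑ ≤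
      κ * (quadConst σ ε c * A.wt θ (-(c 0 + ε / 2)) * (∑' θ : A.Θ.Index, A.wt θ (-(ε / 2))) ^ 3 *
        (A.XNormAt θ Set.univ g * (A.fieldNorm (y 1) (-c 1 + ε) z₁ *
          A.fieldNorm (y 2) (-c 2 + ε) z₂ * A.fieldNorm (y 3) (-c 3 + ε) z₃))) := by
  set K : Space d → ℂ := ⇑(𝓕 (Sectors.multSchwartz θ) : 𝓢(Space d, ℂ)) with hK
  have hKm : Measurable fun z => ‖K z‖ₑ :=
    (𝓕 (Sectors.multSchwartz θ) : 𝓢(Space d, ℂ)).continuous.measurable.enorm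
  set N := A.fieldNorm (y 1) (-c 1 + ε) z₁ * A.fieldNorm (y 2) (-c 2 + ε) z₂ *
    A.fieldNorm (y 3) (-c 3 + ε) z₃
  set B := quadConst σ ε c * A.wt θ (-(c 0 + ε / 2))
  have hpt : ∀ᵐ p : ℝ × Space d, ‖proj θ h p.1 p.2‖ₑ ≤
      ∑' τ : A.Θ.Index × A.Θ.Index × A.Θ.Index, if Interacts θ τ then
        ∫⁻ y, ‖triple z₁ z₂ z₃ τ p.1 y‖ₑ * ‖K (y - p.2)‖ₑ else 0 := by
    have := Measure.quasiMeasurePreserving_fst (μ := (volume : Measure ℝ))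
      (ν := (volume : Measure (Space d))) |>.ae (enorm_proj_le_of_isProduct hh θ)
    filter_upwards [this] with p hp using hp p.2
  have hm : ∀ τ : A.Θ.Index × A.Θ.Index × A.Θ.Index, Measurable fun p : ℝ × Space d =>
      ∫⁻ y, ‖triple z₁ z₂ z₃ τ p.1 y‖ₑ * ‖K (y - p.2)‖ₑ := fun τ => by
    refine Measurable.lintegral_prod_right'
      (f := fun q : (ℝ × Space d) × Space d => ‖triple z₁ z₂ z₃ τ q.1.1 q.2‖ₑ *
        ‖K (q.2 - q.1.2)‖ₑ) ?_
    exact ((measurable_uncurry_triple hz₁ hz₂ hz₃ τ).enorm.comp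
      (measurable_fst.fst.prodMk measurable_snd)).mul
      (hKm.comp (measurable_snd.sub measurable_fst.snd))
  have hterm : ∀ τ : A.Θ.Index × A.Θ.Index × A.Θ.Index, Interacts θ τ →
      ∫⁻ p : ℝ × Space d, ‖g p.1 p.2‖ₑ *
        ∫⁻ y, ‖triple z₁ z₂ z₃ τ p.1 y‖ₑ * ‖K (y - p.2)‖ₑ ≤
      κ * (B * (A.wt τ.1 (-(ε / 2)) * A.wt τ.2.1 (-(ε / 2)) * A.wt τ.2.2 (-(ε / 2))) *
        (A.XNormAt θ Set.univ g * N)) := fun τ hτ => by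
    rw [lintegral_mul_convolution (G := fun t x => ‖g t x‖ₑ)
      (F := fun t x => ‖triple z₁ z₂ z₃ τ t x‖ₑ) (K := fun z => ‖K z‖ₑ) hg.enorm
      (measurable_uncurry_triple hz₁ hz₂ hz₃ τ).enorm hKm]
    calc _ ≤ ∫⁻ z, ‖K z‖ₑ * (B * (A.wt τ.1 (-(ε / 2)) * A.wt τ.2.1 (-(ε / 2)) *
          A.wt τ.2.2 (-(ε / 2))) * (A.XNormAt θ Set.univ g * N)) := by
          -- For fixed `z` the quadrilinear estimate is applied to the translate of `g`, whose `X_θ`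
          -- norm is that of `g`.
          refine lintegral_mono fun z => mul_le_mul_right ?_ _
          have hgz : Measurable (Function.uncurry fun t x => g t (x - z)) :=
            hg.comp (measurable_fst.prodMk (measurable_snd.sub_const z))
          have := lintegral_quadrilinear_le hσd hd h0 h1 hε H θ τ.1 τ.2.1 τ.2.2 hτ hgz hz₁ hz₂ hz₃
          rw [XNormAt_translate] at this
          exact this
      _ = (∫⁻ z, ‖K z‖ₑ) * _ := lintegral_mul_const _ hKm
      _ ≤ _ := mul_le_mul_left (hκ θ) _
  calc _ ≤ ∫⁻ p : ℝ × Space d, ∑' τ : A.Θ.Index × A.Θ.Index × A.Θ.Index,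
        ‖g p.1 p.2‖ₑ * (if Interacts θ τ then
          ∫⁻ y, ‖triple z₁ z₂ z₃ τ p.1 y‖ₑ * ‖K (y - p.2)‖ₑ else 0) := by
        refine lintegral_mono_ae ?_
        filter_upwards [hpt] with p hp
        rw [ENNReal.tsum_mul_left]
        exact mul_le_mul_right hp _
    _ = ∑' τ : A.Θ.Index × A.Θ.Index × A.Θ.Index, ∫⁻ p : ℝ × Space d,
        ‖g p.1 p.2‖ₑ * (if Interacts θ τ then
          ∫⁻ y, ‖triple z₁ z₂ z₃ τ p.1 y‖ₑ * ‖K (y - p.2)‖ₑ else 0) := by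
        refine lintegral_tsum fun τ => (hg.enorm.mul ?_).aemeasurable
        by_cases hτ : Interacts θ τ
        · simpa only [hτ, if_true] using hm τ
        · simp only [hτ, if_false, measurable_const]
    _ ≤ ∑' τ : A.Θ.Index × A.Θ.Index × A.Θ.Index, κ * (B * (A.wt τ.1 (-(ε / 2)) *
        A.wt τ.2.1 (-(ε / 2)) * A.wt τ.2.2 (-(ε / 2))) * (A.XNormAt θ Set.univ g * N)) := by
        refine ENNReal.tsum_le_tsum fun τ => ?_
        by_cases hτ : Interacts θ τ
        · simpa only [hτ, if_true] using hterm τ hτ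
        · simp [hτ]
    _ = _ := by
        rw [ENNReal.tsum_mul_left, ENNReal.tsum_mul_right, ENNReal.tsum_mul_left, tsum_wt_triple]

/-- The constant in the trilinear estimate. -/
def trilinearConst (A : Setup d σ ε₀) (κ : ℝ≥0) (ε : ℝ) (c : Fin 4 → ℝ) : ℝ≥0∞ :=
  κ * (quadConst σ ε c * (∑' θ : A.Θ.Index, A.wt θ (-(ε / 2))) ^ 3) *
    (∑' θ : A.Θ.Index, A.wt θ (-ε)) ^ (1 / 2 : ℝ)

lemma trilinearConst_lt_top (A : Setup d σ ε₀) (κ : ℝ≥0) {ε : ℝ} (hε : 0 < ε) (c : Fin 4 → ℝ) :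
    trilinearConst A κ ε c < ⊤ := by
  have h1 := A.tsum_wt_neg_lt_top (half_pos hε)
  have h2 := A.tsum_wt_neg_lt_top hε
  unfold trilinearConst quadConst
  exact ENNReal.mul_lt_top (ENNReal.mul_lt_top ENNReal.coe_lt_top
    (ENNReal.mul_lt_top ENNReal.ofReal_lt_top (ENNReal.pow_lt_top h1)))
    (ENNReal.rpow_lt_top_of_nonneg (by norm_num) h2.ne)

/-- Testing gives a bound `N_θ^{-(c 0 + ε/2)}` for each output sector. After weighting by `N_θ^{r}`
with `r ≤ c 0` and squaring, `N_θ^{-ε}` is left, which is summable. -/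
lemma XStarNorm_le_of_isProduct (hσd : σ ≤ (d : ℝ)) (hd : (2 : ℝ) ≤ d) (h0 : 0 < ε₀) (h1 : ε₀ < 1)
    {ε : ℝ} (hε : 0 < ε) {y m n : Fin 4 → Bool} {c : Fin 4 → ℝ} (H : Admissible d σ y m n c)
    {κ : ℝ≥0}
    (hκ : ∀ θ : A.Θ.Index, ∫⁻ w, ‖(𝓕 (Sectors.multSchwartz θ) : 𝓢(Space d, ℂ)) w‖ₑ ≤ κ)
    {z₁ z₂ z₃ : Field d} (hz₁ : z₁.IsMeasurable) (hz₂ : z₂.IsMeasurable)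
    (hz₃ : z₃.IsMeasurable) {h : Field d} (hh : IsProduct A.Θ z₁ z₂ z₃ h) {r : ℝ}
    (hr : r ≤ c 0) :
    A.XStarNorm r Set.univ h ≤ trilinearConst A κ ε c * (A.fieldNorm (y 1) (-c 1 + ε) z₁ *
      A.fieldNorm (y 2) (-c 2 + ε) z₂ * A.fieldNorm (y 3) (-c 3 + ε) z₃) := by
  set N := A.fieldNorm (y 1) (-c 1 + ε) z₁ * A.fieldNorm (y 2) (-c 2 + ε) z₂ *
    A.fieldNorm (y 3) (-c 3 + ε) z₃
  set Q := κ * (quadConst σ ε c * (∑' θ : A.Θ.Index, A.wt θ (-(ε / 2))) ^ 3) with hQ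
  have hsec : ∀ θ : A.Θ.Index, A.XStarNormAt θ Set.univ (proj θ h) ≤
      A.wt θ (-(c 0 + ε / 2)) * (Q * N) := fun θ => by
    unfold XStarNormAt
    refine iSup_le fun g => iSup_le fun hg => iSup_le fun hg1 => iSup_le fun _ => ?_
    refine (enorm_integral_le_lintegral_enorm _).trans ?_
    rw [Measure.restrict_univ]
    simp_rw [enorm_mul]
    refine (lintegral_mul_proj_le hσd hd h0 h1 hε H hκ hz₁ hz₂ hz₃ hh θ hg).trans ?_
    calc _ ≤ κ * (quadConst σ ε c * A.wt θ (-(c 0 + ε / 2)) *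
        (∑' θ : A.Θ.Index, A.wt θ (-(ε / 2))) ^ 3 * (1 * N)) := by gcongr
      _ = _ := by rw [hQ]; ring
  have hsum : ∑' θ : A.Θ.Index, A.wt θ (2 * r) * A.XStarNormAt θ Set.univ (proj θ h) ^ 2 ≤
      (∑' θ : A.Θ.Index, A.wt θ (-ε)) * (Q * N) ^ 2 := by
    rw [← ENNReal.tsum_mul_right]
    refine ENNReal.tsum_le_tsum fun θ => ?_
    calc A.wt θ (2 * r) * A.XStarNormAt θ Set.univ (proj θ h) ^ 2
        ≤ A.wt θ (2 * c 0) * (A.wt θ (-(c 0 + ε / 2)) * (Q * N)) ^ 2 := by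
          gcongr
          · exact A.wt_mono θ (by linarith)
          · exact hsec θ
      _ = (A.wt θ (2 * c 0) * A.wt θ (2 * (-(c 0 + ε / 2)))) * (Q * N) ^ 2 := by
          rw [mul_pow, wt_sq]; ring
      _ = _ := by rw [← wt_add]; ring_nf
  unfold XStarNorm
  refine (ENNReal.rpow_le_rpow hsum (by norm_num)).trans (le_of_eq ?_)
  rw [ENNReal.mul_rpow_of_nonneg _ _ (by norm_num), ← ENNReal.rpow_natCast, ← ENNReal.rpow_mul]
  norm_num
  rw [trilinearConst, ← hQ, one_div]
  ring

end Setup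

/-! ### An explicit decaying test function -/

section Decay

/-- The decaying weight `(1 + ‖x‖)^{-k}`. -/
def decayWeight {E : Type*} [NormedAddCommGroup E] (k : ℕ) (x : E) : ℝ := ((1 + ‖x‖) ^ k)⁻¹

lemma decayWeight_pos {E : Type*} [NormedAddCommGroup E] (k : ℕ) (x : E) : 0 < decayWeight k x := by
  unfold decayWeight; positivity

lemma continuous_decayWeight {E : Type*} [NormedAddCommGroup E] (k : ℕ) :
    Continuous (decayWeight (E := E) k) :=
  Continuous.inv₀ (by fun_prop) fun x => by positivity

lemma decayWeight_le_one {E : Type*} [NormedAddCommGroup E] (k : ℕ) (x : E) :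
    decayWeight k x ≤ 1 :=
  inv_le_one_of_one_le₀ (one_le_pow₀ (by linarith [norm_nonneg x]))

/-- The weight is integrable and bounded by 1, hence dominates its own powers with exponent at least
1. -/
lemma eLpNorm_decayWeight_lt_top {E : Type*} [NormedAddCommGroup E] [NormedSpace ℝ E]
    [FiniteDimensional ℝ E] [MeasurableSpace E] [BorelSpace E] {μ : Measure E} [μ.IsAddHaarMeasure]
    {k : ℕ} (hk : Module.finrank ℝ E < k) {p : ℝ≥0∞} (hp : 1 ≤ p) :
    eLpNorm (decayWeight (E := E) k) p μ < ⊤ := by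
  have hmeas := (continuous_decayWeight (E := E) k).aestronglyMeasurable (μ := μ)
  have hint : Integrable (decayWeight (E := E) k) μ := by
    have := integrable_one_add_norm (E := E) (μ := μ) (r := (k : ℝ)) (by exact_mod_cast hk)
    refine this.congr (Eventually.of_forall fun x => ?_)
    have hx : (0 : ℝ) ≤ 1 + ‖x‖ := by positivity
    simp only [decayWeight, Real.rpow_neg hx, Real.rpow_natCast]
  by_cases htop : p = ⊤
  · subst htop
    exact (memLp_top_of_bound hmeas 1 (Eventually.of_forall fun x => by
      rw [Real.norm_of_nonneg (decayWeight_pos k x).le]; exact decayWeight_le_one k x)).2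
  · have hp0 : p ≠ 0 := (zero_lt_one.trans_le hp).ne'
    have hp1 : 1 ≤ p.toReal := by
      rw [← ENNReal.toReal_one]; exact ENNReal.toReal_mono htop hp
    rw [eLpNorm_lt_top_iff_lintegral_rpow_enorm_lt_top hp0 htop]
    refine lt_of_le_of_lt (lintegral_mono fun x => ?_) hint.2
    have h1 : ‖decayWeight k x‖ₑ ≤ 1 := by
      rw [← ofReal_norm, Real.norm_of_nonneg (decayWeight_pos k x).le, ← ENNReal.ofReal_one]
      exact ENNReal.ofReal_le_ofReal (decayWeight_le_one k x)
    calc ‖decayWeight k x‖ₑ ^ p.toReal ≤ ‖decayWeight k x‖ₑ ^ (1 : ℝ) :=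
          ENNReal.rpow_le_rpow_of_exponent_ge h1 hp1
      _ = _ := ENNReal.rpow_one _

lemma eLpNorm_le_of_enorm_le_mul {α E : Type*} [MeasurableSpace α] {μ : Measure α}
    [TopologicalSpace E] [ContinuousENorm E] {f : α → E} {φ : α → ℝ} {p : ℝ≥0∞} {C : ℝ}
    (hφ : eLpNorm φ p μ < ⊤) (h : ∀ x, ‖f x‖ₑ ≤ ‖C * φ x‖ₑ) :
    eLpNorm f p μ ≤ ‖C * (eLpNorm φ p μ).toReal‖ₑ := by
  refine (eLpNorm_mono_enorm h).trans ?_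
  have h1 : (fun x => C * φ x) = C • φ := rfl
  rw [h1, eLpNorm_const_smul, enorm_mul]
  refine mul_le_mul_right (le_of_eq ?_) _
  rw [Real.enorm_of_nonneg ENNReal.toReal_nonneg, ENNReal.ofReal_toReal hφ.ne]

variable {d : ℕ}

lemma norm_rot (O : Orth d) (y : Fin d → ℝ) : ‖rot O y‖ = ‖WithLp.toLp 2 y‖ := by
  have h := (Matrix.mem_orthogonalGroup_iff' (A := (O : Matrix (Fin d) (Fin d) ℝ))).1 O.2
  have h1 : (O : Matrix (Fin d) (Fin d) ℝ).mulVec y ⬝ᵥ (O : Matrix (Fin d) (Fin d) ℝ).mulVec y =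
      y ⬝ᵥ y := by
    rw [Matrix.dotProduct_mulVec, ← Matrix.mulVec_transpose, Matrix.mulVec_mulVec]
    rw [show (O : Matrix (Fin d) (Fin d) ℝ).transpose * (O : Matrix (Fin d) (Fin d) ℝ) = 1 from h,
      Matrix.one_mulVec]
  rw [EuclideanSpace.norm_eq, EuclideanSpace.norm_eq]
  congr 1
  simpa [dotProduct, rot, sq] using h1

lemma abs_le_norm_dirPoint (O : Orth d) (j : Fin d) (x₁ : ℝ) (x' : {k : Fin d // k ≠ j} → ℝ) :
    |x₁| ≤ ‖dirPoint O j x₁ x'‖ ∧ ‖x'‖ ≤ ‖dirPoint O j x₁ x'‖ := by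
  have h : ∀ k : Fin d, |if h : k = j then x₁ else x' ⟨k, h⟩| ≤ ‖dirPoint O j x₁ x'‖ := fun k => by
    rw [dirPoint, norm_rot]
    exact PiLp.norm_apply_le (WithLp.toLp 2 fun k => if h : k = j then x₁ else x' ⟨k, h⟩) k
  refine ⟨by simpa using h j, (pi_norm_le_iff_of_nonneg (norm_nonneg _)).2 fun k => ?_⟩
  have := h k.1
  rw [dif_neg k.2] at this
  exact this

/-- Splits the decay between `x₁` and `x'`. The exponent `2 + d` is later divided into `2` on the
line and `d` on the complementary `d - 1` dimensions, each just enough for integrability. -/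
lemma decayWeight_dirPoint_le (O : Orth d) (j : Fin d) (k l : ℕ) (x₁ : ℝ)
    (x' : {k : Fin d // k ≠ j} → ℝ) :
    decayWeight (k + l) (dirPoint O j x₁ x') ≤ decayWeight k x₁ * decayWeight l x' := by
  unfold decayWeight
  rw [← mul_inv, pow_add]
  obtain ⟨h1, h2⟩ := abs_le_norm_dirPoint O j x₁ x'
  rw [← Real.norm_eq_abs] at h1
  gcongr

/-- A space-time function decaying in all variables. -/
def decayField (d : ℕ) (t : ℝ) (x : Space d) : ℂ := ((decayWeight 2 t * decayWeight (2 + d) x : ℝ) : ℂ)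

lemma enorm_decayField (t : ℝ) (x : Space d) :
    ‖decayField d t x‖ₑ = ‖decayWeight 2 t * decayWeight (2 + d) x‖ₑ := by
  rw [decayField, ← ofReal_norm, Complex.norm_real, ofReal_norm]

lemma measurable_uncurry_decayField : Measurable (Function.uncurry (decayField d)) := by
  refine Complex.measurable_ofReal.comp ?_
  exact ((continuous_decayWeight 2).measurable.comp measurable_fst).mul
    ((continuous_decayWeight (2 + d)).measurable.comp measurable_snd)

lemma enorm_le_enorm_of_nonneg {a b : ℝ} (ha : 0 ≤ a) (h : a ≤ b) : ‖a‖ₑ ≤ ‖b‖ₑ := by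
  rw [Real.enorm_of_nonneg ha, Real.enorm_of_nonneg (ha.trans h)]
  exact ENNReal.ofReal_le_ofReal h

lemma mixedNorm_decayField_lt_top {p q : ℝ≥0∞} (hp : 1 ≤ p) (hq : 1 ≤ q) :
    mixedNorm q p Set.univ (decayField d) < ⊤ := by
  unfold mixedNorm
  rw [Measure.restrict_univ]
  have h1 : eLpNorm (decayWeight (E := Space d) (2 + d)) p volume < ⊤ :=
    eLpNorm_decayWeight_lt_top (by simp) hp
  have h2 : eLpNorm (decayWeight (E := ℝ) 2) q volume < ⊤ :=
    eLpNorm_decayWeight_lt_top (by simp) hq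
  have h3 : ∀ t, eLpNorm (decayField d t) p volume ≤
      ‖decayWeight 2 t * (eLpNorm (decayWeight (E := Space d) (2 + d)) p volume).toReal‖ₑ :=
    fun t => eLpNorm_le_of_enorm_le_mul h1 fun x => (enorm_decayField t x).le
  refine lt_of_le_of_lt (eLpNorm_le_of_enorm_le_mul
    (C := (eLpNorm (decayWeight (E := Space d) (2 + d)) p volume).toReal) h2 fun t => ?_)
    enorm_lt_top
  rw [enorm_eq_self, mul_comm]
  exact h3 t

lemma dirNorm_decayField_lt_top (O : Orth d) (j : Fin d) {a b c : ℝ≥0∞} (ha : 1 ≤ a) (hb : 1 ≤ b)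
    (hc : 1 ≤ c) : dirNorm O j a b c Set.univ (decayField d) < ⊤ := by
  unfold dirNorm
  rw [Measure.restrict_univ]
  have hcard : Module.finrank ℝ ({k : Fin d // k ≠ j} → ℝ) < d := by
    rw [Module.finrank_fintype_fun_eq_card]
    have := Fintype.card_subtype_lt (p := fun k : Fin d => k ≠ j) (x := j) (by simp)
    rwa [Fintype.card_fin] at this
  have h1 : eLpNorm (decayWeight (E := {k : Fin d // k ≠ j} → ℝ) d) c volume < ⊤ :=
    eLpNorm_decayWeight_lt_top hcard hc
  have h2 : eLpNorm (decayWeight (E := ℝ) 2) b volume < ⊤ :=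
    eLpNorm_decayWeight_lt_top (by simp) hb
  have h3 : eLpNorm (decayWeight (E := ℝ) 2) a volume < ⊤ :=
    eLpNorm_decayWeight_lt_top (by simp) ha
  set N₁ := (eLpNorm (decayWeight (E := {k : Fin d // k ≠ j} → ℝ) d) c volume).toReal
  set N₂ := (eLpNorm (decayWeight (E := ℝ) 2) b volume).toReal
  have e1 : ∀ x₁ t : ℝ, eLpNorm (fun x' : {k : Fin d // k ≠ j} → ℝ =>
      decayField d t (dirPoint O j x₁ x')) c volume ≤
      ‖decayWeight 2 t * decayWeight 2 x₁ * N₁‖ₑ := fun x₁ t => by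
    refine eLpNorm_le_of_enorm_le_mul h1 fun x' => ?_
    rw [enorm_decayField]
    refine enorm_le_enorm_of_nonneg (mul_pos (decayWeight_pos _ _) (decayWeight_pos _ _)).le ?_
    rw [mul_assoc]
    exact mul_le_mul_of_nonneg_left (decayWeight_dirPoint_le O j 2 d x₁ x') (decayWeight_pos _ _).le
  have e2 : ∀ x₁ : ℝ, eLpNorm (fun t : ℝ => eLpNorm (fun x' : {k : Fin d // k ≠ j} → ℝ =>
      decayField d t (dirPoint O j x₁ x')) c volume) b volume ≤
      ‖decayWeight 2 x₁ * N₁ * N₂‖ₑ := fun x₁ => by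
    refine eLpNorm_le_of_enorm_le_mul h2 fun t => ?_
    rw [enorm_eq_self]
    refine (e1 x₁ t).trans (le_of_eq ?_)
    congr 1
    ring
  refine lt_of_le_of_lt (eLpNorm_le_of_enorm_le_mul (C := N₁ * N₂) h3 fun x₁ => ?_) enorm_lt_top
  rw [enorm_eq_self]
  refine (e2 x₁).trans (le_of_eq ?_)
  congr 1
  ring

end Decay

/-! ### Existence of the product -/

namespace Setup

variable {d : ℕ} {σ ε₀ : ℝ} {A : Setup d σ ε₀}

lemma one_le_pBig (h0 : 0 < ε₀) (h1 : ε₀ < 1) : 1 ≤ pBig ε₀ := by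
  rw [pBig, ENNReal.one_le_ofReal, le_div_iff₀ h0]; linarith

lemma one_le_pTwo (h0 : 0 < ε₀) (h1 : ε₀ < 1) : 1 ≤ pTwo ε₀ := by
  rw [pTwo, ENNReal.one_le_ofReal, le_div_iff₀ (by linarith)]; linarith

lemma one_le_pStr (hd : (2 : ℝ) ≤ d) (h0 : 0 < ε₀) (h1 : ε₀ < 1) : 1 ≤ pStr d ε₀ := by
  have hpos : ENNReal.ofReal (2 * (d : ℝ)) ≠ 0 := (ENNReal.ofReal_pos.2 (by linarith)).ne'
  rw [pStr, ENNReal.le_div_iff_mul_le (Or.inr hpos) (Or.inl ENNReal.ofReal_ne_top), one_mul]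
  exact ENNReal.ofReal_le_ofReal (by nlinarith)

lemma wt_lt_top (θ : A.Θ.Index) (r : ℝ) : A.wt θ r < ⊤ := ENNReal.ofReal_lt_top

/-- Finiteness of the range of `basis` turns the smoothing part into a finite sum of finite terms.
-/
lemma XNormAt_decayField_lt_top (hfin : (Set.range A.basis).Finite) (hd : (2 : ℝ) ≤ d)
    (h0 : 0 < ε₀) (h1 : ε₀ < 1) (θ : A.Θ.Index) :
    A.XNormAt θ Set.univ (decayField d) < ⊤ := by
  have hB := one_le_pBig h0 h1
  have hT := one_le_pTwo h0 h1
  have hS := one_le_pStr hd h0 h1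
  have := hfin.fintype
  unfold XNormAt
  refine ENNReal.add_lt_top.2 ⟨ENNReal.add_lt_top.2 ⟨ENNReal.add_lt_top.2
    ⟨mixedNorm_decayField_lt_top hT hB, mixedNorm_decayField_lt_top hS hT⟩,
    ENNReal.sum_lt_top.2 fun j _ => ENNReal.add_lt_top.2
      ⟨ENNReal.mul_lt_top (wt_lt_top _ _) (dirNorm_decayField_lt_top _ _ hT hB hT),
      ENNReal.mul_lt_top (wt_lt_top _ _) (dirNorm_decayField_lt_top _ _ hT hB hB)⟩⟩, ?_⟩
  rw [tsum_fintype]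
  refine ENNReal.sum_lt_top.2 fun O _ => ?_
  have := Fintype.ofFinite (A.dominant θ O.1)
  rw [tsum_fintype]
  exact ENNReal.sum_lt_top.2 fun j _ => ENNReal.add_lt_top.2
      ⟨ENNReal.mul_lt_top (wt_lt_top _ _) (dirNorm_decayField_lt_top _ _ hB hT hT),
      ENNReal.mul_lt_top (wt_lt_top _ _) (dirNorm_decayField_lt_top _ _ hB hT hB)⟩

/-- The total mass of all products of sector components, against a polynomial weight. -/
def tripleMass (Θ : Sectors d) (z₁ z₂ z₃ : Field d) (t : ℝ) : ℝ≥0∞ :=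
  ∑' τ : Θ.Index × Θ.Index × Θ.Index,
    ∫⁻ x, ‖decayWeight (2 + d) x‖ₑ * ‖triple z₁ z₂ z₃ τ t x‖ₑ

/-- The quadrilinear bound is summable over all triples. Testing it with a fixed decaying function
gives a finite space-time integral, so the mass in space is finite at almost every time. -/
lemma ae_tripleMass_lt_top (hfin : (Set.range A.basis).Finite) (hσd : σ ≤ (d : ℝ))
    (hd : (2 : ℝ) ≤ d) (h0 : 0 < ε₀) (h1 : ε₀ < 1)
    {ε : ℝ} (hε : 0 < ε) {y m n : Fin 4 → Bool} {c : Fin 4 → ℝ} (H : Admissible d σ y m n c)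
    {z₁ z₂ z₃ : Field d} (hz₁ : z₁.IsMeasurable) (hz₂ : z₂.IsMeasurable) (hz₃ : z₃.IsMeasurable)
    (hN₁ : A.fieldNorm (y 1) (-c 1 + ε) z₁ < ⊤) (hN₂ : A.fieldNorm (y 2) (-c 2 + ε) z₂ < ⊤)
    (hN₃ : A.fieldNorm (y 3) (-c 3 + ε) z₃ < ⊤) :
    ∀ᵐ t : ℝ, tripleMass A.Θ z₁ z₂ z₃ t < ⊤ := by
  have hd0 : 0 < d := by
    have : (0 : ℝ) < d := by linarith
    exact_mod_cast this
  obtain ⟨e, he, -⟩ := A.Θ.cover (stdVec ⟨0, hd0⟩) (by simp [stdVec])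
  -- At scale 1 the sector satisfies the frequency condition with every triple, so that no triple is
  -- left out.
  set θ : A.Θ.Index := (0, ⟨e, he⟩) with hθ
  have hscale : Sectors.scale θ = 1 := by simp [Sectors.scale, hθ]
  have hm : ∀ τ : A.Θ.Index × A.Θ.Index × A.Θ.Index, Measurable fun p : ℝ × Space d =>
      ‖decayWeight (2 + d) p.2‖ₑ * ‖triple z₁ z₂ z₃ τ p.1 p.2‖ₑ := fun τ =>
    ((continuous_decayWeight (2 + d)).measurable.comp measurable_snd).enorm.mul
      (measurable_uncurry_triple hz₁ hz₂ hz₃ τ).enorm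
  have hmτ : ∀ τ : A.Θ.Index × A.Θ.Index × A.Θ.Index, Measurable fun t : ℝ =>
      ∫⁻ x, ‖decayWeight (2 + d) x‖ₑ * ‖triple z₁ z₂ z₃ τ t x‖ₑ := fun τ =>
    Measurable.lintegral_prod_right' (hm τ)
  have hmass : Measurable (tripleMass A.Θ z₁ z₂ z₃) := Measurable.tsum hmτ
  have hw : Measurable fun t : ℝ => ‖decayWeight 2 t‖ₑ :=
    (continuous_decayWeight 2).measurable.enorm
  have hbound : ∫⁻ t, ‖decayWeight 2 t‖ₑ * tripleMass A.Θ z₁ z₂ z₃ t < ⊤ := by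
    have e1 : ∫⁻ t, ‖decayWeight 2 t‖ₑ * tripleMass A.Θ z₁ z₂ z₃ t =
        ∑' τ : A.Θ.Index × A.Θ.Index × A.Θ.Index, ∫⁻ p : ℝ × Space d,
          ‖decayField d p.1 p.2‖ₑ * ‖triple z₁ z₂ z₃ τ p.1 p.2‖ₑ := by
      simp only [tripleMass, ← ENNReal.tsum_mul_left]
      have hmm : ∀ τ : A.Θ.Index × A.Θ.Index × A.Θ.Index, AEMeasurable (fun t : ℝ =>
          ‖decayWeight 2 t‖ₑ * ∫⁻ x, ‖decayWeight (2 + d) x‖ₑ * ‖triple z₁ z₂ z₃ τ t x‖ₑ) volume :=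
        fun τ => (hw.mul (hmτ τ)).aemeasurable
      rw [lintegral_tsum hmm]
      refine tsum_congr fun τ => ?_
      rw [Measure.volume_eq_prod, lintegral_prod _ (by
        exact (measurable_uncurry_decayField.enorm.mul
          (measurable_uncurry_triple hz₁ hz₂ hz₃ τ).enorm).aemeasurable)]
      refine lintegral_congr fun t => ?_
      rw [← lintegral_const_mul' _ _ enorm_ne_top]
      refine lintegral_congr fun x => ?_
      rw [enorm_decayField, enorm_mul, mul_assoc]
    rw [e1]
    refine lt_of_le_of_lt (ENNReal.tsum_le_tsum fun τ => lintegral_quadrilinear_le hσd hd h0 h1 hε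
      H θ τ.1 τ.2.1 τ.2.2 (Or.inl ?_) measurable_uncurry_decayField hz₁ hz₂ hz₃) ?_
    · rw [hscale]; linarith [Sectors.one_le_scale τ.1]
    · rw [ENNReal.tsum_mul_right, ENNReal.tsum_mul_left, tsum_wt_triple]
      refine ENNReal.mul_lt_top (ENNReal.mul_lt_top (ENNReal.mul_lt_top ENNReal.ofReal_lt_top
        (wt_lt_top _ _)) (ENNReal.pow_lt_top (A.tsum_wt_neg_lt_top (half_pos hε))))
        (ENNReal.mul_lt_top (XNormAt_decayField_lt_top hfin hd h0 h1 θ)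
        (ENNReal.mul_lt_top (ENNReal.mul_lt_top hN₁ hN₂) hN₃))
  filter_upwards [ae_lt_top (hw.mul hmass) hbound.ne] with t ht
  by_contra hcon
  rw [not_lt, top_le_iff] at hcon
  rw [Pi.mul_apply, hcon, ENNReal.mul_top (by simpa using (decayWeight_pos 2 t).ne')] at ht
  exact lt_irrefl _ ht

lemma norm_le_decayWeight_mul (φ : 𝓢(Space d, ℂ)) (k : ℕ) (x : Space d) :
    ‖φ x‖ ≤ decayWeight k x *
      (2 ^ k * (Finset.Iic (k, 0)).sup (schwartzSeminormFamily ℂ (Space d) ℂ) φ) := by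
  have h := SchwartzMap.one_add_le_sup_seminorm_apply (𝕜 := ℂ) (m := (k, 0)) le_rfl le_rfl φ x
  rw [norm_iteratedFDeriv_zero] at h
  rw [decayWeight, inv_mul_eq_div, le_div_iff₀ (by positivity), mul_comm]
  exact h

lemma enorm_integral_triple_mul_le {Θ : Sectors d} (z₁ z₂ z₃ : Field d)
    (τ : Θ.Index × Θ.Index × Θ.Index) (t : ℝ) (φ : 𝓢(Space d, ℂ)) :
    ‖∫ x, triple z₁ z₂ z₃ τ t x * φ x‖ₑ ≤
      (∫⁻ x, ‖decayWeight (2 + d) x‖ₑ * ‖triple z₁ z₂ z₃ τ t x‖ₑ) * ENNReal.ofReal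
        (2 ^ (2 + d) * (Finset.Iic (2 + d, 0)).sup (schwartzSeminormFamily ℂ (Space d) ℂ) φ) := by
  refine (enorm_integral_le_lintegral_enorm _).trans ?_
  rw [← lintegral_mul_const' _ _ ENNReal.ofReal_ne_top]
  refine lintegral_mono fun x => ?_
  rw [enorm_mul, mul_comm, mul_right_comm]
  refine mul_le_mul_left ?_ _
  rw [← ofReal_norm, Real.enorm_of_nonneg (decayWeight_pos _ _).le,
    ← ENNReal.ofReal_mul (decayWeight_pos _ _).le]
  exact ENNReal.ofReal_le_ofReal (norm_le_decayWeight_mul φ (2 + d) x)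

/-- Absolute convergence together with a bound by one Schwartz seminorm, which is what makes the sum
a tempered distribution. -/
lemma summable_integral_triple_mul {Θ : Sectors d} {z₁ z₂ z₃ : Field d} {t : ℝ}
    (ht : tripleMass Θ z₁ z₂ z₃ t < ⊤) (φ : 𝓢(Space d, ℂ)) :
    Summable (fun τ : Θ.Index × Θ.Index × Θ.Index => ∫ x, triple z₁ z₂ z₃ τ t x * φ x) ∧
      ‖∑' τ : Θ.Index × Θ.Index × Θ.Index, ∫ x, triple z₁ z₂ z₃ τ t x * φ x‖ ≤
        ((tripleMass Θ z₁ z₂ z₃ t).toReal * 2 ^ (2 + d)) *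
          (Finset.Iic (2 + d, 0)).sup (schwartzSeminormFamily ℂ (Space d) ℂ) φ := by
  set S := 2 ^ (2 + d) * (Finset.Iic (2 + d, 0)).sup (schwartzSeminormFamily ℂ (Space d) ℂ) φ
    with hS
  have hS0 : 0 ≤ S := by positivity
  have hle : ∑' τ : Θ.Index × Θ.Index × Θ.Index, ‖∫ x, triple z₁ z₂ z₃ τ t x * φ x‖ₑ ≤
      tripleMass Θ z₁ z₂ z₃ t * ENNReal.ofReal S := by
    rw [tripleMass, ← ENNReal.tsum_mul_right]
    exact ENNReal.tsum_le_tsum fun τ => enorm_integral_triple_mul_le z₁ z₂ z₃ τ t φ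
  have hlt := ENNReal.mul_lt_top ht (ENNReal.ofReal_lt_top (r := S))
  have hsum : Summable fun τ : Θ.Index × Θ.Index × Θ.Index =>
      ‖∫ x, triple z₁ z₂ z₃ τ t x * φ x‖ := by
    have := ENNReal.summable_toReal (hle.trans_lt hlt).ne
    simpa using this
  refine ⟨hsum.of_norm, (norm_tsum_le_tsum_norm hsum).trans ?_⟩
  rw [mul_assoc, ← hS]
  have h2 := ENNReal.toReal_mono hlt.ne hle
  rw [ENNReal.tsum_toReal_eq (fun _ => enorm_ne_top), ENNReal.toReal_mul,
    ENNReal.toReal_ofReal hS0] at h2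
  simpa using h2

/-- The sum of all products of sector components, as a tempered distribution. -/
def tripleSum {Θ : Sectors d} (z₁ z₂ z₃ : Field d) (t : ℝ) (ht : tripleMass Θ z₁ z₂ z₃ t < ⊤) :
    𝓢'(Space d, ℂ) :=
  ContinuousLinearMap.toPointwiseConvergenceCLM _ _ _ _
    (SchwartzMap.mkCLMtoNormedSpace (𝕜 := ℂ) (σ := RingHom.id ℂ)
      (fun φ : 𝓢(Space d, ℂ) => ∑' τ : Θ.Index × Θ.Index × Θ.Index,
        ∫ x, triple z₁ z₂ z₃ τ t x * φ x)
      (fun φ ψ => by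
        rw [← (summable_integral_triple_mul ht φ).1.tsum_add (summable_integral_triple_mul ht ψ).1]
        refine tsum_congr fun τ => ?_
        rw [← integral_add (integrable_triple_mul z₁ z₂ z₃ τ t φ)
          (integrable_triple_mul z₁ z₂ z₃ τ t ψ)]
        simp only [add_apply, mul_add])
      (fun a φ => by
        rw [RingHom.id_apply, smul_eq_mul, ← tsum_mul_left]
        refine tsum_congr fun τ => ?_
        rw [← integral_const_mul]
        simp only [smul_apply, smul_eq_mul, mul_left_comm])
      ⟨Finset.Iic (2 + d, 0), (tripleMass Θ z₁ z₂ z₃ t).toReal * 2 ^ (2 + d), by positivity,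
        fun φ => (summable_integral_triple_mul ht φ).2⟩)

lemma tendsto_lowTriples (Θ : Sectors d) : Tendsto (lowTriples Θ) atTop atTop := by
  refine tendsto_atTop_finset_of_monotone (fun M M' h τ hτ => ?_) fun τ =>
    ⟨max τ.1.1 (max τ.2.1.1 τ.2.2.1), ?_⟩
  · simp only [lowTriples, lowSectors, Finset.mem_product, Finset.mem_range] at hτ ⊢
    have h' : M ≤ M' := h
    refine ⟨⟨?_, hτ.1.2⟩, ⟨?_, hτ.2.1.2⟩, ?_, hτ.2.2.2⟩ <;> omega
  · simp [lowTriples, lowSectors]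

-- The truncated products are partial sums over cubes of triples that exhaust the index set, so
-- unconditional summability gives their limit. The value on the null set of times is arbitrary.
open Classical in
lemma exists_isProduct {Θ : Sectors d} {z₁ z₂ z₃ : Field d}
    (h : ∀ᵐ t : ℝ, tripleMass Θ z₁ z₂ z₃ t < ⊤) : ∃ h : Field d, IsProduct Θ z₁ z₂ z₃ h := by
  refine ⟨fun t => if ht : tripleMass Θ z₁ z₂ z₃ t < ⊤ then tripleSum z₁ z₂ z₃ t ht else 0, ?_⟩
  filter_upwards [h] with t ht φ
  rw [dif_pos ht]
  simp_rw [integral_lowFreq_mul]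
  exact (summable_integral_triple_mul ht φ).1.hasSum.comp (tendsto_lowTriples Θ)

end Setup

namespace Setup

variable {d : ℕ} {σ ε₀ : ℝ} {A : Setup d σ ε₀}

lemma productBound_of_admissible (hfin : (Set.range A.basis).Finite) (hσd : σ ≤ (d : ℝ))
    (hd : (2 : ℝ) ≤ d) (h0 : 0 < ε₀) (h1 : ε₀ < 1) {ε : ℝ} (hε : 0 < ε) {y m n : Fin 4 → Bool}
    {c : Fin 4 → ℝ} (H : Admissible d σ y m n c) {κ : ℝ≥0}
    (hκ : ∀ θ : A.Θ.Index, ∫⁻ w, ‖(𝓕 (Sectors.multSchwartz θ) : 𝓢(Space d, ℂ)) w‖ₑ ≤ κ)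
    {C : ℝ≥0} (hC : trilinearConst A κ ε c ≤ C) {r : ℝ} (hr : r ≤ c 0)
    {z₁ z₂ z₃ : Field d} (hz₁ : z₁.IsMeasurable) (hz₂ : z₂.IsMeasurable)
    (hz₃ : z₃.IsMeasurable) (hN₁ : A.fieldNorm (y 1) (-c 1 + ε) z₁ < ⊤)
    (hN₂ : A.fieldNorm (y 2) (-c 2 + ε) z₂ < ⊤) (hN₃ : A.fieldNorm (y 3) (-c 3 + ε) z₃ < ⊤) :
    A.ProductBound r z₁ z₂ z₃ (C * (A.fieldNorm (y 1) (-c 1 + ε) z₁ *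
      A.fieldNorm (y 2) (-c 2 + ε) z₂ * A.fieldNorm (y 3) (-c 3 + ε) z₃)) :=
  ⟨exists_isProduct (ae_tripleMass_lt_top hfin hσd hd h0 h1 hε H hz₁ hz₂ hz₃ hN₁ hN₂ hN₃),
    fun _ hh => (XStarNorm_le_of_isProduct hσd hd h0 h1 hε H hκ hz₁ hz₂ hz₃ hh hr).trans
      (mul_le_mul_left hC _)⟩

/-! ### Exponent inequalities in the four cases -/

section Admissible

variable {S₁ S₂ S₃ s : ℝ}

/-- Only the dual function is an `X` factor, so any pairing loses just `σ/4` twice. The threshold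
`1/3 - σ/4` comes from `three` at `l = 0`, the output having the lowest frequency: there `S₁ + S₂ +
S₃ ≥ 1 - 3σ/4` is required. -/
lemma admissible_zzz (hσ : 2 ≤ σ) (hS₁ : 1 / 3 - σ / 4 < S₁) (hS₁₂ : S₁ ≤ S₂) (hS₂₃ : S₂ ≤ S₃) :
    Admissible d σ ![false, true, true, true] (fun _ => true) (fun _ => true)
      ![S₁ + min S₂ (σ / 4) + min S₃ (σ / 4) + (σ - 2) / 2, -S₁, -S₂, -S₃] where
  dual := rfl
  pairable := by unfold Pairable; decide
  one i hi := by
    fin_cases i <;> simp at hi ⊢ <;> linarith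
  two i j hij := by
    rcases min_cases S₂ (σ / 4) with ⟨e, h⟩ | ⟨e, h⟩ <;>
    rcases min_cases S₃ (σ / 4) with ⟨e', h'⟩ | ⟨e', h'⟩ <;>
    rw [e, e'] <;>
    fin_cases i <;> fin_cases j <;> simp at hij ⊢ <;> linarith
  three l := by
    rcases min_cases S₂ (σ / 4) with ⟨e, h⟩ | ⟨e, h⟩ <;>
    rcases min_cases S₃ (σ / 4) with ⟨e', h'⟩ | ⟨e', h'⟩ <;>
    rw [e, e'] <;>
    fin_cases l <;> simp [Fin.sum_univ_four, lossExp] <;> linarith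
  four l := by
    rcases min_cases S₂ (σ / 4) with ⟨e, h⟩ | ⟨e, h⟩ <;>
    rcases min_cases S₃ (σ / 4) with ⟨e', h'⟩ | ⟨e', h'⟩ <;>
    rw [e, e'] <;>
    fin_cases l <;> simp [Fin.sum_univ_four, lossExp] <;> linarith

/-- Of the two possible pairings, at least one does not put the two `X` factors, indices `0` and
`3`, into the same pair. All losses are therefore again `σ/4`. -/
lemma admissible_zzv (hσ : 2 ≤ σ) (hS₁ : 1 / 3 - σ / 4 < S₁) (hS₁₂ : S₁ ≤ S₂)
    (hS₂ : S₂ < ((d : ℝ) - σ) / 2) (hs : ((d : ℝ) - σ) / 2 < s) :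
    Admissible d σ ![false, true, true, false] (fun _ => true) (fun _ => true)
      ![S₁ + min S₂ (σ / 4) + min s (σ / 4) + (σ - 2) / 2, -S₁, -S₂, -s] where
  dual := rfl
  pairable := by unfold Pairable; decide
  one i hi := by
    fin_cases i <;> simp at hi ⊢ <;> linarith
  two i j hij := by
    rcases min_cases S₂ (σ / 4) with ⟨e, h⟩ | ⟨e, h⟩ <;>
    rcases min_cases s (σ / 4) with ⟨e', h'⟩ | ⟨e', h'⟩ <;>
    rw [e, e'] <;>
    fin_cases i <;> fin_cases j <;> simp at hij ⊢ <;> linarith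
  three l := by
    rcases min_cases S₂ (σ / 4) with ⟨e, h⟩ | ⟨e, h⟩ <;>
    rcases min_cases s (σ / 4) with ⟨e', h'⟩ | ⟨e', h'⟩ <;>
    rw [e, e'] <;>
    fin_cases l <;> simp [Fin.sum_univ_four, lossExp] <;> linarith
  four l := by
    rcases min_cases S₂ (σ / 4) with ⟨e, h⟩ | ⟨e, h⟩ <;>
    rcases min_cases s (σ / 4) with ⟨e', h'⟩ | ⟨e', h'⟩ <;>
    rw [e, e'] <;>
    fin_cases l <;> simp [Fin.sum_univ_four, lossExp] <;> linarith

/-- With a single `Y` factor, one pair necessarily loses `(d-1)/2`. The pairing assigns this loss to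
the lowest frequency, unless that is the `Y` factor itself, in which case it falls on the third. The
term `S₁ + σ - 1` comes from `two` for the output and `z₁`. The alternatives `σ/4` and `S₁` in the
other term come from `three` at `l = 1` and from `four`. -/
lemma admissible_zvv (hσ : 2 ≤ σ) (hσd : σ ≤ (d : ℝ)) (hS₁ : 1 / 3 - σ / 4 < S₁)
    (hS₁' : S₁ < ((d : ℝ) - σ) / 2) (hs : ((d : ℝ) - σ) / 2 < s) :
    Admissible d σ ![false, true, false, false] (fun l => l ≠ 1) (fun l => l = 1)
      ![min (2 * s - ((d : ℝ) - σ) / 2 + (σ - 2) / 4 + min (σ / 4) S₁) (S₁ + σ - 1),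
        -S₁, -s, -s] where
  dual := rfl
  pairable := by unfold Pairable; decide
  one i hi := by
    fin_cases i <;> simp at hi ⊢ <;> linarith
  two i j hij := by
    have h1 := min_le_left (2 * s - ((d : ℝ) - σ) / 2 + (σ - 2) / 4 + min (σ / 4) S₁) (S₁ + σ - 1)
    have h2 := min_le_right (2 * s - ((d : ℝ) - σ) / 2 + (σ - 2) / 4 + min (σ / 4) S₁) (S₁ + σ - 1)
    have h3 := min_le_left (σ / 4) S₁
    have h4 := min_le_right (σ / 4) S₁
    generalize min (2 * s - ((d : ℝ) - σ) / 2 + (σ - 2) / 4 + min (σ / 4) S₁) (S₁ + σ - 1) = a at *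
    fin_cases i <;> fin_cases j <;> simp at hij ⊢ <;> linarith
  three l := by
    have h1 := min_le_left (2 * s - ((d : ℝ) - σ) / 2 + (σ - 2) / 4 + min (σ / 4) S₁) (S₁ + σ - 1)
    have h2 := min_le_right (2 * s - ((d : ℝ) - σ) / 2 + (σ - 2) / 4 + min (σ / 4) S₁) (S₁ + σ - 1)
    have h3 := min_le_left (σ / 4) S₁
    have h4 := min_le_right (σ / 4) S₁
    generalize min (2 * s - ((d : ℝ) - σ) / 2 + (σ - 2) / 4 + min (σ / 4) S₁) (S₁ + σ - 1) = a at *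
    fin_cases l <;> simp [Fin.sum_univ_four, lossExp] <;> linarith
  four l := by
    have h1 := min_le_left (2 * s - ((d : ℝ) - σ) / 2 + (σ - 2) / 4 + min (σ / 4) S₁) (S₁ + σ - 1)
    have h2 := min_le_right (2 * s - ((d : ℝ) - σ) / 2 + (σ - 2) / 4 + min (σ / 4) S₁) (S₁ + σ - 1)
    have h3 := min_le_left (σ / 4) S₁
    have h4 := min_le_right (σ / 4) S₁
    generalize min (2 * s - ((d : ℝ) - σ) / 2 + (σ - 2) / 4 + min (σ / 4) S₁) (S₁ + σ - 1) = a at *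
    fin_cases l <;> simp [Fin.sum_univ_four, lossExp] <;> linarith

/-- Both losses are `(d-1)/2`. Then `four` is an equality, which fixes the output regularity, and
the upper bound on `s` is what `two` needs for the output paired with an input. -/
lemma admissible_vvv (hσd : σ ≤ (d : ℝ)) (hs : ((d : ℝ) - σ) / 2 < s)
    (hs' : s < ((d : ℝ) - σ) / 2 + (σ - 1) / 2) :
    Admissible d σ ![false, false, false, false] (fun _ => false) (fun _ => false)
      ![s + 2 * (s - ((d : ℝ) - σ) / 2), -s, -s, -s] where
  dual := rfl
  pairable := by unfold Pairable; decide
  one i hi := by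
    fin_cases i <;> simp at hi ⊢ <;> linarith
  two i j hij := by
    fin_cases i <;> fin_cases j <;> simp at hij ⊢ <;> linarith
  three l := by
    fin_cases l <;> simp [Fin.sum_univ_four, lossExp] <;> linarith
  four l := by
    fin_cases l <;> simp [Fin.sum_univ_four, lossExp] <;> linarith

end Admissible

end Setup

end DirectionalNLS

end

theorem proposition5p3 (d : ℕ) (σ : ℝ) (hσ : 2 ≤ σ) (hσd : σ ≤ (d : ℝ))
    (S₁ S₂ S₃ s : ℝ) (hS₁ : 1 / 3 - σ / 4 < S₁) (hS₁₂ : S₁ ≤ S₂) (hS₂₃ : S₂ ≤ S₃)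
    (hS₃ : S₃ < ((d : ℝ) - σ) / 2) (hs : ((d : ℝ) - σ) / 2 < s) :
    ∃ ε₁ : ℝ, 0 < ε₁ ∧ ∀ ε : ℝ, 0 < ε → ε < ε₁ →
    ∃ ε₂ : ℝ, 0 < ε₂ ∧ ∀ ε₀ : ℝ, 0 < ε₀ → ε₀ < ε₂ →
    ∀ (A : DirectionalNLS.Setup d σ ε₀) (Cmax CL CO : ℝ),
      DirectionalNLS.IsSymbol σ A.m Cmax CL → A.IsAdapted Cmax CO →
    ∃ C : ℝ≥0,
      -- case zzz
      (∀ r : ℝ, r ≤ S₁ + min S₂ (σ / 4) + min S₃ (σ / 4) + (σ - 2) / 2 →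
        ∀ z₁ z₂ z₃ : DirectionalNLS.Field d,
          z₁.IsMeasurable → z₂.IsMeasurable → z₃.IsMeasurable →
          A.YNorm (S₁ + ε) Set.univ z₁ < ⊤ → A.YNorm (S₂ + ε) Set.univ z₂ < ⊤ →
          A.YNorm (S₃ + ε) Set.univ z₃ < ⊤ →
          A.ProductBound r z₁ z₂ z₃
            (C * (A.YNorm (S₁ + ε) Set.univ z₁ * A.YNorm (S₂ + ε) Set.univ z₂ *
              A.YNorm (S₃ + ε) Set.univ z₃))) ∧
      -- case zzv
      (∀ r : ℝ, r ≤ S₁ + min S₂ (σ / 4) + min s (σ / 4) + (σ - 2) / 2 →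
        ∀ z₁ z₂ v₃ : DirectionalNLS.Field d,
          z₁.IsMeasurable → z₂.IsMeasurable → v₃.IsMeasurable →
          A.YNorm (S₁ + ε) Set.univ z₁ < ⊤ → A.YNorm (S₂ + ε) Set.univ z₂ < ⊤ →
          A.XNorm (s + ε) Set.univ v₃ < ⊤ →
          A.ProductBound r z₁ z₂ v₃
            (C * (A.YNorm (S₁ + ε) Set.univ z₁ * A.YNorm (S₂ + ε) Set.univ z₂ *
              A.XNorm (s + ε) Set.univ v₃))) ∧
      -- case zvv
      (∀ r : ℝ, r ≤ min (2 * s - ((d : ℝ) - σ) / 2 + (σ - 2) / 4 + min (σ / 4) S₁) (S₁ + σ - 1) →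
        ∀ z₁ v₂ v₃ : DirectionalNLS.Field d,
          z₁.IsMeasurable → v₂.IsMeasurable → v₃.IsMeasurable →
          A.YNorm (S₁ + ε) Set.univ z₁ < ⊤ → A.XNorm (s + ε) Set.univ v₂ < ⊤ →
          A.XNorm (s + ε) Set.univ v₃ < ⊤ →
          A.ProductBound r z₁ v₂ v₃
            (C * (A.YNorm (S₁ + ε) Set.univ z₁ * A.XNorm (s + ε) Set.univ v₂ *
              A.XNorm (s + ε) Set.univ v₃))) ∧
      -- case vvv
      (s < ((d : ℝ) - σ) / 2 + (σ - 1) / 2 →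
        ∀ r : ℝ, r ≤ s + 2 * (s - ((d : ℝ) - σ) / 2) →
        ∀ v₁ v₂ v₃ : DirectionalNLS.Field d,
          v₁.IsMeasurable → v₂.IsMeasurable → v₃.IsMeasurable →
          A.XNorm (s + ε) Set.univ v₁ < ⊤ → A.XNorm (s + ε) Set.univ v₂ < ⊤ →
          A.XNorm (s + ε) Set.univ v₃ < ⊤ →
          A.ProductBound r v₁ v₂ v₃
            (C * (A.XNorm (s + ε) Set.univ v₁ * A.XNorm (s + ε) Set.univ v₂ *
              A.XNorm (s + ε) Set.univ v₃))) := by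
  have hd : (2 : ℝ) ≤ d := hσ.trans hσd
  -- Both thresholds can be 1: any positive `ε` makes the sums converge, and `0 < ε₀ < 1` is all
  -- that the complementary Hölder exponents require.
  refine ⟨1, one_pos, fun ε hε _ => ⟨1, one_pos, fun ε₀ h0 h1 A Cmax CL CO _ hA => ?_⟩⟩
  obtain ⟨κ, hκ⟩ := DirectionalNLS.Sectors.exists_lintegral_kernel_le A.Θ
  have hfin := hA.finite_range
  have hlt := fun c => (A.trilinearConst_lt_top κ hε c).ne
  have hSs := hS₃.trans hs
  have Hzzz := DirectionalNLS.Setup.admissible_zzz (d := d) hσ hS₁ hS₁₂ hS₂₃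
  have Hzzv := DirectionalNLS.Setup.admissible_zzv hσ hS₁ hS₁₂ (hS₂₃.trans_lt hS₃) hs
  have Hzvv := DirectionalNLS.Setup.admissible_zvv hσ hσd hS₁
    ((hS₁₂.trans hS₂₃).trans_lt hS₃) hs
  set c₁ : Fin 4 → ℝ :=
    ![S₁ + min S₂ (σ / 4) + min S₃ (σ / 4) + (σ - 2) / 2, -S₁, -S₂, -S₃] with hc₁
  set c₂ : Fin 4 → ℝ :=
    ![S₁ + min S₂ (σ / 4) + min s (σ / 4) + (σ - 2) / 2, -S₁, -S₂, -s] with hc₂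
  set c₃ : Fin 4 → ℝ :=
    ![min (2 * s - ((d : ℝ) - σ) / 2 + (σ - 2) / 4 + min (σ / 4) S₁) (S₁ + σ - 1),
      -S₁, -s, -s] with hc₃
  set c₄ : Fin 4 → ℝ := ![s + 2 * (s - ((d : ℝ) - σ) / 2), -s, -s, -s] with hc₄
  -- The common constant is the sum of the four case constants. It is independent of `r`, which
  -- enters only through `r ≤ c 0`.
  set T := fun c => (A.trilinearConst κ ε c).toNNReal with hT
  have hle : ∀ c, T c ≤ T c₁ + T c₂ + T c₃ + T c₄ →
      A.trilinearConst κ ε c ≤ (T c₁ + T c₂ + T c₃ + T c₄ : ℝ≥0) := fun c h => by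
    rw [← ENNReal.coe_toNNReal (hlt c)]
    exact ENNReal.coe_le_coe.2 h
  refine ⟨T c₁ + T c₂ + T c₃ + T c₄, fun r hr z₁ z₂ z₃ m₁ m₂ m₃ n₁ n₂ n₃ => ?_,
    fun r hr z₁ z₂ z₃ m₁ m₂ m₃ n₁ n₂ n₃ => ?_, fun r hr z₁ z₂ z₃ m₁ m₂ m₃ n₁ n₂ n₃ => ?_,
    fun hs' r hr z₁ z₂ z₃ m₁ m₂ m₃ n₁ n₂ n₃ => ?_⟩
  · simpa [DirectionalNLS.Setup.fieldNorm, hc₁] using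
      DirectionalNLS.Setup.productBound_of_admissible hfin hσd hd h0 h1 hε Hzzz hκ
        (hle c₁ (by rw [add_assoc, add_assoc]; exact le_self_add)) hr m₁ m₂ m₃
        (by simpa [DirectionalNLS.Setup.fieldNorm, hc₁] using n₁)
        (by simpa [DirectionalNLS.Setup.fieldNorm, hc₁] using n₂)
        (by simpa [DirectionalNLS.Setup.fieldNorm, hc₁] using n₃)
  · simpa [DirectionalNLS.Setup.fieldNorm, hc₂] using
      DirectionalNLS.Setup.productBound_of_admissible hfin hσd hd h0 h1 hε Hzzv hκ
        (hle c₂ (by rw [add_assoc]; exact le_add_self.trans le_self_add)) hr m₁ m₂ m₃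
        (by simpa [DirectionalNLS.Setup.fieldNorm, hc₂] using n₁)
        (by simpa [DirectionalNLS.Setup.fieldNorm, hc₂] using n₂)
        (by simpa [DirectionalNLS.Setup.fieldNorm, hc₂] using n₃)
  · simpa [DirectionalNLS.Setup.fieldNorm, hc₃] using
      DirectionalNLS.Setup.productBound_of_admissible hfin hσd hd h0 h1 hε Hzvv hκ
        (hle c₃ (le_add_self.trans le_self_add)) hr m₁ m₂ m₃
        (by simpa [DirectionalNLS.Setup.fieldNorm, hc₃] using n₁)
        (by simpa [DirectionalNLS.Setup.fieldNorm, hc₃] using n₂)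
        (by simpa [DirectionalNLS.Setup.fieldNorm, hc₃] using n₃)
  · have Hvvv := DirectionalNLS.Setup.admissible_vvv hσd hs hs'
    simpa [DirectionalNLS.Setup.fieldNorm, hc₄] using
      DirectionalNLS.Setup.productBound_of_admissible hfin hσd hd h0 h1 hε Hvvv hκ
        (hle c₄ le_add_self) hr m₁ m₂ m₃
        (by simpa [DirectionalNLS.Setup.fieldNorm, hc₄] using n₁)
        (by simpa [DirectionalNLS.Setup.fieldNorm, hc₄] using n₂)
        (by simpa [DirectionalNLS.Setup.fieldNorm, hc₄] using n₃)
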